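/- **Model.** Fix $a<b$, $y_0\in\mathbb R$, $0<\varepsilon<1$, $L>0$, $0<\mu_0<1$. For $n\ge 1$ observe $y_1,\dots,y_n$ with $$y_k=S(x_k)\,y_{k-1}+\xi_k,\qquad x_k=a+\frac{k(b-a)}{n},$$ where $y_0$ is the given constant and $\xi_1,\xi_2,\dots$ are i.i.d. with an unknown density $p\in\mathcal P_n$. Here $\mathcal P_n$ is the set of densities $p$ with $\int xp(x)\,dx=0$, $\int x^2p(x)\,dx=1$ and $\int |x|^{2k}p(x)\,dx\le\varsigma(n)^k(2k-1)!!$ for all $k\ge1$, where $\varsigma(n)\ge1$ and $\varsigma(n)=o(n^{\check\delta})$ for every $\check\delta>0$. The function $S$ belongs to $$\Theta_{\varepsilon,L}=\Bigl\{S\in C^1([a,b],\mathbb R):\ \sup_{[a,b]}|S|\le1-\varepsilon,\ \sup_{[a,b]}|S'|\le L\Bigr\}.$$ For an estimator $\widehat S$ put $\mathcal R_p(\widehat S,S)=\mathbf E_{p,S}\int_a^b(\widehat S(x)-S(x))^2dx$ and $\mathcal R^*(\widehat S,S)=\sup_{p\in\mathcal P_n}\mathcal R_p(\widehat S,S)\in[0,\infty]$.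 **Sequential procedures.** Let $d=[\sqrt n]$, $z_l=a+\frac ld(b-a)$, $h=\frac{b-a}{2d}$, $\widetilde z_l=\frac{z_l-a}{b-a}$, $\widetilde h=\frac h{b-a}$, $Q_{l,j}=\mathbf 1_{\{|x_j-z_l|\le h\}}$, $k_{1,l}=[n\widetilde z_l-n\widetilde h]+1$, $k_{2,l}=[n\widetilde z_l+n\widetilde h]\wedge n$, $\iota_l=k_{1,l}+[(n\widetilde h)^{\mu_0}]$, $\widetilde\epsilon=\frac1{2+\ln n}$, and $A^{(l)}_{k,m}=\sum_{j=k+1}^mQ_{l,j}y_{j-1}^2$. Let $$\widehat S_{\iota_l}=\frac{\sum_{j=1}^{\iota_l}Q_{l,j}y_{j-1}y_j}{A^{(l)}_{0,\iota_l}},\qquad \widetilde S_{\iota_l}=\min(\max(\widehat S_{\iota_l},-1+\widetilde\epsilon),1-\widetilde\epsilon),\qquad H_l=\frac{1-\widetilde\epsilon}{1-\widetilde S_{\iota_l}^2}(k_{2,l}-\iota_l-1).$$ Let $\tau_l=\inf\{\iota_l+1\le k\le k_{2,l}:A^{(l)}_{\iota_l,k}\ge H_l\}$ (with $\inf\emptyset=k_{2,l}$),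 $\Gamma_l=\{H_l>0,\ A^{(l)}_{\iota_l,k_{2,l}-1}\ge H_l\}$ and $\Gamma=\bigcap_{l=1}^d\Gamma_l$. (For fixed $\mu_0$, $H_l>0$ holds automatically for all $l$ once $n$ is large.) On $\Gamma_l$ let $0<\varkappa_l\le1$ be defined by $A^{(l)}_{\iota_l,\tau_l-1}+\varkappa_l^2Q_{l,\tau_l}y_{\tau_l-1}^2=H_l$, and set $$Y_l=\mathbf 1_\Gamma\,\frac1{H_l}\Bigl(\sum_{j=\iota_l+1}^{\tau_l-1}Q_{l,j}y_{j-1}y_j+\varkappa_lQ_{l,\tau_l}y_{\tau_l-1}y_{\tau_l}\Bigr),\qquad \sigma_l^2=\frac1{H_l},\qquad 1\le l\le d .$$ **Model selection.** Let $\phi_1,\dots,\phi_d$ be functions on $[a,b]$ that are orthonormal for $(f,g)_d=\frac{b-a}d\sum_{l=1}^df(z_l)g(z_l)$, and let $\Lambda\subset[0,1]^d$ be a finite nonempty set of weight vectors with cardinality $\nu(n)$, where $\nu(n)=o(n^{\check\delta})$ for every $\check\delta>0$. Put $\widehat\theta_j=\frac{b-a}d\sum_lY_l\phi_j(z_l)$,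 $\mathbf s_j=\frac{b-a}d\sum_l\sigma_l^2\phi_j^2(z_l)$, $\widetilde\theta_j=\widehat\theta_j^2-\frac{b-a}d\mathbf s_j$. For $\lambda\in\Lambda$ let $\widehat S_\lambda(z_l)=\mathbf 1_\Gamma\sum_{j=1}^d\lambda(j)\widehat\theta_j\phi_j(z_l)$, and extend $\widehat S_\lambda$ to $[a,b]$ as the step function equal to $\widehat S_\lambda(z_1)$ on $[a,z_1]$ and to $\widehat S_\lambda(z_l)$ on $(z_{l-1},z_l]$, $2\le l\le d$. For $0<\delta\le1/12$ let $$J_d(\lambda)=\sum_{j=1}^d\lambda^2(j)\widehat\theta_j^2-2\sum_{j=1}^d\lambda(j)\widetilde\theta_j+\delta\,\frac{b-a}d\sum_{j=1}^d\lambda^2(j)\mathbf s_j ,$$ let $\widehat\lambda$ be any random vector, measurable with respect to the observations, with $\widehat\lambda\in\operatorname{argmin}_{\lambda\in\Lambda}J_d(\lambda)$, and let $\widehat S_*=\widehat S_{\widehat\lambda}$. **Theorem.** Given $a,b,y_0,\varepsilon,L,\mu_0$ and the sequences $\varsigma(\cdot),\nu(\cdot)$ as above, there is a sequence $\mathbf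 B^*_n\ge0$ with $\lim_{n\to\infty}\mathbf B^*_n/n^{\check\delta}=0$ for every $\check\delta>0$ such that for all $n\ge3$, all such bases and sets $\Lambda$ with $|\Lambda|=\nu(n)$, all $S\in\Theta_{\varepsilon,L}$, all $0<\delta\le1/12$ and every such choice of $\widehat\lambda$, $$\mathcal R^*(\widehat S_*,S)\le\frac{(1+4\delta)(1+\delta)^2}{1-6\delta}\,\min_{\lambda\in\Lambda}\mathcal R^*(\widehat S_\lambda,S)+\frac{\mathbf B^*_n}{\delta n}.$$ -/

import Mathlib

open MeasureTheory Set Filter Topology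
open scoped ENNReal

noncomputable section

namespace SeqAR

/-! Model -/

/-- The class of noise densities with parameter `s` (written ς in the text): centred densities with
unit variance whose even moments satisfy `∫ |x|^(2k) p(x) dx ≤ s^k (2k-1)!!` for all `k ≥ 1`. -/
def densityClass (s : ℝ) : Set (ℝ → ℝ) :=
  {p | Measurable p ∧ (∀ x, 0 ≤ p x) ∧ (∫ x, p x) = 1 ∧ (∫ x, x * p x) = 0 ∧
    (∫ x, x ^ 2 * p x) = 1 ∧
    ∀ k : ℕ, 1 ≤ k → Integrable (fun x => |x| ^ (2 * k) * p x) ∧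
      (∫ x, |x| ^ (2 * k) * p x) ≤ s ^ k * (Nat.doubleFactorial (2 * k - 1) : ℝ)}

/-- The stability set: continuously differentiable functions on `[a, b]` with
`sup |S| ≤ 1 - ε` and `sup |S'| ≤ L`. -/
def stabilitySet (a b ε L : ℝ) : Set (ℝ → ℝ) :=
  {S | ContDiffOn ℝ 1 S (Icc a b) ∧ (∀ x ∈ Icc a b, |S x| ≤ 1 - ε) ∧
    ∀ x ∈ Icc a b, |derivWithin S (Icc a b) x| ≤ L}

/-- The law on `ℝ` with Lebesgue density `p`. -/
def noiseLaw (p : ℝ → ℝ) : Measure ℝ := volume.withDensity fun x => ENNReal.ofReal (p x)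

/-- The time points `x_k = a + k (b - a) / n`. -/
def designPoint (a b : ℝ) (n k : ℕ) : ℝ := a + k * (b - a) / n

/-- The autoregression `y_k = S(x_k) y_{k-1} + ξ_k`, `1 ≤ k ≤ n`, started at the constant `y₀`.
The noise variable `ξ_{k+1}` is the coordinate `k` of `ξ`; indices above `n` are never used. -/
def arPath (a b y₀ : ℝ) {n : ℕ} (S : ℝ → ℝ) (ξ : Fin n → ℝ) : ℕ → ℝ
  | 0 => y₀
  | k + 1 => S (designPoint a b n (k + 1)) * arPath a b y₀ S ξ k +
      (if h : k < n then ξ ⟨k, h⟩ else 0)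

theorem measurable_arPath (a b y₀ : ℝ) {n : ℕ} (S : ℝ → ℝ) (k : ℕ) :
    Measurable fun ξ : Fin n → ℝ => arPath a b y₀ S ξ k := by
  induction k with
  | zero => exact measurable_const
  | succ k ih =>
    simp only [arPath]
    refine (measurable_const.mul ih).add ?_
    by_cases h : k < n
    · simp only [h, dite_true]
      exact measurable_pi_apply _
    · simp only [h, dite_false]
      exact measurable_const

/-- The law of the observations `(y_1, …, y_n)` when the noise variables are i.i.d. with density
`p` and the coefficient is `S`; `y_{k+1}` is the coordinate `k`. -/
def obsLaw (a b y₀ : ℝ) (n : ℕ) (p S : ℝ → ℝ) : Measure (Fin n → ℝ) :=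
  (Measure.pi fun _ : Fin n => noiseLaw p).map
    fun ξ k => arPath a b y₀ S ξ ((k : ℕ) + 1)

/-- The quadratic risk `E_{p,S} ∫_a^b (T(t) - S(t))² dt` of an estimator `T` which is a function of
the observations. -/
def risk (a b y₀ : ℝ) {n : ℕ} (T : (Fin n → ℝ) → ℝ → ℝ) (S p : ℝ → ℝ) : ℝ≥0∞ :=
  ∫⁻ y, (∫⁻ t in Icc a b, ENNReal.ofReal ((T y t - S t) ^ 2)) ∂(obsLaw a b y₀ n p S)

/-- The robust risk: the supremum of the risks over the density class with parameter `s`. -/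
def robustRisk (a b y₀ s : ℝ) {n : ℕ} (T : (Fin n → ℝ) → ℝ → ℝ) (S : ℝ → ℝ) : ℝ≥0∞ :=
  ⨆ p ∈ densityClass s, risk a b y₀ T S p

/-! The sequential kernel procedures. Here `y : ℕ → ℝ` is the whole sequence `y_0, y_1, …` and
`l` runs over `1, …, d`. -/

/-- `d = [√n]`. -/
abbrev gridSize (n : ℕ) : ℕ := Nat.sqrt n

/-- `z_l = a + (l / d) (b - a)`. -/
def gridPoint (a b : ℝ) (n l : ℕ) : ℝ := a + (l : ℝ) / gridSize n * (b - a)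

/-- `h = (b - a) / (2 d)`. -/
def bandwidth (a b : ℝ) (n : ℕ) : ℝ := (b - a) / (2 * gridSize n)

/-- `Q_{l,j} = Q((x_j - z_l) / h)` with `Q` the indicator function of `[-1, 1]`. -/
def kernelWeight (a b : ℝ) (n l j : ℕ) : ℝ :=
  indicator (Icc (-1 : ℝ) 1) (fun _ => (1 : ℝ))
    ((designPoint a b n j - gridPoint a b n l) / bandwidth a b n)

/-- `k_{1,l} = [n z̃_l - n h̃] + 1`. -/
def kOne (a b : ℝ) (n l : ℕ) : ℕ :=
  ⌊(n : ℝ) * ((gridPoint a b n l - a) / (b - a)) - n * (bandwidth a b n / (b - a))⌋₊ + 1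

/-- `k_{2,l} = [n z̃_l + n h̃] ∧ n`. -/
def kTwo (a b : ℝ) (n l : ℕ) : ℕ :=
  min ⌊(n : ℝ) * ((gridPoint a b n l - a) / (b - a)) + n * (bandwidth a b n / (b - a))⌋₊ n

/-- `ι_l = k_{1,l} + q` with `q = [(n h̃)^μ₀]`. -/
def iotaIdx (a b μ₀ : ℝ) (n l : ℕ) : ℕ :=
  kOne a b n l + ⌊((n : ℝ) * (bandwidth a b n / (b - a))) ^ μ₀⌋₊

/-- `A_{k,m} = ∑_{j=k+1}^m Q_{l,j} y_{j-1}²`. -/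
def energy (a b : ℝ) (n l : ℕ) (y : ℕ → ℝ) (k m : ℕ) : ℝ :=
  ∑ j ∈ Finset.Icc (k + 1) m, kernelWeight a b n l j * y (j - 1) ^ 2

/-- `ε̃ = 1 / (2 + ln n)`. -/
def epsTilde (n : ℕ) : ℝ := 1 / (2 + Real.log n)

/-- The preliminary least squares estimator of `S(z_l)` based on the first `ι_l` observations. -/
def prelimEst (a b μ₀ : ℝ) (n l : ℕ) (y : ℕ → ℝ) : ℝ :=
  (∑ j ∈ Finset.Icc 1 (iotaIdx a b μ₀ n l), kernelWeight a b n l j * y (j - 1) * y j) /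
    energy a b n l y 0 (iotaIdx a b μ₀ n l)

/-- The projection of the preliminary estimator to `[-1 + ε̃, 1 - ε̃]`. -/
def prelimProj (a b μ₀ : ℝ) (n l : ℕ) (y : ℕ → ℝ) : ℝ :=
  min (max (prelimEst a b μ₀ n l y) (-1 + epsTilde n)) (1 - epsTilde n)

/-- The threshold `H_l = (1 - ε̃) (k_{2,l} - ι_l - 1) / γ̃_l`. -/
def threshold (a b μ₀ : ℝ) (n l : ℕ) (y : ℕ → ℝ) : ℝ :=
  (1 - epsTilde n) / (1 - prelimProj a b μ₀ n l y ^ 2) *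
    ((kTwo a b n l : ℝ) - iotaIdx a b μ₀ n l - 1)

/-- The stopping time `τ_l`: the first `k` with `ι_l + 1 ≤ k ≤ k_{2,l}` and `A_{ι_l,k} ≥ H_l`, and
`k_{2,l}` if there is none. -/
def stopTime (a b μ₀ : ℝ) (n l : ℕ) (y : ℕ → ℝ) : ℕ :=
  sInf ({k | iotaIdx a b μ₀ n l + 1 ≤ k ∧ k ≤ kTwo a b n l ∧
    threshold a b μ₀ n l y ≤ energy a b n l y (iotaIdx a b μ₀ n l) k} ∪ {kTwo a b n l})

/-- The event `Γ_l = {A_{ι_l, k_{2,l} - 1} ≥ H_l}`. The procedure requires a positive threshold;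
if `H_l ≤ 0`, which happens only for finitely many `n`, the procedure is not defined and
the event is taken to be empty. -/
def goodAt (a b μ₀ : ℝ) (n l : ℕ) (y : ℕ → ℝ) : Prop :=
  0 < threshold a b μ₀ n l y ∧
    threshold a b μ₀ n l y ≤ energy a b n l y (iotaIdx a b μ₀ n l) (kTwo a b n l - 1)

/-- The correcting coefficient `ϰ_l`: on `Γ_l` it is the positive solution of
`A_{ι_l, τ_l - 1} + ϰ² Q_{l,τ_l} y_{τ_l - 1}² = H_l`. -/
def corrCoef (a b μ₀ : ℝ) (n l : ℕ) (y : ℕ → ℝ) : ℝ :=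
  Real.sqrt ((threshold a b μ₀ n l y -
      energy a b n l y (iotaIdx a b μ₀ n l) (stopTime a b μ₀ n l y - 1)) /
    (kernelWeight a b n l (stopTime a b μ₀ n l y) * y (stopTime a b μ₀ n l y - 1) ^ 2))

open Classical in
/-- The sequential estimator `S*_l` of `S(z_l)`. -/
def seqEst (a b μ₀ : ℝ) (n l : ℕ) (y : ℕ → ℝ) : ℝ :=
  if goodAt a b μ₀ n l y then
    (1 / threshold a b μ₀ n l y) *
      ((∑ j ∈ Finset.Icc (iotaIdx a b μ₀ n l + 1) (stopTime a b μ₀ n l y - 1),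
          kernelWeight a b n l j * y (j - 1) * y j) +
        corrCoef a b μ₀ n l y * kernelWeight a b n l (stopTime a b μ₀ n l y) *
          y (stopTime a b μ₀ n l y - 1) * y (stopTime a b μ₀ n l y))
  else 0

/-- The event `Γ = ⋂_{l=1}^d Γ_l`. -/
def good (a b μ₀ : ℝ) (n : ℕ) (y : ℕ → ℝ) : Prop :=
  ∀ l ∈ Finset.Icc 1 (gridSize n), goodAt a b μ₀ n l y

open Classical in
/-- `Y_l = S*_l 1_Γ`. -/
def regObs (a b μ₀ : ℝ) (n l : ℕ) (y : ℕ → ℝ) : ℝ :=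
  if good a b μ₀ n y then seqEst a b μ₀ n l y else 0

/-- `σ_l² = 1 / H_l`. -/
def sigmaSq (a b μ₀ : ℝ) (n l : ℕ) (y : ℕ → ℝ) : ℝ := (threshold a b μ₀ n l y)⁻¹

/-! Model selection. The indices `l, j ∈ {1, …, d}` are represented by `Fin d`, shifted by one. -/

/-- The system `φ_1, …, φ_d` is orthonormal for the empirical inner product
`(f, g)_d = ((b - a) / d) ∑_{l=1}^d f(z_l) g(z_l)`. -/
def EmpOrthonormal (a b : ℝ) (n : ℕ) (φ : Fin (gridSize n) → ℝ → ℝ) : Prop :=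
  ∀ i j, (b - a) / gridSize n *
      ∑ l : Fin (gridSize n), φ i (gridPoint a b n (l + 1)) * φ j (gridPoint a b n (l + 1)) =
    if i = j then 1 else 0

/-- The empirical Fourier coefficients `θ̂_{j,d}`. -/
def thetaHat (a b μ₀ : ℝ) (n : ℕ) (φ : Fin (gridSize n) → ℝ → ℝ) (y : ℕ → ℝ)
    (j : Fin (gridSize n)) : ℝ :=
  (b - a) / gridSize n *
    ∑ l : Fin (gridSize n), regObs a b μ₀ n (l + 1) y * φ j (gridPoint a b n (l + 1))

/-- `s_{j,d} = ((b - a) / d) ∑_l σ_l² φ_j(z_l)²`. -/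
def sCoef (a b μ₀ : ℝ) (n : ℕ) (φ : Fin (gridSize n) → ℝ → ℝ) (y : ℕ → ℝ)
    (j : Fin (gridSize n)) : ℝ :=
  (b - a) / gridSize n *
    ∑ l : Fin (gridSize n), sigmaSq a b μ₀ n (l + 1) y * φ j (gridPoint a b n (l + 1)) ^ 2

/-- `θ̃_{j,d} = θ̂_{j,d}² - ((b - a) / d) s_{j,d}`. -/
def thetaTilde (a b μ₀ : ℝ) (n : ℕ) (φ : Fin (gridSize n) → ℝ → ℝ) (y : ℕ → ℝ)
    (j : Fin (gridSize n)) : ℝ :=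
  thetaHat a b μ₀ n φ y j ^ 2 - (b - a) / gridSize n * sCoef a b μ₀ n φ y j

/-- The penalty `P_d(w) = ((b - a) / d) ∑_j w(j)² s_{j,d}`. -/
def penalty (a b μ₀ : ℝ) (n : ℕ) (φ : Fin (gridSize n) → ℝ → ℝ) (y : ℕ → ℝ)
    (w : Fin (gridSize n) → ℝ) : ℝ :=
  (b - a) / gridSize n * ∑ j, w j ^ 2 * sCoef a b μ₀ n φ y j

/-- The cost function `J_d(w) = ∑ w(j)² θ̂_j² - 2 ∑ w(j) θ̃_j + δ P_d(w)`. -/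
def cost (a b μ₀ : ℝ) (n : ℕ) (φ : Fin (gridSize n) → ℝ → ℝ) (δ : ℝ) (y : ℕ → ℝ)
    (w : Fin (gridSize n) → ℝ) : ℝ :=
  ∑ j, w j ^ 2 * thetaHat a b μ₀ n φ y j ^ 2 - 2 * ∑ j, w j * thetaTilde a b μ₀ n φ y j +
    δ * penalty a b μ₀ n φ y w

open Classical in
/-- The value `Ŝ_w(z_l)` of the weighted least squares estimator on the grid. -/
def gridEst (a b μ₀ : ℝ) (n : ℕ) (φ : Fin (gridSize n) → ℝ → ℝ) (y : ℕ → ℝ)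
    (w : Fin (gridSize n) → ℝ) (l : ℕ) : ℝ :=
  if good a b μ₀ n y then
    ∑ j, w j * thetaHat a b μ₀ n φ y j * φ j (gridPoint a b n l)
  else 0

/-- The weighted least squares estimator `Ŝ_w` as a step function on `[a, b]`, with the value
`Ŝ_w(z_1)` on `[a, z_1]` and `Ŝ_w(z_l)` on `(z_{l-1}, z_l]` for `2 ≤ l ≤ d`. -/
def stepEst (a b μ₀ : ℝ) (n : ℕ) (φ : Fin (gridSize n) → ℝ → ℝ) (y : ℕ → ℝ)
    (w : Fin (gridSize n) → ℝ) (t : ℝ) : ℝ :=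
  indicator (Icc a (gridPoint a b n 1)) (fun _ => gridEst a b μ₀ n φ y w 1) t +
    ∑ l ∈ Finset.Icc 2 (gridSize n),
      indicator (Ioc (gridPoint a b n (l - 1)) (gridPoint a b n l))
        (fun _ => gridEst a b μ₀ n φ y w l) t

/-- The sequence `y_0, y_1, …, y_n` formed by the constant `y₀` and the observations
`(y_1, …, y_n)`; it is continued by zero, which does not affect the estimators. -/
def obsSeq (y₀ : ℝ) {n : ℕ} (y : Fin n → ℝ) : ℕ → ℝ
  | 0 => y₀
  | k + 1 => if h : k < n then y ⟨k, h⟩ else 0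

/-- The estimator `Ŝ_w` with a fixed weight vector `w`, as a function of the observations. -/
def weightedEst (a b y₀ μ₀ : ℝ) {n : ℕ} (φ : Fin (gridSize n) → ℝ → ℝ)
    (w : Fin (gridSize n) → ℝ) (y : Fin n → ℝ) (t : ℝ) : ℝ :=
  stepEst a b μ₀ n φ (obsSeq y₀ y) w t

/-- `W` is a random weight vector, depending measurably on the observations only, with values in
the finite set `Λ` and minimizing the cost function over `Λ`: `W = argmin_{w ∈ Λ} J_d(w)`. -/
def IsSelector (a b y₀ μ₀ : ℝ) {n : ℕ} (φ : Fin (gridSize n) → ℝ → ℝ) (δ : ℝ)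
    (Λ : Finset (Fin (gridSize n) → ℝ)) (W : (Fin n → ℝ) → Fin (gridSize n) → ℝ) : Prop :=
  Measurable W ∧ ∀ y, W y ∈ Λ ∧
    ∀ w ∈ Λ, cost a b μ₀ n φ δ (obsSeq y₀ y) (W y) ≤ cost a b μ₀ n φ δ (obsSeq y₀ y) w

/-- The model selection estimator `Ŝ_*`, i.e. `Ŝ_w` at the selected weight vector `w = W y`. -/
def selectedEst (a b y₀ μ₀ : ℝ) {n : ℕ} (φ : Fin (gridSize n) → ℝ → ℝ)
    (W : (Fin n → ℝ) → Fin (gridSize n) → ℝ) (y : Fin n → ℝ) (t : ℝ) : ℝ :=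
  weightedEst a b y₀ μ₀ φ (W y) y t

/-- `f(n) = o(n^r)` for every `r > 0`. -/
def SubPoly (f : ℕ → ℝ) : Prop :=
  ∀ r : ℝ, 0 < r → Tendsto (fun n : ℕ => f n / (n : ℝ) ^ r) atTop (𝓝 0)

end SeqAR

end

open SeqAR

namespace SeqAR

/-! Penalised model selection with weights in `[0, 1]`: the deterministic inequality. -/

/-! On `good` the sequential observations form a regression `Y_l = S(z_l) + e_l + g_l`
(`regObs_eq`). Here `e_l = ∑ v_{l,i} ξ_i` is a martingale transform with predictable weights, and
`g_l` is a small bias. Stopping at a prescribed energy gives `∑_i v_{l,i}² = 1 / H_l = σ_l²` on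
every path, once the energy clock is completed to `H_l` at the end of the window
(`sum_noiseWeight_sq`). The windows of different `l` are disjoint, so `v_{l,i} v_{l',i} = 0`. The
thresholds `H_l` are of order `d` up to a logarithm.

For such a regression the oracle inequality is deterministic (`oracle_inequality`,
`oracle_inequality_coord`). If `lam` minimises the penalised cost, the difference of its error and
that of a competitor consists of linear statistics `∑ x_j t_j η_j`, centred quadratic statistics `∑
x_j (η_j² - s_j)`, and bias terms. Suppose the squares of these statistics are at most `Z ∑ x_j²
t_j²` and `Zq ∑ x_j² s_j`. Young's inequality then absorbs everything into a `δ`-fraction of the two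
errors plus a multiple of `(Z + Zq + ∑ g²) / δ`.

The numbers `Z` and `Zq` are taken as sums of normalised squares over the weights occurring in the
comparison (`linSup`, `quadSup`). Their number is at most `2ν + 2`, so expectations require only
second moments for each fixed deterministic weight, and `Λ` costs a factor linear in `ν`. The second
moments come from martingale orthogonality (`integral_sq_linear_form_le`,
`integral_sq_quadratic_form_le`). The off-diagonal part of the quadratic form is handled by a
summation by parts against the bounded clock `∑ v²` (`sum_integral_clock_mul_sq_le`).

The bias is at most `L h` plus a term of order `max y_k² / H_l` (`abs_bias_le`). Stability bounds
the path by the noise maximum, whose fourth power has polylogarithmic mean up to powers of `ς`: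
moments of order `4m` with `m ~ log n` are used (`integral_noiseMax_le`). After multiplication by
`(b - a) / d` every remainder is a subpolynomial factor times `1 / d² ≤ 4 / n`.

Passing between grid errors and integrated errors costs `1 + δ` in each direction, hence the factor
`(1 + δ)²`. Off `good` all the estimators vanish and there is nothing to compare; the probability of
`good` plays no role. -/

theorem two_mul_le_of_sq_le {m Z G k : ℝ} (hk : 0 < k) (hZ : 0 ≤ Z) (hG : 0 ≤ G)
    (h : m ^ 2 ≤ Z * G) : 2 * m ≤ k * G + Z / k := by
  have h1 : (2 * m) ^ 2 ≤ (k * G + Z / k) ^ 2 := by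
    have e : (k * G + Z / k) ^ 2 = (k * G - Z / k) ^ 2 + 4 * (Z * G) := by
      field_simp
      ring
    nlinarith [sq_nonneg (k * G - Z / k)]
  exact (le_abs_self _).trans (abs_le_of_sq_le_sq h1 (by positivity))

/-- This isolates the numerical bookkeeping of `oracle_inequality`. `E`, `E0` are the errors of the
selected and the competing weight, `p`, `p0`, `px` the variances weighted by `lam²`, `lam0²` and
`(lam - lam0)²`, `G` the signal weighted by `(lam - lam0)²`, and `W` the squared bias. The argument
gives denominator `1 - δ`, which is then weakened to `1 - 6δ`. -/
theorem oracle_arith {δ k G W p p0 px E E0 Z Zq a1 a2 a3 a4 a5 b1 b2 b3 y2 : ℝ}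
    (hδ : 0 < δ) (hδ' : δ ≤ 1 / 12) (hk : k = δ / 8) (hZ : 0 ≤ Z) (hZq : 0 ≤ Zq)
    (hW0 : 0 ≤ W) (hpn : 0 ≤ p) (hE0n : 0 ≤ E0)
    (hpp : px ≤ p + p0) (hpen : p0 ≤ 16 / 7 * E0 + 8 * (Z + Zq + W))
    (m1 : 2 * a1 ≤ k * G + Z / k) (m2 : 2 * a2 ≤ k * G + W / k) (m3 : 2 * a3 ≤ k * px + Zq / k)
    (m4 : 2 * b1 ≤ 1 * px + Zq / 1) (hη : y2 = b1 + px)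
    (m5 : 2 * a4 ≤ k / 2 * y2 + W / (k / 2)) (m6 : a5 ≤ W)
    (m7 : 2 * -b2 ≤ 1 / 4 * G + Z / (1 / 4)) (m8 : 2 * -b3 ≤ 1 / 4 * G + W / (1 / 4))
    (m9 : G ≤ 2 * E + 2 * E0 - 2 * b2 - 2 * b3)
    (m10 : E - E0 ≤ 2 * a1 + 2 * a2 + 2 * a3 + 4 * a4 + 2 * a5 - δ * p + δ * p0) :
    E ≤ (1 + 4 * δ) / (1 - 6 * δ) * E0 + 60 / δ * (Z + Zq + W) := by
  have hkd : Z / k = 8 * (Z / δ) := by rw [hk]; field_simp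
  have hkq : Zq / k = 8 * (Zq / δ) := by rw [hk]; field_simp
  have hkw : W / k = 8 * (W / δ) := by rw [hk]; field_simp
  have hkw2 : W / (k / 2) = 16 * (W / δ) := by rw [hk]; field_simp; ring
  rw [hkd] at m1
  rw [hkw] at m2
  rw [hkq] at m3
  rw [hkw2, hη] at m5
  have hZd : 12 * Z ≤ Z / δ := by rw [le_div_iff₀ hδ]; nlinarith only [hδ', hZ]
  have hZqd : 12 * Zq ≤ Zq / δ := by rw [le_div_iff₀ hδ]; nlinarith only [hδ', hZq]
  have hWd : 12 * W ≤ W / δ := by rw [le_div_iff₀ hδ]; nlinarith only [hδ', hW0]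
  -- Young's inequality with parameter `1/4` in `m7` and `m8` puts `G/4 + G/4` on the right of `m9`;
  -- half of `G` survives on the left.
  have hGb : G ≤ 4 * (E + E0) + 8 * Z + 8 * W := by linarith only [m7, m8, m9]
  have q1 : δ * G ≤ δ * (4 * (E + E0) + 8 * Z + 8 * W) := mul_le_mul_of_nonneg_left hGb hδ.le
  have q2 : δ * px ≤ δ * (p + p0) := mul_le_mul_of_nonneg_left hpp hδ.le
  have q3 : δ * p0 ≤ δ * (16 / 7 * E0 + 8 * (Z + Zq + W)) := mul_le_mul_of_nonneg_left hpen hδ.le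
  have q4 : δ * b1 ≤ δ * (1 / 2 * px + 1 / 2 * Zq) :=
    mul_le_mul_of_nonneg_left (by linarith only [m4]) hδ.le
  have q5 : 0 ≤ δ * p := mul_nonneg hδ.le hpn
  have q6 : δ * (Z + Zq + W) ≤ 1 / 12 * (Z + Zq + W) :=
    mul_le_mul_of_nonneg_right hδ' (by linarith only [hZ, hZq, hW0])
  have q7 : 0 ≤ δ * Z := mul_nonneg hδ.le hZ
  have q8 : 0 ≤ δ * W := mul_nonneg hδ.le hW0
  have q9 : 0 ≤ δ * Zq := mul_nonneg hδ.le hZq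
  have fin : E * (1 - δ) ≤ (1 + 4 * δ) * E0 + 50 * ((Z + Zq + W) / δ) := by
    rw [add_div, add_div]
    have n1 : 2 * a1 ≤ δ * G / 8 + 8 * (Z / δ) := m1.trans_eq (by rw [hk]; ring)
    have n2 : 2 * a2 ≤ δ * G / 8 + 8 * (W / δ) := m2.trans_eq (by rw [hk]; ring)
    have n3 : 2 * a3 ≤ δ * px / 8 + 8 * (Zq / δ) := m3.trans_eq (by rw [hk]; ring)
    have n5 : 4 * a4 ≤ δ * b1 / 8 + δ * px / 8 + 32 * (W / δ) := by
      have := m5.trans_eq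
        (by rw [hk]; ring : _ = δ * b1 / 16 + δ * px / 16 + 16 * (W / δ))
      linarith only [this]
    have r1 : E - E0 ≤ δ * G / 4 + 5 * (δ * px) / 16 + δ * Zq / 16 - δ * p + δ * p0 +
        (8 * (Z / δ) + 8 * (Zq / δ) + 41 * (W / δ)) := by
      linarith only [n1, n2, n3, n5, q4, m10, m6, hWd, hW0]
    -- The term `δ G / 4` yields `δ (E + E0)`. The penalties leave `-11/16 δ p`, which is dropped,
    -- and `21/16 δ p0`; the latter gives `21/16 · 16/7 = 3` times `δ E0`.
    have r2 : E - E0 ≤ δ * (E + E0) + 3 * (δ * E0) + 13 * (δ * (Z + Zq + W)) +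
        (8 * (Z / δ) + 8 * (Zq / δ) + 41 * (W / δ)) := by
      linarith only [r1, q1, q2, q3, q5, q7, q8, q9]
    have r3 : 13 * (δ * (Z + Zq + W)) ≤ 2 * (Z / δ) + 2 * (Zq / δ) + 2 * (W / δ) := by
      linarith only [q6, hZd, hZqd, hWd, hZ, hZq, hW0]
    have d1 : 0 ≤ Z / δ := by positivity
    have d2 : 0 ≤ Zq / δ := by positivity
    have d3 : 0 ≤ W / δ := by positivity
    have r4 : E - E0 ≤ δ * (E + E0) + 3 * (δ * E0) +
        50 * (Z / δ + Zq / δ + W / δ) := by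
      linarith only [r2, r3, d1, d2, d3]
    linarith only [r4]
  have hR : 0 ≤ (Z + Zq + W) / δ := by positivity
  have h6 : 0 < 1 - 6 * δ := by linarith only [hδ']
  have h1 : 0 < 1 - δ := by linarith only [hδ']
  have fin2 : E ≤ ((1 + 4 * δ) * E0 + 50 * ((Z + Zq + W) / δ)) / (1 - δ) := by
    rw [le_div_iff₀ h1]
    exact fin
  refine fin2.trans ?_
  rw [add_div]
  refine add_le_add ?_ ?_
  · rw [mul_div_right_comm]
    gcongr
    linarith only [hδ]
  · rw [div_le_iff₀ h1]
    have : 60 / δ * (Z + Zq + W) = 60 * ((Z + Zq + W) / δ) := by ring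
    rw [this, mul_right_comm]
    exact mul_le_mul_of_nonneg_right (by linarith only [hδ']) hR

section Oracle

variable {ι : Type*} [Fintype ι]

theorem sq_sum_mul_le (f g : ι → ℝ) : (∑ j, f j * g j) ^ 2 ≤ (∑ j, g j ^ 2) * ∑ j, f j ^ 2 := by
  rw [mul_comm]
  exact Finset.sum_mul_sq_le_sq_mul_sq _ _ _

/-- The penalty of a weight vector is controlled by its empirical error. -/
theorem penalty_le_error {t η w s : ι → ℝ} {lam : ι → ℝ} {Z Zq : ℝ}
    (h01 : ∀ j, lam j ∈ Icc (0 : ℝ) 1) (hs : ∀ j, 0 ≤ s j) (hZ : 0 ≤ Z) (hZq : 0 ≤ Zq)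
    (hM : (∑ j, (lam j - lam j ^ 2) * t j * η j) ^ 2 ≤
      Z * ∑ j, (lam j - lam j ^ 2) ^ 2 * t j ^ 2)
    (hQ : (∑ j, lam j ^ 2 * (η j ^ 2 - s j)) ^ 2 ≤ Zq * ∑ j, (lam j ^ 2) ^ 2 * s j) :
    ∑ j, lam j ^ 2 * s j ≤ 16 / 7 * (∑ j, (lam j * (t j + η j + w j) - t j) ^ 2) +
      8 * (Z + Zq + ∑ j, w j ^ 2) := by
  set A := ∑ j, (1 - lam j) ^ 2 * t j ^ 2 with hA
  set p := ∑ j, lam j ^ 2 * s j with hp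
  have hW : 0 ≤ ∑ j, w j ^ 2 := Finset.sum_nonneg fun j _ => sq_nonneg _
  have hA0 : 0 ≤ A := Finset.sum_nonneg fun j _ => by positivity
  have hp0 : 0 ≤ p := Finset.sum_nonneg fun j _ => mul_nonneg (sq_nonneg _) (hs j)
  have hGA : ∑ j, (lam j - lam j ^ 2) ^ 2 * t j ^ 2 ≤ A := by
    refine Finset.sum_le_sum fun j _ => mul_le_mul_of_nonneg_right ?_ (sq_nonneg _)
    have h0 := (h01 j).1
    have h1 := (h01 j).2
    have : (lam j - lam j ^ 2) ^ 2 = lam j ^ 2 * (1 - lam j) ^ 2 := by ring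
    rw [this]
    have h2 : lam j ^ 2 ≤ 1 := by nlinarith
    nlinarith [sq_nonneg (1 - lam j)]
  have hpp : ∑ j, (lam j ^ 2) ^ 2 * s j ≤ p := by
    refine Finset.sum_le_sum fun j _ => mul_le_mul_of_nonneg_right ?_ (hs j)
    have h0 := (h01 j).1
    have h1 := (h01 j).2
    have h2 : lam j ^ 2 ≤ 1 := by nlinarith
    nlinarith [sq_nonneg (lam j)]
  have h1 := two_mul_le_of_sq_le (k := 1 / 2) (by norm_num) hZ hA0
    (hM.trans (mul_le_mul_of_nonneg_left hGA hZ))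
  have h2 := two_mul_le_of_sq_le (k := 1 / 2) (m := ∑ j, (lam j - lam j ^ 2) * t j * w j)
    (by norm_num) hW hA0 ((sq_sum_mul_le (fun j => (lam j - lam j ^ 2) * t j) w).trans
      (mul_le_mul_of_nonneg_left (le_trans (le_of_eq (Finset.sum_congr rfl fun j _ => by ring))
        hGA) hW))
  have h3 := two_mul_le_of_sq_le (k := 1 / 4) (m := -∑ j, lam j ^ 2 * (η j ^ 2 - s j))
    (by norm_num) hZq hp0 (by rw [neg_sq]; exact hQ.trans (mul_le_mul_of_nonneg_left hpp hZq))
  -- Expand `(lam (η + w) - (1 - lam) t)²` and use `(η + w)² ≥ η² / 2 - w²`, which is `(η + 2w)² ≥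
  -- 0`.
  have h4 : A - 2 * ∑ j, (lam j - lam j ^ 2) * t j * η j -
      2 * ∑ j, (lam j - lam j ^ 2) * t j * w j + 1 / 2 * ((∑ j, lam j ^ 2 * (η j ^ 2 - s j)) + p)
      - ∑ j, w j ^ 2 ≤ ∑ j, (lam j * (t j + η j + w j) - t j) ^ 2 := by
    rw [hA, hp, Finset.mul_sum, Finset.mul_sum, ← Finset.sum_add_distrib, Finset.mul_sum,
      ← Finset.sum_sub_distrib, ← Finset.sum_sub_distrib, ← Finset.sum_add_distrib,
      ← Finset.sum_sub_distrib]
    refine Finset.sum_le_sum fun j _ => ?_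
    have h0 := (h01 j).1
    have h1 := (h01 j).2
    have h2 : lam j ^ 2 ≤ 1 := by nlinarith
    have h5 : 0 ≤ lam j ^ 2 * (η j + 2 * w j) ^ 2 := by positivity
    have h6 : lam j ^ 2 * w j ^ 2 ≤ w j ^ 2 := by nlinarith [sq_nonneg (w j)]
    nlinarith
  -- The two cross terms cost exactly `A`, and the quadratic term costs `p / 16` out of `p / 2`.
  -- Thus `7/16 p` is bounded by the error plus `2 Z + Zq + 3 ∑ w²`.
  linarith

/-- The cost differs from the squared error, up to a constant and the penalty, by replacing `(t + η
+ w) t` with its estimate `(t + η + w)² - s`. The discrepancy `(t + η + w)(η + w) - s` splits into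
the five sums on the right. -/
theorem sq_err_sub_le {t η w s : ι → ℝ} {lam lam0 : ι → ℝ} {δ : ℝ}
    (hJ : ∑ j, lam j ^ 2 * (t j + η j + w j) ^ 2 - 2 * ∑ j, lam j * ((t j + η j + w j) ^ 2 - s j) +
        δ * ∑ j, lam j ^ 2 * s j ≤
      ∑ j, lam0 j ^ 2 * (t j + η j + w j) ^ 2 - 2 * ∑ j, lam0 j * ((t j + η j + w j) ^ 2 - s j) +
        δ * ∑ j, lam0 j ^ 2 * s j) :
    (∑ j, (lam j * (t j + η j + w j) - t j) ^ 2) - ∑ j, (lam0 j * (t j + η j + w j) - t j) ^ 2 ≤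
      2 * ∑ j, (lam j - lam0 j) * t j * η j + 2 * ∑ j, (lam j - lam0 j) * t j * w j +
      2 * ∑ j, (lam j - lam0 j) * (η j ^ 2 - s j) + 4 * ∑ j, (lam j - lam0 j) * η j * w j +
      2 * ∑ j, (lam j - lam0 j) * w j ^ 2
      - δ * ∑ j, lam j ^ 2 * s j + δ * ∑ j, lam0 j ^ 2 * s j := by
  have key : (∑ j, (lam j * (t j + η j + w j) - t j) ^ 2) -
      (∑ j, (lam0 j * (t j + η j + w j) - t j) ^ 2) -
      (2 * ∑ j, (lam j - lam0 j) * t j * η j + 2 * ∑ j, (lam j - lam0 j) * t j * w j +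
      2 * ∑ j, (lam j - lam0 j) * (η j ^ 2 - s j) + 4 * ∑ j, (lam j - lam0 j) * η j * w j +
      2 * ∑ j, (lam j - lam0 j) * w j ^ 2) -
      (∑ j, lam j ^ 2 * (t j + η j + w j) ^ 2 -
        2 * ∑ j, lam j * ((t j + η j + w j) ^ 2 - s j)) +
      (∑ j, lam0 j ^ 2 * (t j + η j + w j) ^ 2 -
        2 * ∑ j, lam0 j * ((t j + η j + w j) ^ 2 - s j)) = 0 := by
    simp only [Finset.mul_sum, ← Finset.sum_add_distrib, ← Finset.sum_sub_distrib]
    exact Finset.sum_eq_zero fun j _ => by ring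
  linarith

/-- The difference of the two residuals is `(lam - lam0)(t + η + w)`, and `(u - u0)² ≤ 2u² + 2u0²`.
This lets the signal factor of the linear statistics be paid for by the errors themselves, at the
price of statistics with the weights `(lam - lam0)²`. -/
theorem sq_sum_diff_le (t η w lam lam0 : ι → ℝ) :
    ∑ j, (lam j - lam0 j) ^ 2 * t j ^ 2 ≤
      2 * ∑ j, (lam j * (t j + η j + w j) - t j) ^ 2 +
      2 * ∑ j, (lam0 j * (t j + η j + w j) - t j) ^ 2 -
      2 * ∑ j, (lam j - lam0 j) ^ 2 * t j * η j - 2 * ∑ j, (lam j - lam0 j) ^ 2 * t j * w j := by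
  rw [Finset.mul_sum, Finset.mul_sum, Finset.mul_sum, Finset.mul_sum,
    ← Finset.sum_add_distrib, ← Finset.sum_sub_distrib, ← Finset.sum_sub_distrib]
  refine Finset.sum_le_sum fun j _ => ?_
  have h1 := sq_nonneg ((lam j * (t j + η j + w j) - t j) + (lam0 j * (t j + η j + w j) - t j))
  have h2 := sq_nonneg ((lam j - lam0 j) * (η j + w j))
  linarith

/-- The oracle inequality for the selected weight vector `lam` against a competitor `lam0`. -/
theorem oracle_inequality {t η w s : ι → ℝ} {lam lam0 : ι → ℝ} {Z Zq δ : ℝ}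
    (hδ : 0 < δ) (hδ' : δ ≤ 1 / 12)
    (h01 : ∀ j, lam j ∈ Icc (0 : ℝ) 1) (h01' : ∀ j, lam0 j ∈ Icc (0 : ℝ) 1)
    (hs : ∀ j, 0 ≤ s j) (hZ : 0 ≤ Z) (hZq : 0 ≤ Zq)
    (hM : ∀ x : ι → ℝ, (x = (fun j => lam j - lam0 j) ∨ x = (fun j => (lam j - lam0 j) ^ 2) ∨
      x = fun j => lam0 j - lam0 j ^ 2) →
      (∑ j, x j * t j * η j) ^ 2 ≤ Z * ∑ j, x j ^ 2 * t j ^ 2)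
    (hQ : ∀ x : ι → ℝ, (x = (fun j => lam j - lam0 j) ∨ x = (fun j => (lam j - lam0 j) ^ 2) ∨
      x = fun j => lam0 j ^ 2) →
      (∑ j, x j * (η j ^ 2 - s j)) ^ 2 ≤ Zq * ∑ j, x j ^ 2 * s j)
    (hJ : ∑ j, lam j ^ 2 * (t j + η j + w j) ^ 2 - 2 * ∑ j, lam j * ((t j + η j + w j) ^ 2 - s j) +
        δ * ∑ j, lam j ^ 2 * s j ≤
      ∑ j, lam0 j ^ 2 * (t j + η j + w j) ^ 2 - 2 * ∑ j, lam0 j * ((t j + η j + w j) ^ 2 - s j) +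
        δ * ∑ j, lam0 j ^ 2 * s j) :
    ∑ j, (lam j * (t j + η j + w j) - t j) ^ 2 ≤
      (1 + 4 * δ) / (1 - 6 * δ) * (∑ j, (lam0 j * (t j + η j + w j) - t j) ^ 2) +
        60 / δ * (Z + Zq + ∑ j, w j ^ 2) := by
  set x : ι → ℝ := fun j => lam j - lam0 j with hx
  set G := ∑ j, x j ^ 2 * t j ^ 2 with hG
  set W := ∑ j, w j ^ 2 with hW
  set p := ∑ j, lam j ^ 2 * s j with hp
  set p0 := ∑ j, lam0 j ^ 2 * s j with hp0
  set px := ∑ j, x j ^ 2 * s j with hpx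
  set E := ∑ j, (lam j * (t j + η j + w j) - t j) ^ 2 with hE
  set E0 := ∑ j, (lam0 j * (t j + η j + w j) - t j) ^ 2 with hE0
  have hW0 : 0 ≤ W := Finset.sum_nonneg fun j _ => sq_nonneg _
  have hG0 : 0 ≤ G := Finset.sum_nonneg fun j _ => by positivity
  have hpn : 0 ≤ p := Finset.sum_nonneg fun j _ => mul_nonneg (sq_nonneg _) (hs j)
  have hpx0 : 0 ≤ px := Finset.sum_nonneg fun j _ => mul_nonneg (sq_nonneg _) (hs j)
  have hE0n : 0 ≤ E0 := Finset.sum_nonneg fun j _ => sq_nonneg _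
  have hx1 : ∀ j, x j ^ 2 ≤ 1 := fun j => by
    have h1 := h01 j
    have h2 := h01' j
    have h3 : |x j| ≤ 1 := abs_le.mpr ⟨by simp only [hx]; linarith [h1.1, h2.2],
      by simp only [hx]; linarith [h1.2, h2.1]⟩
    rw [← sq_abs]
    nlinarith only [abs_nonneg (x j), h3]
  have hx2 : ∀ j, (x j ^ 2) ^ 2 ≤ x j ^ 2 := fun j => by
    nlinarith only [hx1 j, sq_nonneg (x j)]
  have hpp : px ≤ p + p0 := by
    rw [hpx, hp, hp0, ← Finset.sum_add_distrib]
    refine Finset.sum_le_sum fun j _ => ?_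
    rw [← add_mul]
    refine mul_le_mul_of_nonneg_right ?_ (hs j)
    simp only [hx]
    nlinarith only [mul_nonneg (h01 j).1 (h01' j).1]
  have hpen : p0 ≤ 16 / 7 * E0 + 8 * (Z + Zq + W) :=
    penalty_le_error h01' hs hZ hZq (hM _ (by simp)) (hQ _ (by simp))
  -- Two signal terms with this parameter add up to `δ G / 4`, and `G` is about `4 (E + E0)`.
  set k := δ / 8 with hk
  have hk0 : 0 < k := by positivity
  have m1 := two_mul_le_of_sq_le hk0 hZ hG0 (hM x (by simp))
  have m2 := two_mul_le_of_sq_le (m := ∑ j, x j * t j * w j) hk0 hW0 hG0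
    ((sq_sum_mul_le (fun j => x j * t j) w).trans
      (le_of_eq (by rw [hW, hG]; congr 1; exact Finset.sum_congr rfl fun j _ => by ring)))
  have m3 := two_mul_le_of_sq_le hk0 hZq hpx0 (hQ x (by simp))
  have hx4s : ∑ j, (x j ^ 2) ^ 2 * s j ≤ px :=
    Finset.sum_le_sum fun j _ => mul_le_mul_of_nonneg_right (hx2 j) (hs j)
  have hx4t : ∑ j, (x j ^ 2) ^ 2 * t j ^ 2 ≤ G :=
    Finset.sum_le_sum fun j _ => mul_le_mul_of_nonneg_right (hx2 j) (sq_nonneg _)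
  have m4 := two_mul_le_of_sq_le (k := 1) one_pos hZq hpx0
    ((hQ (fun j => x j ^ 2) (by simp [hx])).trans (mul_le_mul_of_nonneg_left hx4s hZq))
  have hη0 : 0 ≤ ∑ j, (x j * η j) ^ 2 := Finset.sum_nonneg fun j _ => sq_nonneg _
  have hη : ∑ j, (x j * η j) ^ 2 = ∑ j, x j ^ 2 * (η j ^ 2 - s j) + px := by
    rw [hpx, ← Finset.sum_add_distrib]
    exact Finset.sum_congr rfl fun j _ => by ring
  have m5 := two_mul_le_of_sq_le (m := ∑ j, x j * η j * w j) (k := k / 2) (by positivity) hW0 hη0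
    (sq_sum_mul_le (fun j => x j * η j) w)
  have m6 : ∑ j, x j * w j ^ 2 ≤ W := Finset.sum_le_sum fun j _ => by
    have : x j ≤ 1 := by nlinarith only [hx1 j]
    nlinarith only [sq_nonneg (w j), this]
  have m7 := two_mul_le_of_sq_le (m := -∑ j, x j ^ 2 * t j * η j) (k := 1 / 4) (by norm_num) hZ hG0
    (by rw [neg_sq]; exact
      (hM (fun j => x j ^ 2) (by simp [hx])).trans (mul_le_mul_of_nonneg_left hx4t hZ))
  have m8 := two_mul_le_of_sq_le (m := -∑ j, x j ^ 2 * t j * w j) (k := 1 / 4) (by norm_num) hW0 hG0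
    (by
      rw [neg_sq]
      refine (sq_sum_mul_le (fun j => x j ^ 2 * t j) w).trans (mul_le_mul_of_nonneg_left ?_ hW0)
      exact (le_of_eq (Finset.sum_congr rfl fun j _ => by ring)).trans hx4t)
  have m9 : G ≤ 2 * E + 2 * E0 - 2 * ∑ j, x j ^ 2 * t j * η j - 2 * ∑ j, x j ^ 2 * t j * w j :=
    sq_sum_diff_le t η w lam lam0
  have m10 : E - E0 ≤ 2 * ∑ j, x j * t j * η j + 2 * ∑ j, x j * t j * w j +
      2 * ∑ j, x j * (η j ^ 2 - s j) + 4 * ∑ j, x j * η j * w j + 2 * ∑ j, x j * w j ^ 2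
      - δ * p + δ * p0 := sq_err_sub_le hJ
  exact oracle_arith hδ hδ' hk hZ hZq hW0 hpn hE0n hpp hpen m1 m2 m3 m4 hη m5 m6 m7 m8 m9 m10

end Oracle

end SeqAR

namespace SeqAR

/-! Second moments of linear and quadratic forms in martingale differences. -/

/-- All moments are finite. -/
def AllMoments {Ω : Type*} [MeasurableSpace Ω] (P : Measure Ω) (f : Ω → ℝ) : Prop :=
  ∀ q : ℕ, MemLp f q P

namespace AllMoments

variable {Ω : Type*} [MeasurableSpace Ω] {P : Measure Ω} {f g : Ω → ℝ}

theorem add (hf : AllMoments P f) (hg : AllMoments P g) : AllMoments P fun ω => f ω + g ω :=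
  fun q => (hf q).add (hg q)

theorem sub (hf : AllMoments P f) (hg : AllMoments P g) : AllMoments P fun ω => f ω - g ω :=
  fun q => (hf q).sub (hg q)

theorem mul (hf : AllMoments P f) (hg : AllMoments P g) : AllMoments P fun ω => f ω * g ω :=
  fun q => by
    have : ENNReal.HolderTriple ((2 * q : ℕ) : ℝ≥0∞) ((2 * q : ℕ) : ℝ≥0∞) (q : ℝ≥0∞) := ⟨by
      push_cast
      rw [ENNReal.mul_inv (by simp) (by simp), ← add_mul, ENNReal.inv_two_add_inv_two, one_mul]⟩
    exact (hg (2 * q)).mul (hf (2 * q))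

theorem sum {ι : Type*} (s : Finset ι) {F : ι → Ω → ℝ} (h : ∀ i ∈ s, AllMoments P (F i)) :
    AllMoments P fun ω => ∑ i ∈ s, F i ω :=
  fun q => memLp_finsetSum s fun i hi => h i hi q

theorem of_bound [IsFiniteMeasure P] (hf : Measurable f) (C : ℝ) (h : ∀ ω, |f ω| ≤ C) :
    AllMoments P f :=
  fun _ => MemLp.of_bound hf.aestronglyMeasurable C (ae_of_all _ h)

theorem const [IsFiniteMeasure P] (c : ℝ) : AllMoments P fun _ => c :=
  fun _ => memLp_const c

theorem pow [IsFiniteMeasure P] (hf : AllMoments P f) (k : ℕ) : AllMoments P fun ω => f ω ^ k := by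
  induction k with
  | zero => simpa using const (1 : ℝ)
  | succ k ih => simpa only [pow_succ] using ih.mul hf

theorem integrable (hf : AllMoments P f) : Integrable f P :=
  memLp_one_iff_integrable.mp (by simpa using hf 1)

end AllMoments

/-- The noise coordinates up to time `m`. -/
def before (n m : ℕ) : Finset (Fin n) := Finset.univ.filter fun j => j.val < m

theorem mem_before {n m : ℕ} {j : Fin n} : j ∈ before n m ↔ j.val < m := by simp [before]

theorem before_succ {n m : ℕ} (h : m < n) :
    before n (m + 1) = insert ⟨m, h⟩ (before n m) := by
  ext j
  simp only [mem_before, Finset.mem_insert, Fin.ext_iff]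
  omega

theorem notMem_before {n m : ℕ} (h : m < n) : (⟨m, h⟩ : Fin n) ∉ before n m := by
  simp [mem_before]

theorem before_self (n : ℕ) : before n n = Finset.univ := by
  ext j
  simp [mem_before]

/-- A random variable with finite moments which depends on the first `m` noise variables only. -/
structure Adapted {n : ℕ} (μ : Measure ℝ) (m : ℕ) (f : (Fin n → ℝ) → ℝ) : Prop where
  meas : Measurable f
  dep : DependsOn f {j : Fin n | j.val < m}
  mom : AllMoments (Measure.pi fun _ : Fin n => μ) f

namespace Adapted

variable {n m m' : ℕ} {μ : Measure ℝ} {f g : (Fin n → ℝ) → ℝ}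

theorem mono (hf : Adapted μ m f) (h : m ≤ m') : Adapted μ m' f :=
  ⟨hf.meas, fun _ _ hxy => hf.dep fun i hi => hxy i (lt_of_lt_of_le hi h), hf.mom⟩

theorem add (hf : Adapted μ m f) (hg : Adapted μ m g) : Adapted μ m fun ξ => f ξ + g ξ :=
  ⟨hf.meas.add hg.meas, fun _ _ h => congrArg₂ _ (hf.dep h) (hg.dep h), hf.mom.add hg.mom⟩

theorem sub (hf : Adapted μ m f) (hg : Adapted μ m g) : Adapted μ m fun ξ => f ξ - g ξ :=
  ⟨hf.meas.sub hg.meas, fun _ _ h => congrArg₂ _ (hf.dep h) (hg.dep h), hf.mom.sub hg.mom⟩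

theorem mul (hf : Adapted μ m f) (hg : Adapted μ m g) : Adapted μ m fun ξ => f ξ * g ξ :=
  ⟨hf.meas.mul hg.meas, fun _ _ h => congrArg₂ _ (hf.dep h) (hg.dep h), hf.mom.mul hg.mom⟩

variable [IsProbabilityMeasure μ]

theorem const (c : ℝ) : Adapted μ m (fun _ : Fin n → ℝ => c) :=
  ⟨measurable_const, fun _ _ _ => rfl, AllMoments.const c⟩

theorem pow (hf : Adapted μ m f) (k : ℕ) : Adapted μ m fun ξ => f ξ ^ k :=
  ⟨hf.meas.pow_const k, fun _ _ h => congrArg (· ^ k) (hf.dep h), hf.mom.pow k⟩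

omit [IsProbabilityMeasure μ] in
theorem sum {ι : Type*} (s : Finset ι) {F : ι → (Fin n → ℝ) → ℝ}
    (h : ∀ i ∈ s, Adapted μ m (F i)) : Adapted μ m fun ξ => ∑ i ∈ s, F i ξ :=
  ⟨Finset.measurable_fun_sum s fun i hi => (h i hi).meas,
    fun _ _ hxy => Finset.sum_congr rfl fun i hi => (h i hi).dep hxy,
    AllMoments.sum s fun i hi => (h i hi).mom⟩

theorem eval (hμ : AllMoments μ id) (i : Fin n) (h : i.val < m) : Adapted μ m fun ξ => ξ i :=
  ⟨measurable_pi_apply i, fun _ _ hxy => hxy i h, fun q =>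
    (hμ q).comp_measurePreserving (measurePreserving_eval (fun _ : Fin n => μ) i)⟩

/-- Independence of the past from the coordinate `i` replaces conditional expectations throughout.
Padding the past with zeros (`ext`) displays `f` as a function of the earlier coordinates only,
since `f` ignores the others. -/
theorem integral_mul_comp_eval {i : Fin n} (hf : Adapted μ i.val f) {φ : ℝ → ℝ}
    (hφ : Measurable φ) :
    ∫ ξ, f ξ * φ (ξ i) ∂(Measure.pi fun _ : Fin n => μ) =
      (∫ ξ, f ξ ∂(Measure.pi fun _ : Fin n => μ)) * ∫ x, φ x ∂μ := by
  have hind := (ProbabilityTheory.iIndepFun_pi (μ := fun _ : Fin n => μ)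
    (X := fun _ x => x) fun _ => aemeasurable_id).indepFun_finset (before n i.val) {i}
    (by rw [Finset.disjoint_singleton_right]; simp [mem_before]) fun j => measurable_pi_apply j
  let ext : (before n i.val → ℝ) → Fin n → ℝ := fun z j =>
    if h : j ∈ before n i.val then z ⟨j, h⟩ else 0
  have hext : Measurable ext := by
    refine measurable_pi_lambda _ fun j => ?_
    by_cases h : j ∈ before n i.val
    · simp only [ext, h, dite_true]
      exact measurable_pi_apply _
    · simp only [ext, h, dite_false]
      exact measurable_const
  have h2 := hind.comp (hf.meas.comp hext)
    (hφ.comp (measurable_pi_apply (⟨i, Finset.mem_singleton_self i⟩ : ({i} : Finset (Fin n)))))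
  have e1 : ((f ∘ ext) ∘ fun (a : Fin n → ℝ) (j : before n i.val) => a j) = f := by
    funext ξ
    refine hf.dep fun j hj => ?_
    simp only [ext, mem_before.mpr hj, dite_true]
  rw [e1] at h2
  rw [← integral_comp_eval (μ := fun _ : Fin n => μ) (i := i) (f := φ) hφ.aestronglyMeasurable]
  exact h2.integral_fun_mul_eq_mul_integral hf.meas.aestronglyMeasurable
    (hφ.comp (measurable_pi_apply i)).aestronglyMeasurable

end Adapted

/-- A centred noise law with unit variance and finite moments. -/
structure IsNoise (μ : Measure ℝ) : Prop where
  prob : IsProbabilityMeasure μ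
  mom : AllMoments μ id
  mean : ∫ x, x ∂μ = 0
  var : ∫ x, x ^ 2 ∂μ = 1

section Martingale

variable {n : ℕ} {μ : Measure ℝ}

theorem integral_sq_sum_of_orthogonal {P : Measure (Fin n → ℝ)} {D : Fin n → (Fin n → ℝ) → ℝ}
    (hD : ∀ i, AllMoments P (D i)) (h0 : ∀ i j, j < i → ∫ ξ, D j ξ * D i ξ ∂P = 0) :
    ∫ ξ, (∑ i, D i ξ) ^ 2 ∂P = ∑ i, ∫ ξ, D i ξ ^ 2 ∂P := by
  have e : ∀ ξ, (∑ i, D i ξ) ^ 2 = ∑ i, ∑ j, D i ξ * D j ξ := fun ξ => by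
    rw [sq, Finset.sum_mul_sum]
  simp_rw [e]
  rw [integral_finsetSum _ fun i _ => integrable_finsetSum _ fun j _ =>
    ((hD i).mul (hD j)).integrable]
  refine Finset.sum_congr rfl fun i _ => ?_
  rw [integral_finsetSum _ fun j _ => ((hD i).mul (hD j)).integrable]
  rw [Finset.sum_eq_single i]
  · simp_rw [sq]
  · intro j _ hj
    rcases lt_or_gt_of_ne hj with h | h
    · simp_rw [mul_comm (D i _)]
      exact h0 i j h
    · exact h0 j i h
  · simp

variable (hμ : IsNoise μ)
include hμ

theorem integral_adapted_mul_eval {i : Fin n} {f : (Fin n → ℝ) → ℝ} (hf : Adapted μ i.val f) :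
    ∫ ξ, f ξ * ξ i ∂(Measure.pi fun _ : Fin n => μ) = 0 := by
  have := hμ.prob
  rw [hf.integral_mul_comp_eval (φ := fun x => x) measurable_id, hμ.mean, mul_zero]

theorem integral_adapted_mul_eval_sq {i : Fin n} {f : (Fin n → ℝ) → ℝ} (hf : Adapted μ i.val f) :
    ∫ ξ, f ξ * ξ i ^ 2 ∂(Measure.pi fun _ : Fin n => μ) =
      ∫ ξ, f ξ ∂(Measure.pi fun _ : Fin n => μ) := by
  have := hμ.prob
  rw [hf.integral_mul_comp_eval (φ := fun x => x ^ 2) (measurable_id.pow_const 2), hμ.var, mul_one]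

theorem integrable_sq_noise (k : ℕ) : Integrable (fun x : ℝ => x ^ k) μ := by
  have := hμ.prob
  exact (hμ.mom.pow k).integrable

theorem integral_adapted_mul_eval_sq_sub_one {i : Fin n} {f : (Fin n → ℝ) → ℝ}
    (hf : Adapted μ i.val f) :
    ∫ ξ, f ξ * (ξ i ^ 2 - 1) ∂(Measure.pi fun _ : Fin n => μ) = 0 := by
  have := hμ.prob
  rw [hf.integral_mul_comp_eval (φ := fun x => x ^ 2 - 1) ((measurable_id.pow_const 2).sub_const 1),
    integral_sub (integrable_sq_noise hμ 2) (integrable_const 1), hμ.var]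
  simp

theorem integral_adapted_mul_sq_eval_sq_sub_one_le {i : Fin n} {f : (Fin n → ℝ) → ℝ} {m4 : ℝ}
    (h4 : ∫ x, x ^ 4 ∂μ ≤ m4) (hf : Adapted μ i.val f) (h0 : ∀ ξ, 0 ≤ f ξ) :
    ∫ ξ, f ξ * (ξ i ^ 2 - 1) ^ 2 ∂(Measure.pi fun _ : Fin n => μ) ≤
      m4 * ∫ ξ, f ξ ∂(Measure.pi fun _ : Fin n => μ) := by
  have := hμ.prob
  rw [hf.integral_mul_comp_eval (φ := fun x => (x ^ 2 - 1) ^ 2)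
    (((measurable_id.pow_const 2).sub_const 1).pow_const 2), mul_comm]
  refine mul_le_mul_of_nonneg_right (le_trans ?_ h4) (integral_nonneg h0)
  have e : ∀ x : ℝ, (x ^ 2 - 1) ^ 2 = x ^ 4 - 2 * x ^ 2 + 1 := fun x => by ring
  simp_rw [e]
  have i4 := integrable_sq_noise hμ 4
  have i2 := (integrable_sq_noise hμ 2).const_mul 2
  rw [integral_add (f := fun x : ℝ => x ^ 4 - 2 * x ^ 2) (i4.sub i2) (integrable_const 1),
    integral_sub i4 i2, integral_const_mul, hμ.var]
  simp only [integral_const, probReal_univ, smul_eq_mul]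
  linarith

/-- The second moment of a sum of martingale differences `α_i ξ_i + β_i (ξ_i² - 1)`. -/
theorem integral_sq_sum_le {α β : Fin n → (Fin n → ℝ) → ℝ} {m4 : ℝ} (h4 : ∫ x, x ^ 4 ∂μ ≤ m4)
    (hα : ∀ i : Fin n, Adapted μ i.val (α i)) (hβ : ∀ i : Fin n, Adapted μ i.val (β i)) :
    ∫ ξ, (∑ i, (α i ξ * ξ i + β i ξ * (ξ i ^ 2 - 1))) ^ 2 ∂(Measure.pi fun _ : Fin n => μ) ≤
      ∑ i, (2 * ∫ ξ, α i ξ ^ 2 ∂(Measure.pi fun _ : Fin n => μ) +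
        2 * m4 * ∫ ξ, β i ξ ^ 2 ∂(Measure.pi fun _ : Fin n => μ)) := by
  have := hμ.prob
  have hx : ∀ i : Fin n, Adapted μ (i.val + 1) fun ξ : Fin n → ℝ => ξ i := fun i =>
    Adapted.eval hμ.mom i (Nat.lt_succ_self _)
  have hD : ∀ i : Fin n, Adapted μ (i.val + 1)
      fun ξ => α i ξ * ξ i + β i ξ * (ξ i ^ 2 - 1) := fun i =>
    (((hα i).mono (Nat.le_succ _)).mul (hx i)).add
      (((hβ i).mono (Nat.le_succ _)).mul (((hx i).pow 2).sub (Adapted.const 1)))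
  rw [integral_sq_sum_of_orthogonal (fun i => (hD i).mom)]
  · refine Finset.sum_le_sum fun i _ => ?_
    have a1 := ((hα i).pow 2).mom.mul ((hx i).pow 2).mom
    have b1 := ((hβ i).pow 2).mom.mul (((((hx i).pow 2).sub (Adapted.const 1))).pow 2).mom
    calc ∫ ξ, (α i ξ * ξ i + β i ξ * (ξ i ^ 2 - 1)) ^ 2 ∂(Measure.pi fun _ : Fin n => μ)
        ≤ ∫ ξ, (2 * (α i ξ ^ 2 * ξ i ^ 2) + 2 * (β i ξ ^ 2 * (ξ i ^ 2 - 1) ^ 2))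
            ∂(Measure.pi fun _ : Fin n => μ) := by
          refine integral_mono ((hD i).pow 2).mom.integrable
            ((a1.integrable.const_mul 2).add (b1.integrable.const_mul 2)) fun ξ => ?_
          have := sq_nonneg (α i ξ * ξ i - β i ξ * (ξ i ^ 2 - 1))
          simp only
          nlinarith
      _ = 2 * ∫ ξ, α i ξ ^ 2 ∂(Measure.pi fun _ : Fin n => μ) +
          2 * ∫ ξ, β i ξ ^ 2 * (ξ i ^ 2 - 1) ^ 2 ∂(Measure.pi fun _ : Fin n => μ) := by
          rw [integral_add (a1.integrable.const_mul 2) (b1.integrable.const_mul 2),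
            integral_const_mul, integral_const_mul, integral_adapted_mul_eval_sq hμ ((hα i).pow 2)]
      _ ≤ _ := by
          have := integral_adapted_mul_sq_eval_sq_sub_one_le hμ h4 ((hβ i).pow 2)
            fun ξ => sq_nonneg _
          linarith
  · intro i j hij
    have hj := (hD j).mono (Nat.succ_le_of_lt hij)
    have e : ∀ ξ : Fin n → ℝ, (α j ξ * ξ j + β j ξ * (ξ j ^ 2 - 1)) *
        (α i ξ * ξ i + β i ξ * (ξ i ^ 2 - 1)) =
        (α j ξ * ξ j + β j ξ * (ξ j ^ 2 - 1)) * α i ξ * ξ i +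
        (α j ξ * ξ j + β j ξ * (ξ j ^ 2 - 1)) * β i ξ * (ξ i ^ 2 - 1) := fun ξ => by ring
    simp_rw [e]
    rw [integral_add, integral_adapted_mul_eval hμ (hj.mul (hα i)),
      integral_adapted_mul_eval_sq_sub_one hμ (hj.mul (hβ i)), add_zero]
    · exact ((hj.mul (hα i)).mom.mul (hx i).mom).integrable
    · exact ((hj.mul (hβ i)).mom.mul (((hx i).pow 2).sub (Adapted.const 1)).mom).integrable

/-- The second moment of a martingale transform. -/
theorem integral_sq_linear {α : Fin n → (Fin n → ℝ) → ℝ}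
    (hα : ∀ i : Fin n, Adapted μ i.val (α i)) :
    ∫ ξ, (∑ i, α i ξ * ξ i) ^ 2 ∂(Measure.pi fun _ : Fin n => μ) =
      ∑ i, ∫ ξ, α i ξ ^ 2 ∂(Measure.pi fun _ : Fin n => μ) := by
  have := hμ.prob
  have hx : ∀ i : Fin n, Adapted μ (i.val + 1) fun ξ : Fin n → ℝ => ξ i := fun i =>
    Adapted.eval hμ.mom i (Nat.lt_succ_self _)
  have hD : ∀ i : Fin n, Adapted μ (i.val + 1) fun ξ => α i ξ * ξ i := fun i =>
    ((hα i).mono (Nat.le_succ _)).mul (hx i)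
  rw [integral_sq_sum_of_orthogonal (fun i => (hD i).mom)]
  · refine Finset.sum_congr rfl fun i _ => ?_
    simp_rw [mul_pow]
    exact integral_adapted_mul_eval_sq hμ ((hα i).pow 2)
  · intro i j hij
    have hj := ((hD j).mono (Nat.succ_le_of_lt hij)).mul (hα i)
    simp_rw [← mul_assoc]
    exact integral_adapted_mul_eval hμ hj

/-- Integration by parts: a martingale transform squared, summed against a bounded clock. -/
theorem sum_integral_clock_mul_sq_le {v c : Fin n → (Fin n → ℝ) → ℝ} {s : ℝ}
    (hv : ∀ i : Fin n, Adapted μ i.val (v i)) (hc : ∀ i : Fin n, Adapted μ i.val (c i))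
    (hs : ∀ ξ, ∑ i, v i ξ ^ 2 ≤ s) :
    ∑ i, ∫ ξ, v i ξ ^ 2 * (∑ j ∈ before n i.val, c j ξ * ξ j) ^ 2
        ∂(Measure.pi fun _ : Fin n => μ) ≤
      s * ∑ i, ∫ ξ, c i ξ ^ 2 ∂(Measure.pi fun _ : Fin n => μ) := by
  have := hμ.prob
  set P := Measure.pi fun _ : Fin n => μ with hP
  have hX : ∀ m, Adapted μ m fun ξ => ∑ j ∈ before n m, c j ξ * ξ j := fun m =>
    Adapted.sum _ fun j hj => ((hc j).mono (mem_before.mp hj).le).mul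
      (Adapted.eval hμ.mom j (mem_before.mp hj))
  -- The clock including index `m` is already known at time `m`, because `v` is predictable; this
  -- makes the cross term with `ξ_m` vanish below.
  have hA : ∀ m, Adapted μ m fun ξ => s - ∑ j ∈ before n (m + 1), v j ξ ^ 2 := fun m =>
    (Adapted.const s).sub (Adapted.sum _ fun j hj =>
      ((hv j).mono (Nat.lt_succ_iff.mp (mem_before.mp hj))).pow 2)
  have hA' : ∀ m, Adapted μ m fun ξ => s - ∑ j ∈ before n m, v j ξ ^ 2 := fun m =>
    (Adapted.const s).sub (Adapted.sum _ fun j hj =>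
      ((hv j).mono (mem_before.mp hj).le).pow 2)
  have hle : ∀ m ξ, ∑ j ∈ before n m, v j ξ ^ 2 ≤ s := fun m ξ =>
    (Finset.sum_le_univ_sum_of_nonneg fun j => sq_nonneg _).trans (hs ξ)
  -- Discrete summation by parts with `(s - clock) X²`: in one step the clock releases the term
  -- `v_i² X²`, while `X²` gains on average at most `s E c_i²`. The product is nonnegative at the
  -- end and can be dropped, so no maximal inequality is involved.
  have key : ∀ m ≤ n, ∑ i ∈ before n m, ∫ ξ, v i ξ ^ 2 *
      (∑ j ∈ before n i.val, c j ξ * ξ j) ^ 2 ∂P +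
      ∫ ξ, (s - ∑ j ∈ before n m, v j ξ ^ 2) * (∑ j ∈ before n m, c j ξ * ξ j) ^ 2 ∂P ≤
      s * ∑ i ∈ before n m, ∫ ξ, c i ξ ^ 2 ∂P := by
    intro m
    induction m with
    | zero => simp [before]
    | succ m ih =>
      intro hm
      have hmn : m < n := hm
      have ih := ih hmn.le
      rw [before_succ hmn, Finset.sum_insert (notMem_before hmn),
        Finset.sum_insert (notMem_before hmn), ← before_succ hmn]
      set i : Fin n := ⟨m, hmn⟩ with hi
      have ci : Adapted μ m (c i) := hc i
      have vi : Adapted μ m (v i) := hv i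
      have e : ∀ ξ : Fin n → ℝ, (s - ∑ j ∈ before n (m + 1), v j ξ ^ 2) *
          (∑ j ∈ before n (m + 1), c j ξ * ξ j) ^ 2 =
          ((s - ∑ j ∈ before n m, v j ξ ^ 2) * (∑ j ∈ before n m, c j ξ * ξ j) ^ 2 -
            v i ξ ^ 2 * (∑ j ∈ before n m, c j ξ * ξ j) ^ 2) +
          (2 * ((s - ∑ j ∈ before n (m + 1), v j ξ ^ 2) * (∑ j ∈ before n m, c j ξ * ξ j) *
            c i ξ) * ξ i + ((s - ∑ j ∈ before n (m + 1), v j ξ ^ 2) * c i ξ ^ 2) * ξ i ^ 2) := by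
        intro ξ
        rw [before_succ hmn, Finset.sum_insert (notMem_before hmn),
          Finset.sum_insert (notMem_before hmn)]
        ring
      have a1 := (hA' m).mul ((hX m).pow 2)
      have a2 := (vi.pow 2).mul ((hX m).pow 2)
      have a3 := (Adapted.const 2).mul (((hA m).mul (hX m)).mul ci)
      have a4 := (hA m).mul (ci.pow 2)
      have hx : Adapted μ (m + 1) fun ξ : Fin n → ℝ => ξ i :=
        Adapted.eval hμ.mom i (Nat.lt_succ_self _)
      have a5 := (a3.mono (Nat.le_succ m)).mul hx
      have a6 := (a4.mono (Nat.le_succ m)).mul (hx.pow 2)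
      have e2 : ∫ ξ, (s - ∑ j ∈ before n (m + 1), v j ξ ^ 2) * c i ξ ^ 2 ∂P ≤
          s * ∫ ξ, c i ξ ^ 2 ∂P := by
        rw [← integral_const_mul]
        refine integral_mono a4.mom.integrable ((ci.pow 2).mom.integrable.const_mul s) fun ξ => ?_
        refine mul_le_mul_of_nonneg_right ?_ (sq_nonneg _)
        have := Finset.sum_nonneg (s := before n (m + 1)) fun j _ => sq_nonneg (v j ξ)
        linarith
      have e3 : ∫ ξ, (s - ∑ j ∈ before n (m + 1), v j ξ ^ 2) *
          (∑ j ∈ before n (m + 1), c j ξ * ξ j) ^ 2 ∂P =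
          ∫ ξ, (s - ∑ j ∈ before n m, v j ξ ^ 2) * (∑ j ∈ before n m, c j ξ * ξ j) ^ 2 ∂P -
          ∫ ξ, v i ξ ^ 2 * (∑ j ∈ before n m, c j ξ * ξ j) ^ 2 ∂P +
          ∫ ξ, (s - ∑ j ∈ before n (m + 1), v j ξ ^ 2) * c i ξ ^ 2 ∂P := by
        simp_rw [e]
        rw [integral_add (a1.sub a2).mom.integrable (a5.add a6).mom.integrable,
          integral_sub a1.mom.integrable a2.mom.integrable,
          integral_add a5.mom.integrable a6.mom.integrable,
          integral_adapted_mul_eval hμ (i := i) a3,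
          integral_adapted_mul_eval_sq hμ (i := i) a4, zero_add]
      rw [e3]
      have : i.val = m := rfl
      rw [this]
      linarith
  have h := key n le_rfl
  rw [before_self] at h
  have h0 : 0 ≤ ∫ ξ, (s - ∑ j, v j ξ ^ 2) * (∑ j, c j ξ * ξ j) ^ 2 ∂P :=
    integral_nonneg fun ξ => mul_nonneg (sub_nonneg.mpr (hs ξ)) (sq_nonneg _)
  linarith

end Martingale

end SeqAR

namespace SeqAR

/-! ### Linear and quadratic forms in block noises with disjoint supports. -/

section Forms

/-- At most one `v l` is nonzero. Applied at each time, it prevents the number of blocks from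
entering the moment bounds. -/
theorem sq_sum_of_disjoint {ι : Type*} [Fintype ι] {v : ι → ℝ}
    (h : ∀ l l', l ≠ l' → v l * v l' = 0) (x : ι → ℝ) :
    (∑ l, v l * x l) ^ 2 = ∑ l, v l ^ 2 * x l ^ 2 := by
  rw [sq, Finset.sum_mul_sum]
  refine Finset.sum_congr rfl fun l _ => ?_
  rw [Finset.sum_eq_single l]
  · ring
  · intro l' _ hl
    rw [mul_mul_mul_comm, h l l' hl.symm, zero_mul]
  · simp

/-- Ordering the pairs in time turns a quadratic form in the noise into a sum of martingale
differences. -/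
theorem sum_sum_symm {n : ℕ} (A : Fin n → Fin n → ℝ) (hA : ∀ i j, A i j = A j i) :
    ∑ i, ∑ j, A i j = ∑ i, (A i i + 2 * ∑ j ∈ before n i.val, A i j) := by
  have h1 : ∀ i : Fin n, ∑ j, A i j = A i i + ∑ j ∈ before n i.val, A i j +
      ∑ j, if i.val < j.val then A i j else 0 := by
    intro i
    rw [before, Finset.sum_filter, add_assoc, ← Finset.sum_add_distrib,
      ← Finset.add_sum_erase _ _ (Finset.mem_univ i),
      ← Finset.add_sum_erase _ (fun j => (if j.val < i.val then A i j else 0) +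
        if i.val < j.val then A i j else 0) (Finset.mem_univ i)]
    simp only [lt_irrefl, if_false, add_zero, zero_add]
    congr 1
    refine Finset.sum_congr rfl fun j hj => ?_
    have hne : j.val ≠ i.val := fun h => (Finset.mem_erase.mp hj).1 (Fin.ext h)
    rcases lt_or_gt_of_ne hne with h | h
    · simp [h, h.not_gt]
    · simp [h, h.not_gt]
  have h2 : ∑ i : Fin n, ∑ j, (if i.val < j.val then A i j else 0) =
      ∑ i : Fin n, ∑ j ∈ before n i.val, A i j := by
    rw [Finset.sum_comm]
    refine Finset.sum_congr rfl fun i _ => ?_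
    rw [before, Finset.sum_filter]
    exact Finset.sum_congr rfl fun j _ => by rw [hA]
  simp_rw [h1, Finset.sum_add_distrib, ← Finset.mul_sum]
  rw [h2]
  ring

variable {n d : ℕ} {μ : Measure ℝ} (hμ : IsNoise μ)
  {v : Fin d → Fin n → (Fin n → ℝ) → ℝ} {s : ℝ}
  (hv : ∀ l (i : Fin n), Adapted μ i.val (v l i))
  (hdis : ∀ l l' i ξ, l ≠ l' → v l i ξ * v l' i ξ = 0)
  (hs : ∀ l ξ, ∑ i, v l i ξ ^ 2 ≤ s)
include hμ hv hdis hs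

/-- Linear forms of the block noises `e_l = ∑_i v_{l,i} ξ_i`. -/
theorem integral_sq_linear_form_le (f : Fin d → ℝ) :
    ∫ ξ, (∑ l, f l * ∑ i, v l i ξ * ξ i) ^ 2 ∂(Measure.pi fun _ : Fin n => μ) ≤
      s * ∑ l, f l ^ 2 := by
  have := hμ.prob
  have e : ∀ ξ : Fin n → ℝ, ∑ l, f l * ∑ i, v l i ξ * ξ i = ∑ i, (∑ l, v l i ξ * f l) * ξ i := by
    intro ξ
    simp_rw [Finset.mul_sum, Finset.sum_mul]
    rw [Finset.sum_comm]
    exact Finset.sum_congr rfl fun i _ => Finset.sum_congr rfl fun l _ => by ring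
  have hα : ∀ i : Fin n, Adapted μ i.val fun ξ => ∑ l, v l i ξ * f l := fun i =>
    Adapted.sum _ fun l _ => (hv l i).mul (Adapted.const (f l))
  simp_rw [e]
  rw [integral_sq_linear hμ hα, ← integral_finsetSum _ fun i _ => ((hα i).pow 2).mom.integrable]
  have h : ∀ ξ : Fin n → ℝ, ∑ i, (∑ l, v l i ξ * f l) ^ 2 ≤ s * ∑ l, f l ^ 2 := by
    intro ξ
    simp_rw [fun i => sq_sum_of_disjoint (fun l l' hl => hdis l l' i ξ hl) f]
    rw [Finset.sum_comm, Finset.mul_sum]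
    refine Finset.sum_le_sum fun l _ => ?_
    rw [← Finset.sum_mul]
    exact mul_le_mul_of_nonneg_right (hs l ξ) (sq_nonneg _)
  calc _ ≤ ∫ _, s * ∑ l, f l ^ 2 ∂(Measure.pi fun _ : Fin n => μ) :=
        integral_mono (integrable_finsetSum _ fun i _ => ((hα i).pow 2).mom.integrable)
          (integrable_const _) h
    _ = _ := by simp

/-- Centred quadratic forms of the block noises `e_l = ∑_i v_{l,i} ξ_i`. -/
theorem integral_sq_quadratic_form_le {m4 : ℝ} (h4 : ∫ x, x ^ 4 ∂μ ≤ m4) (hm4 : 0 ≤ m4)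
    (hs0 : 0 ≤ s) (D : Fin d → Fin d → ℝ) (hD : ∀ l l', D l l' = D l' l) :
    ∫ ξ, (∑ l, ∑ l', D l l' * (∑ i, v l i ξ * ξ i) * (∑ i, v l' i ξ * ξ i) -
        ∑ l, D l l * ∑ i, v l i ξ ^ 2) ^ 2 ∂(Measure.pi fun _ : Fin n => μ) ≤
      (8 + 2 * m4) * s ^ 2 * ∑ l, ∑ l', D l l' ^ 2 := by
  have := hμ.prob
  set P := Measure.pi fun _ : Fin n => μ with hP
  have hc : ∀ l (i : Fin n), Adapted μ i.val fun ξ => ∑ l', v l' i ξ * D l l' := fun l i =>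
    Adapted.sum _ fun l' _ => (hv l' i).mul (Adapted.const _)
  have hX : ∀ l m, Adapted μ m fun ξ => ∑ j ∈ before n m, (∑ l', v l' j ξ * D l l') * ξ j :=
    fun l m => Adapted.sum _ fun j hj => ((hc l j).mono (mem_before.mp hj).le).mul
      (Adapted.eval hμ.mom j (mem_before.mp hj))
  have hα : ∀ i : Fin n, Adapted μ i.val fun ξ =>
      2 * ∑ l, v l i ξ * ∑ j ∈ before n i.val, (∑ l', v l' j ξ * D l l') * ξ j := fun i =>
    (Adapted.const 2).mul (Adapted.sum _ fun l _ => (hv l i).mul (hX l i.val))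
  have hβ : ∀ i : Fin n, Adapted μ i.val fun ξ => ∑ l, D l l * v l i ξ ^ 2 := fun i =>
    Adapted.sum _ fun l _ => (Adapted.const _).mul ((hv l i).pow 2)
  -- Pairs of distinct times give a predictable coefficient times `ξ_i`. Equal times give, by
  -- disjointness, only the terms `D_{ll} v_{l,i}² ξ_i²`, and the subtracted variance centres them
  -- to `ξ_i² - 1`.
  have e : ∀ ξ : Fin n → ℝ,
      ∑ l, ∑ l', D l l' * (∑ i, v l i ξ * ξ i) * (∑ i, v l' i ξ * ξ i) -
        ∑ l, D l l * ∑ i, v l i ξ ^ 2 =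
      ∑ i, ((2 * ∑ l, v l i ξ * ∑ j ∈ before n i.val, (∑ l', v l' j ξ * D l l') * ξ j) * ξ i +
        (∑ l, D l l * v l i ξ ^ 2) * (ξ i ^ 2 - 1)) := by
    intro ξ
    have e1 : ∑ l, ∑ l', D l l' * (∑ i, v l i ξ * ξ i) * (∑ i, v l' i ξ * ξ i) =
        ∑ i, ∑ j, ∑ l, ∑ l', D l l' * (v l i ξ * ξ i) * (v l' j ξ * ξ j) := by
      simp_rw [mul_assoc (D _ _), Finset.sum_mul_sum, Finset.mul_sum]
      rw [Finset.sum_congr rfl fun l _ => Finset.sum_comm, Finset.sum_comm]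
      refine Finset.sum_congr rfl fun i _ => ?_
      rw [Finset.sum_congr rfl fun l _ => Finset.sum_comm, Finset.sum_comm]
    have e2 : ∑ l, D l l * ∑ i, v l i ξ ^ 2 = ∑ i, ∑ l, D l l * v l i ξ ^ 2 := by
      simp_rw [Finset.mul_sum]
      rw [Finset.sum_comm]
    rw [e1, e2, sum_sum_symm, ← Finset.sum_sub_distrib]
    · refine Finset.sum_congr rfl fun i _ => ?_
      have e3 : ∑ l, ∑ l', D l l' * (v l i ξ * ξ i) * (v l' i ξ * ξ i) =
          (∑ l, D l l * v l i ξ ^ 2) * ξ i ^ 2 := by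
        rw [Finset.sum_mul]
        refine Finset.sum_congr rfl fun l _ => ?_
        rw [Finset.sum_eq_single l]
        · ring
        · intro l' _ hl
          have := hdis l l' i ξ hl.symm
          linear_combination D l l' * ξ i ^ 2 * this
        · simp
      have e4 : ∑ j ∈ before n i.val, ∑ l, ∑ l', D l l' * (v l i ξ * ξ i) * (v l' j ξ * ξ j) =
          (∑ l, v l i ξ * ∑ j ∈ before n i.val, (∑ l', v l' j ξ * D l l') * ξ j) * ξ i := by
        rw [Finset.sum_comm, Finset.sum_mul]
        refine Finset.sum_congr rfl fun l _ => ?_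
        simp_rw [Finset.mul_sum, Finset.sum_mul, Finset.mul_sum, Finset.sum_mul]
        exact Finset.sum_congr rfl fun j _ => Finset.sum_congr rfl fun l' _ => by ring
      rw [e3, e4]
      ring
    · intro i j
      rw [Finset.sum_comm]
      refine Finset.sum_congr rfl fun l _ => Finset.sum_congr rfl fun l' _ => ?_
      rw [hD l' l]
      ring
  simp_rw [e]
  refine (integral_sq_sum_le hμ h4 hα hβ).trans ?_
  have b1 : ∑ i, ∫ ξ, (2 * ∑ l, v l i ξ *
      ∑ j ∈ before n i.val, (∑ l', v l' j ξ * D l l') * ξ j) ^ 2 ∂P ≤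
      4 * (s * (s * ∑ l, ∑ l', D l l' ^ 2)) := by
    have c1 : ∀ i : Fin n, ∫ ξ, (2 * ∑ l, v l i ξ *
        ∑ j ∈ before n i.val, (∑ l', v l' j ξ * D l l') * ξ j) ^ 2 ∂P =
        4 * ∑ l, ∫ ξ, v l i ξ ^ 2 *
          (∑ j ∈ before n i.val, (∑ l', v l' j ξ * D l l') * ξ j) ^ 2 ∂P := by
      intro i
      simp_rw [mul_pow]
      simp_rw [fun ξ => sq_sum_of_disjoint (fun l l' hl => hdis l l' i ξ hl)
        fun l => ∑ j ∈ before n i.val, (∑ l', v l' j ξ * D l l') * ξ j]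
      rw [integral_const_mul, integral_finsetSum _ fun l _ =>
        (((hv l i).pow 2).mul ((hX l i.val).pow 2)).mom.integrable,
        show (2 : ℝ) ^ 2 = 4 by norm_num]
    simp_rw [c1, ← Finset.mul_sum]
    refine mul_le_mul_of_nonneg_left ?_ (by norm_num)
    rw [Finset.sum_comm, Finset.mul_sum, Finset.mul_sum]
    refine Finset.sum_le_sum fun l _ => ?_
    refine (sum_integral_clock_mul_sq_le hμ (hv l) (hc l) (hs l)).trans ?_
    refine mul_le_mul_of_nonneg_left ?_ hs0
    rw [← integral_finsetSum _ fun i _ => ((hc l i).pow 2).mom.integrable]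
    calc _ ≤ ∫ _, s * ∑ l', D l l' ^ 2 ∂P := by
          refine integral_mono (integrable_finsetSum _ fun i _ =>
            ((hc l i).pow 2).mom.integrable) (integrable_const _) fun ξ => ?_
          simp_rw [fun i => sq_sum_of_disjoint (fun l l' hl => hdis l l' i ξ hl) (D l)]
          rw [Finset.sum_comm, Finset.mul_sum]
          refine Finset.sum_le_sum fun l' _ => ?_
          rw [← Finset.sum_mul]
          exact mul_le_mul_of_nonneg_right (hs l' ξ) (sq_nonneg _)
      _ = _ := by simp [hP]
  -- One factor `v²` is bounded by `s` and the other is summed to `s`. Together with `b1`, this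
  -- gives the constant `2 · 4 + 2 · m4`.
  have b2 : ∑ i, ∫ ξ, (∑ l, D l l * v l i ξ ^ 2) ^ 2 ∂P ≤ s ^ 2 * ∑ l, ∑ l', D l l' ^ 2 := by
    rw [← integral_finsetSum _ fun i _ => ((hβ i).pow 2).mom.integrable]
    calc _ ≤ ∫ _, s ^ 2 * ∑ l, ∑ l', D l l' ^ 2 ∂P := by
          refine integral_mono (integrable_finsetSum _ fun i _ =>
            ((hβ i).pow 2).mom.integrable) (integrable_const _) fun ξ => ?_
          have c1 : ∀ i : Fin n, (∑ l, D l l * v l i ξ ^ 2) ^ 2 =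
              ∑ l, v l i ξ ^ 2 * (D l l * v l i ξ) ^ 2 := fun i => by
            rw [← sq_sum_of_disjoint (fun l l' hl => hdis l l' i ξ hl) fun l => D l l * v l i ξ]
            congr 1
            exact Finset.sum_congr rfl fun l _ => by ring
          simp_rw [c1]
          rw [Finset.sum_comm, Finset.mul_sum]
          refine Finset.sum_le_sum fun l _ => ?_
          have c2 : ∀ i : Fin n, v l i ξ ^ 2 * (D l l * v l i ξ) ^ 2 ≤
              v l i ξ ^ 2 * (s * D l l ^ 2) := fun i => by
            refine mul_le_mul_of_nonneg_left ?_ (sq_nonneg _)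
            rw [mul_pow, mul_comm]
            refine mul_le_mul_of_nonneg_right ?_ (sq_nonneg _)
            exact (Finset.single_le_sum (f := fun i => v l i ξ ^ 2) (fun i _ => sq_nonneg _)
              (Finset.mem_univ i)).trans (hs l ξ)
          refine (Finset.sum_le_sum fun i _ => c2 i).trans ?_
          rw [← Finset.sum_mul, sq s, mul_assoc]
          refine mul_le_mul (hs l ξ) (mul_le_mul_of_nonneg_left ?_ hs0) (by positivity) hs0
          exact Finset.single_le_sum (f := fun l' => D l l' ^ 2) (fun l' _ => sq_nonneg _)
            (Finset.mem_univ l)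
      _ = _ := by simp [hP]
  rw [Finset.sum_add_distrib, ← Finset.mul_sum, ← Finset.mul_sum]
  have := mul_le_mul_of_nonneg_left b2 hm4
  linarith

end Forms

end SeqAR

namespace SeqAR

/-! The sequential procedure as a martingale transform. -/

section Sequential

theorem kernelWeight_eq (a b : ℝ) (n l j : ℕ) :
    kernelWeight a b n l j = 0 ∨ kernelWeight a b n l j = 1 := by
  unfold kernelWeight indicator
  split_ifs <;> simp

theorem kernelWeight_nonneg (a b : ℝ) (n l j : ℕ) : 0 ≤ kernelWeight a b n l j := by
  rcases kernelWeight_eq a b n l j with h | h <;> simp [h]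

theorem abs_sub_le_of_kernelWeight {a b : ℝ} (hab : a < b) {n l j : ℕ} (hn : 1 ≤ n)
    (h : kernelWeight a b n l j ≠ 0) :
    |designPoint a b n j - gridPoint a b n l| ≤ bandwidth a b n := by
  have hh : 0 < bandwidth a b n := by
    have : 0 < gridSize n := Nat.sqrt_pos.mpr hn
    unfold bandwidth
    have : (0 : ℝ) < gridSize n := by exact_mod_cast this
    have := sub_pos.mpr hab
    positivity
  have := mem_of_indicator_ne_zero h
  rw [mem_Icc, ← abs_le, abs_div, abs_of_pos hh, div_le_one hh] at this
  exact this

/-- The energy clock stopped at the threshold; it is completed to the threshold at time `k_{2,l}`. -/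
noncomputable def cappedEnergy (a b μ₀ : ℝ) (n l : ℕ) (y : ℕ → ℝ) (k : ℕ) : ℝ :=
  if k < kTwo a b n l then
    min (energy a b n l y (iotaIdx a b μ₀ n l) k) (threshold a b μ₀ n l y)
  else threshold a b μ₀ n l y

/-- The predictable weights whose squares are the increments of the capped energy. -/
noncomputable def transformWeight (a b μ₀ : ℝ) (n l : ℕ) (y : ℕ → ℝ) (k : ℕ) : ℝ :=
  (if 0 ≤ y (k - 1) then 1 else -1) *
    Real.sqrt (cappedEnergy a b μ₀ n l y k - cappedEnergy a b μ₀ n l y (k - 1))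

/-- The normalised weight of the noise variable with index `i`, i.e. of time `i + 1`. -/
noncomputable def noiseWeight (a b μ₀ : ℝ) (n l : ℕ) (y : ℕ → ℝ) (i : ℕ) : ℝ :=
  if iotaIdx a b μ₀ n l < i + 1 ∧ i + 1 ≤ kTwo a b n l then
    transformWeight a b μ₀ n l y (i + 1) / threshold a b μ₀ n l y
  else 0

variable {a b μ₀ : ℝ} {n l : ℕ} {y : ℕ → ℝ}

theorem energy_self (k : ℕ) : energy a b n l y k k = 0 := by simp [energy]

theorem energy_succ {k m : ℕ} (h : k ≤ m) :
    energy a b n l y k (m + 1) =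
      energy a b n l y k m + kernelWeight a b n l (m + 1) * y m ^ 2 := by
  rw [energy, Finset.sum_Icc_succ_top (by omega)]
  simp [energy]

theorem energy_mono (k : ℕ) {m m' : ℕ} (h : m ≤ m') :
    energy a b n l y k m ≤ energy a b n l y k m' :=
  Finset.sum_le_sum_of_subset_of_nonneg (Finset.Icc_subset_Icc_right h) fun _ _ _ =>
    mul_nonneg (kernelWeight_nonneg _ _ _ _ _) (sq_nonneg _)

theorem cappedEnergy_mono {k m : ℕ} (h : k ≤ m) :
    cappedEnergy a b μ₀ n l y k ≤ cappedEnergy a b μ₀ n l y m := by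
  unfold cappedEnergy
  split_ifs with h1 h2
  · exact min_le_min_right _ (energy_mono _ h)
  · exact min_le_right _ _
  · omega
  · exact le_rfl

theorem transformWeight_sq (k : ℕ) :
    transformWeight a b μ₀ n l y k ^ 2 =
      cappedEnergy a b μ₀ n l y k - cappedEnergy a b μ₀ n l y (k - 1) := by
  rw [transformWeight, mul_pow, Real.sq_sqrt (sub_nonneg.mpr (cappedEnergy_mono (Nat.sub_le _ _)))]
  split_ifs <;> norm_num

/-- The squares telescope along the capped clock. The jump to the threshold at `k_{2,l}` makes the
identity hold on every path, also off `goodAt`, so the martingale bounds may be integrated over the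
whole space. -/
theorem sum_transformWeight_sq (hι : iotaIdx a b μ₀ n l < kTwo a b n l)
    (hH : 0 ≤ threshold a b μ₀ n l y) :
    ∑ k ∈ Finset.Icc (iotaIdx a b μ₀ n l + 1) (kTwo a b n l),
      transformWeight a b μ₀ n l y k ^ 2 = threshold a b μ₀ n l y := by
  have key : ∀ m, iotaIdx a b μ₀ n l ≤ m → ∑ k ∈ Finset.Icc (iotaIdx a b μ₀ n l + 1) m,
      transformWeight a b μ₀ n l y k ^ 2 =
      cappedEnergy a b μ₀ n l y m - cappedEnergy a b μ₀ n l y (iotaIdx a b μ₀ n l) := by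
    intro m hm
    induction m, hm using Nat.le_induction with
    | base => simp
    | succ m hm ih =>
      rw [Finset.sum_Icc_succ_top (by omega), ih, transformWeight_sq, Nat.add_sub_cancel]
      ring
  rw [key _ hι.le]
  simp [cappedEnergy, hι, energy_self, min_eq_left hH]

theorem sum_window {n i k : ℕ} (hk : k ≤ n) (f : ℕ → ℝ) :
    ∑ j : Fin n, (if i < j.val + 1 ∧ j.val + 1 ≤ k then f (j.val + 1) else 0) =
      ∑ j ∈ Finset.Icc (i + 1) k, f j := by
  rw [Fin.sum_univ_eq_sum_range (fun j => if i < j + 1 ∧ j + 1 ≤ k then f (j + 1) else 0) n,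
    ← Finset.sum_filter]
  refine Finset.sum_bij (fun j _ => j + 1) ?_ ?_ ?_ ?_
  · intro j hj
    simp only [Finset.mem_filter, Finset.mem_range, Finset.mem_Icc] at hj ⊢
    omega
  · intro j _ j' _ h
    omega
  · intro j hj
    rw [Finset.mem_Icc] at hj
    refine ⟨j - 1, ?_, by omega⟩
    simp only [Finset.mem_filter, Finset.mem_range]
    omega
  · intro j _
    rfl

theorem kTwo_le (a b : ℝ) (n l : ℕ) : kTwo a b n l ≤ n := min_le_right _ _

theorem sum_noiseWeight_mul (g : ℕ → ℝ) :
    ∑ i : Fin n, noiseWeight a b μ₀ n l y i.val * g (i.val + 1) =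
      (∑ k ∈ Finset.Icc (iotaIdx a b μ₀ n l + 1) (kTwo a b n l),
        transformWeight a b μ₀ n l y k * g k) / threshold a b μ₀ n l y := by
  rw [Finset.sum_div, ← sum_window (kTwo_le a b n l)]
  refine Finset.sum_congr rfl fun i _ => ?_
  unfold noiseWeight
  split_ifs <;> ring

theorem sum_noiseWeight_sq (hι : iotaIdx a b μ₀ n l < kTwo a b n l)
    (hH : 0 < threshold a b μ₀ n l y) :
    ∑ i : Fin n, noiseWeight a b μ₀ n l y i.val ^ 2 = sigmaSq a b μ₀ n l y := by
  have : ∑ i : Fin n, noiseWeight a b μ₀ n l y i.val ^ 2 =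
      (∑ k ∈ Finset.Icc (iotaIdx a b μ₀ n l + 1) (kTwo a b n l),
        transformWeight a b μ₀ n l y k ^ 2) / threshold a b μ₀ n l y ^ 2 := by
    rw [Finset.sum_div, ← sum_window (kTwo_le a b n l)]
    refine Finset.sum_congr rfl fun i _ => ?_
    unfold noiseWeight
    split_ifs
    · rw [div_pow]
    · ring
  rw [this, sum_transformWeight_sq hι hH.le, sigmaSq]
  field_simp

/-- Since `goodAt` asks for the threshold to be reached by time `k_{2,l} - 1`, the infimum is a
genuine crossing time, strictly before the default value `k_{2,l}`. -/
theorem stopTime_spec (hg : goodAt a b μ₀ n l y) (hι : iotaIdx a b μ₀ n l + 1 < kTwo a b n l) :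
    iotaIdx a b μ₀ n l + 1 ≤ stopTime a b μ₀ n l y ∧
    stopTime a b μ₀ n l y < kTwo a b n l ∧
    threshold a b μ₀ n l y ≤
      energy a b n l y (iotaIdx a b μ₀ n l) (stopTime a b μ₀ n l y) ∧
    ∀ k < stopTime a b μ₀ n l y,
      energy a b n l y (iotaIdx a b μ₀ n l) k < threshold a b μ₀ n l y := by
  set T : Set ℕ := {k | iotaIdx a b μ₀ n l + 1 ≤ k ∧ k ≤ kTwo a b n l ∧
    threshold a b μ₀ n l y ≤ energy a b n l y (iotaIdx a b μ₀ n l) k} ∪ {kTwo a b n l} with hT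
  have hτ : stopTime a b μ₀ n l y = sInf T := rfl
  have h1 : kTwo a b n l - 1 ∈ T := Or.inl ⟨by omega, by omega, hg.2⟩
  have h2 : stopTime a b μ₀ n l y ≤ kTwo a b n l - 1 := Nat.sInf_le h1
  have h3 : stopTime a b μ₀ n l y ∈ T := Nat.sInf_mem ⟨_, h1⟩
  rcases h3 with h3 | h3
  · refine ⟨h3.1, by omega, h3.2.2, fun k hk => ?_⟩
    rcases le_or_gt (iotaIdx a b μ₀ n l + 1) k with h4 | h4
    · by_contra! h5
      exact Nat.notMem_of_lt_sInf (hτ ▸ hk) (Or.inl ⟨h4, by omega, h5⟩)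
    · refine lt_of_le_of_lt (energy_mono _ (Nat.lt_succ_iff.mp h4)) ?_
      rw [energy_self]
      exact hg.1
  · simp only [mem_singleton_iff] at h3
    omega

theorem sign_mul_abs (x : ℝ) : (if 0 ≤ x then 1 else -1) * |x| = x := by
  split_ifs with h
  · rw [abs_of_nonneg h, one_mul]
  · rw [abs_of_neg (not_le.mp h)]
    ring

theorem transformWeight_before_stop (hg : goodAt a b μ₀ n l y)
    (hι : iotaIdx a b μ₀ n l + 1 < kTwo a b n l) {k : ℕ} (h1 : iotaIdx a b μ₀ n l + 1 ≤ k)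
    (h2 : k < stopTime a b μ₀ n l y) :
    transformWeight a b μ₀ n l y k = kernelWeight a b n l k * y (k - 1) := by
  obtain ⟨-, s2, -, s4⟩ := stopTime_spec hg hι
  obtain ⟨k, rfl⟩ : ∃ k', k = k' + 1 := ⟨k - 1, by omega⟩
  have e1 : cappedEnergy a b μ₀ n l y (k + 1) =
      energy a b n l y (iotaIdx a b μ₀ n l) (k + 1) := by
    rw [cappedEnergy, if_pos (by omega), min_eq_left (s4 _ h2).le]
  have e2 : cappedEnergy a b μ₀ n l y k = energy a b n l y (iotaIdx a b μ₀ n l) k := by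
    rw [cappedEnergy, if_pos (by omega), min_eq_left (s4 _ (by omega)).le]
  rw [transformWeight, Nat.add_sub_cancel, e1, e2, energy_succ (by omega), add_sub_cancel_left]
  rcases kernelWeight_eq a b n l (k + 1) with h | h
  · simp [h]
  · rw [h, one_mul, Real.sqrt_sq_eq_abs, sign_mul_abs, one_mul]

/-- The energy must increase strictly at the crossing time. Consequently the quotient defining
`corrCoef` has a positive denominator and is at most one. -/
theorem kernelWeight_stop (hg : goodAt a b μ₀ n l y)
    (hι : iotaIdx a b μ₀ n l + 1 < kTwo a b n l) :
    kernelWeight a b n l (stopTime a b μ₀ n l y) = 1 ∧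
      0 < y (stopTime a b μ₀ n l y - 1) ^ 2 ∧
      threshold a b μ₀ n l y - energy a b n l y (iotaIdx a b μ₀ n l) (stopTime a b μ₀ n l y - 1) ≤
        y (stopTime a b μ₀ n l y - 1) ^ 2 := by
  obtain ⟨s1, s2, s3, s4⟩ := stopTime_spec hg hι
  obtain ⟨t, ht⟩ : ∃ t, stopTime a b μ₀ n l y = t + 1 := ⟨stopTime a b μ₀ n l y - 1, by omega⟩
  have h4 := s4 t (by omega)
  rw [ht] at s3 ⊢
  rw [energy_succ (by omega)] at s3
  rw [Nat.add_sub_cancel]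
  rcases kernelWeight_eq a b n l (t + 1) with h | h
  · rw [h] at s3
    linarith
  · rw [h] at s3
    exact ⟨h, by linarith, by linarith⟩

theorem transformWeight_stop (hg : goodAt a b μ₀ n l y)
    (hι : iotaIdx a b μ₀ n l + 1 < kTwo a b n l) :
    transformWeight a b μ₀ n l y (stopTime a b μ₀ n l y) =
      corrCoef a b μ₀ n l y * y (stopTime a b μ₀ n l y - 1) := by
  obtain ⟨s1, s2, s3, s4⟩ := stopTime_spec hg hι
  obtain ⟨q1, q2, q3⟩ := kernelWeight_stop hg hι
  have e1 : cappedEnergy a b μ₀ n l y (stopTime a b μ₀ n l y) = threshold a b μ₀ n l y := by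
    rw [cappedEnergy, if_pos s2, min_eq_right s3]
  have e2 : cappedEnergy a b μ₀ n l y (stopTime a b μ₀ n l y - 1) =
      energy a b n l y (iotaIdx a b μ₀ n l) (stopTime a b μ₀ n l y - 1) := by
    rw [cappedEnergy, if_pos (by omega), min_eq_left (s4 _ (by omega)).le]
  rw [transformWeight, corrCoef, q1, one_mul, e1, e2,
    Real.sqrt_div' _ (sq_nonneg _), Real.sqrt_sq_eq_abs]
  generalize y (stopTime a b μ₀ n l y - 1) = x at q2
  have h0 : |x| ≠ 0 := by
    rw [Ne, abs_eq_zero]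
    rintro rfl
    norm_num at q2
  have h1 := sign_mul_abs x
  nth_rw 4 [← h1]
  field_simp

theorem transformWeight_after_stop (hg : goodAt a b μ₀ n l y)
    (hι : iotaIdx a b μ₀ n l + 1 < kTwo a b n l) {k : ℕ} (h : stopTime a b μ₀ n l y < k) :
    transformWeight a b μ₀ n l y k = 0 := by
  obtain ⟨s1, s2, s3, s4⟩ := stopTime_spec hg hι
  have e : ∀ m, stopTime a b μ₀ n l y ≤ m →
      cappedEnergy a b μ₀ n l y m = threshold a b μ₀ n l y := by
    intro m hm
    rw [cappedEnergy, min_eq_right (s3.trans (energy_mono _ hm)), ite_self]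
  rw [transformWeight, e k h.le, e (k - 1) (by omega), sub_self, Real.sqrt_zero, mul_zero]

theorem sum_transformWeight_mul (hg : goodAt a b μ₀ n l y)
    (hι : iotaIdx a b μ₀ n l + 1 < kTwo a b n l) (g : ℕ → ℝ) :
    ∑ k ∈ Finset.Icc (iotaIdx a b μ₀ n l + 1) (kTwo a b n l),
      transformWeight a b μ₀ n l y k * g k =
    (∑ j ∈ Finset.Icc (iotaIdx a b μ₀ n l + 1) (stopTime a b μ₀ n l y - 1),
      kernelWeight a b n l j * y (j - 1) * g j) +
    corrCoef a b μ₀ n l y * y (stopTime a b μ₀ n l y - 1) * g (stopTime a b μ₀ n l y) := by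
  obtain ⟨s1, s2, s3, s4⟩ := stopTime_spec hg hι
  have h1 : ∑ k ∈ Finset.Icc (iotaIdx a b μ₀ n l + 1) (stopTime a b μ₀ n l y),
      transformWeight a b μ₀ n l y k * g k =
      ∑ k ∈ Finset.Icc (iotaIdx a b μ₀ n l + 1) (kTwo a b n l),
      transformWeight a b μ₀ n l y k * g k := by
    refine Finset.sum_subset (Finset.Icc_subset_Icc_right s2.le) fun k hk hk' => ?_
    rw [Finset.mem_Icc] at hk hk'
    rw [transformWeight_after_stop hg hι (by omega), zero_mul]
  rw [← h1, ← transformWeight_stop hg hι]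
  obtain ⟨t, ht⟩ : ∃ t, stopTime a b μ₀ n l y = t + 1 := ⟨stopTime a b μ₀ n l y - 1, by omega⟩
  rw [ht, Finset.sum_Icc_succ_top (by omega), Nat.add_sub_cancel]
  congr 1
  refine Finset.sum_congr rfl fun k hk => ?_
  rw [Finset.mem_Icc] at hk
  rw [transformWeight_before_stop hg hι hk.1 (by omega)]

/-- On `goodAt` the signed square roots of the clock increments are exactly the coefficients of the
estimator: `Q y` before stopping, `ϰ y` at stopping, zero afterwards. In particular the artificial
last jump is absent. -/
theorem seqEst_eq (hg : goodAt a b μ₀ n l y) (hι : iotaIdx a b μ₀ n l + 1 < kTwo a b n l) :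
    seqEst a b μ₀ n l y = ∑ i : Fin n, noiseWeight a b μ₀ n l y i.val * y (i.val + 1) := by
  rw [sum_noiseWeight_mul, sum_transformWeight_mul hg hι, seqEst, if_pos hg,
    (kernelWeight_stop hg hι).1]
  ring

/-- The bias of the sequential estimator. -/
theorem abs_bias_le (hg : goodAt a b μ₀ n l y) (hι : iotaIdx a b μ₀ n l + 1 < kTwo a b n l)
    {f : ℕ → ℝ} {z r Y : ℝ} (hz : |z| ≤ 1) (hr : 0 ≤ r)
    (hf : ∀ k ∈ Finset.Icc 1 n, kernelWeight a b n l k ≠ 0 → |f k - z| ≤ r)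
    (hY : ∀ k ≤ n, |y k| ≤ Y) :
    |∑ i : Fin n, noiseWeight a b μ₀ n l y i.val * (f (i.val + 1) * y i.val) - z| ≤
      r + (1 + r) * (Y ^ 2 / threshold a b μ₀ n l y) := by
  obtain ⟨s1, s2, s3, s4⟩ := stopTime_spec hg hι
  obtain ⟨q1, q2, q3⟩ := kernelWeight_stop hg hι
  have hH := hg.1
  set H := threshold a b μ₀ n l y with hHdef
  set τ := stopTime a b μ₀ n l y with hτ
  set A := energy a b n l y (iotaIdx a b μ₀ n l) with hA
  have hkn := kTwo_le a b n l
  set I := Finset.Icc (iotaIdx a b μ₀ n l + 1) (kTwo a b n l) with hI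
  set g : ℕ → ℝ := fun k => transformWeight a b μ₀ n l y k * y (k - 1) with hgdef
  have hcase : ∀ k ∈ I, (k < τ ∨ k = τ) ∨ g k = 0 := by
    intro k _
    rcases lt_trichotomy k τ with h | h | h
    · exact Or.inl (Or.inl h)
    · exact Or.inl (Or.inr h)
    · right
      simp only [hgdef]
      rw [transformWeight_after_stop hg hι h, zero_mul]
  have hkQ : ∀ k ∈ I, g k ≠ 0 → kernelWeight a b n l k ≠ 0 := by
    intro k hk hne
    rcases hcase k hk with (h | h) | h
    · intro h0
      apply hne
      simp only [hgdef]
      rw [transformWeight_before_stop hg hι (Finset.mem_Icc.mp hk).1 h, h0]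
      ring
    · rw [h, q1]
      exact one_ne_zero
    · exact absurd h hne
  have hg0 : ∀ k, 0 ≤ g k := by
    intro k
    simp only [hgdef, transformWeight]
    split_ifs with h
    · rw [one_mul]
      positivity
    · have := Real.sqrt_nonneg (cappedEnergy a b μ₀ n l y k - cappedEnergy a b μ₀ n l y (k - 1))
      nlinarith [not_le.mp h]
  have hτ1 : 0 ≤ corrCoef a b μ₀ n l y ∧ corrCoef a b μ₀ n l y ≤ 1 ∧
      corrCoef a b μ₀ n l y ^ 2 * y (τ - 1) ^ 2 = H - A (τ - 1) := by
    have hd : (H - A (τ - 1)) / y (τ - 1) ^ 2 ≤ 1 := (div_le_one q2).mpr q3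
    have hd0 : 0 ≤ (H - A (τ - 1)) / y (τ - 1) ^ 2 :=
      div_nonneg (sub_nonneg.mpr (s4 _ (by omega)).le) q2.le
    have e : corrCoef a b μ₀ n l y = Real.sqrt ((H - A (τ - 1)) / y (τ - 1) ^ 2) := by
      rw [corrCoef, q1, one_mul]
    refine ⟨Real.sqrt_nonneg _, ?_, ?_⟩
    · rw [e]
      exact Real.sqrt_le_one.mpr hd
    · rw [e, Real.sq_sqrt hd0, div_mul_cancel₀ _ q2.ne']
  have hsum : ∑ k ∈ I, g k = A (τ - 1) + corrCoef a b μ₀ n l y * y (τ - 1) ^ 2 := by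
    rw [sum_transformWeight_mul hg hι fun k => y (k - 1)]
    simp only [hA, energy]
    congr 1
    · exact Finset.sum_congr rfl fun k _ => by ring
    · ring
  have hyY : y (τ - 1) ^ 2 ≤ Y ^ 2 := by
    have h := hY (τ - 1) (by omega)
    rw [← sq_abs (y (τ - 1))]
    exact pow_le_pow_left₀ (abs_nonneg _) h 2
  -- The estimator carries `ϰ` where the energy identity carries `ϰ²`, so the total weight exceeds
  -- `H` by `(ϰ - ϰ²) y_{τ-1}²`. This lies between `0` and `Y²` because `0 ≤ ϰ ≤ 1`.
  have hsum1 : H ≤ ∑ k ∈ I, g k := by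
    rw [hsum]
    nlinarith [hτ1.1, hτ1.2.1, hτ1.2.2, mul_nonneg hτ1.1 (sub_nonneg.mpr hτ1.2.1)]
  have hsum2 : ∑ k ∈ I, g k ≤ H + Y ^ 2 := by
    rw [hsum]
    have := (s4 (τ - 1) (by omega)).le
    nlinarith [hτ1.2.1]
  have e1 : ∑ i : Fin n, noiseWeight a b μ₀ n l y i.val * (f (i.val + 1) * y i.val) =
      (∑ k ∈ I, g k * f k) / H := by
    have := sum_noiseWeight_mul (a := a) (b := b) (μ₀ := μ₀) (n := n) (l := l) (y := y)
      fun k => f k * y (k - 1)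
    simp only [Nat.add_sub_cancel] at this
    rw [this]
    congr 1
    exact Finset.sum_congr rfl fun k _ => by simp only [hgdef]; ring
  have e2 : (∑ k ∈ I, g k * f k) / H - z =
      (∑ k ∈ I, g k * (f k - z) + z * (∑ k ∈ I, g k - H)) / H := by
    have : ∑ k ∈ I, g k * (f k - z) = ∑ k ∈ I, g k * f k - z * ∑ k ∈ I, g k := by
      rw [Finset.mul_sum, ← Finset.sum_sub_distrib]
      exact Finset.sum_congr rfl fun k _ => by ring
    rw [this]
    field_simp
    ring
  have b1 : |∑ k ∈ I, g k * (f k - z)| ≤ r * (H + Y ^ 2) := by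
    calc |∑ k ∈ I, g k * (f k - z)| ≤ ∑ k ∈ I, |g k * (f k - z)| := Finset.abs_sum_le_sum_abs _ _
      _ ≤ ∑ k ∈ I, g k * r := by
          refine Finset.sum_le_sum fun k hk => ?_
          rw [abs_mul, abs_of_nonneg (hg0 k)]
          by_cases h : g k = 0
          · simp [h]
          · refine mul_le_mul_of_nonneg_left (hf k ?_ (hkQ k hk h)) (hg0 k)
            rw [Finset.mem_Icc] at hk ⊢
            omega
      _ = r * ∑ k ∈ I, g k := by rw [← Finset.sum_mul, mul_comm]
      _ ≤ _ := mul_le_mul_of_nonneg_left hsum2 hr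
  have b2 : |z * (∑ k ∈ I, g k - H)| ≤ Y ^ 2 := by
    rw [abs_mul, abs_of_nonneg (sub_nonneg.mpr hsum1)]
    calc |z| * (∑ k ∈ I, g k - H) ≤ 1 * Y ^ 2 :=
          mul_le_mul hz (by linarith) (sub_nonneg.mpr hsum1) zero_le_one
      _ = _ := one_mul _
  rw [e1, e2, abs_div, abs_of_pos hH, div_le_iff₀ hH]
  refine (abs_add_le _ _).trans ((add_le_add b1 b2).trans (le_of_eq ?_))
  field_simp
  ring

end Sequential

end SeqAR

namespace SeqAR

/-! Sizes of the windows and of the thresholds. -/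

section Windows

variable {a b μ₀ : ℝ} {n : ℕ}

theorem gridSize_pos (hn : 1 ≤ n) : (0 : ℝ) < gridSize n := by
  exact_mod_cast Nat.sqrt_pos.mpr hn

theorem sq_gridSize_le (n : ℕ) : (gridSize n : ℝ) ^ 2 ≤ n := by
  exact_mod_cast Nat.sqrt_le' n

theorem le_four_mul_sq_gridSize (hn : 1 ≤ n) : (n : ℝ) ≤ 4 * (gridSize n : ℝ) ^ 2 := by
  have h1 : n < (gridSize n + 1) ^ 2 := Nat.lt_succ_sqrt' n
  have h2 : 1 ≤ gridSize n := Nat.sqrt_pos.mpr hn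
  have h3 : n ≤ 4 * gridSize n ^ 2 := by nlinarith
  exact_mod_cast h3

theorem gridPoint_ratio (hab : a < b) (l : ℕ) :
    (gridPoint a b n l - a) / (b - a) = (l : ℝ) / gridSize n := by
  have : b - a ≠ 0 := (sub_pos.mpr hab).ne'
  rw [gridPoint]
  field_simp
  ring

theorem bandwidth_ratio (hab : a < b) :
    bandwidth a b n / (b - a) = 1 / (2 * gridSize n) := by
  rw [bandwidth, div_right_comm, div_self (sub_pos.mpr hab).ne']

theorem window_ratio (l : ℕ) :
    (n : ℝ) * ((l : ℝ) / gridSize n) + n * (1 / (2 * gridSize n)) =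
      (n / (2 * gridSize n)) * (2 * l + 1) ∧
    (n : ℝ) * ((l : ℝ) / gridSize n) - n * (1 / (2 * gridSize n)) =
      (n / (2 * gridSize n)) * (2 * l - 1) := by
  constructor <;>
  · rw [mul_one_div, mul_div_assoc', mul_comm (2 : ℝ) (gridSize n : ℝ), ← div_div]
    ring

/-- With `X = n / (2d)`, window `l` ends no later than `X (2l + 1)`, and window `l'` starts after
the integer part of `X (2l' - 1)`, which is at least as large. This is the source of the
disjointness of the noise weights. -/
theorem kTwo_le_iotaIdx (hab : a < b) {l l' : ℕ} (h : l < l') :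
    kTwo a b n l ≤ iotaIdx a b μ₀ n l' := by
  refine (min_le_left _ _).trans (le_trans ?_ (Nat.le_add_right _ _))
  rw [kOne, gridPoint_ratio hab, gridPoint_ratio hab, bandwidth_ratio hab, (window_ratio l).1,
    (window_ratio l').2]
  refine (Nat.floor_le_floor (mul_le_mul_of_nonneg_left ?_ (by positivity))).trans
    (Nat.le_succ _)
  have : (l : ℝ) + 1 ≤ l' := by exact_mod_cast h
  linarith

theorem window_le (hab : a < b) (hn : 1 ≤ n) (l : ℕ) :
    (kTwo a b n l : ℝ) - iotaIdx a b μ₀ n l - 1 ≤ 4 * gridSize n := by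
  have hd := gridSize_pos hn
  have hX : (0 : ℝ) ≤ n / (2 * gridSize n) := by positivity
  have hX2 : (n : ℝ) / (2 * gridSize n) ≤ 2 * gridSize n := by
    rw [div_le_iff₀ (by positivity)]
    have := le_four_mul_sq_gridSize hn
    linarith
  have h1 : (kTwo a b n l : ℝ) ≤ (n / (2 * gridSize n)) * (2 * l + 1) := by
    rw [kTwo, gridPoint_ratio hab, bandwidth_ratio hab, (window_ratio l).1]
    refine le_trans ?_ (Nat.floor_le (by positivity))
    exact_mod_cast min_le_left _ _
  have h2 : (n / (2 * gridSize n)) * (2 * (l : ℝ) - 1) ≤ (iotaIdx a b μ₀ n l : ℝ) := by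
    rw [iotaIdx, kOne, gridPoint_ratio hab, bandwidth_ratio hab, (window_ratio l).2]
    push_cast
    refine (Nat.lt_floor_add_one _).le.trans ?_
    linarith [Nat.cast_nonneg (α := ℝ)
      ⌊((n : ℝ) * (1 / (2 * (gridSize n : ℝ)))) ^ μ₀⌋₊]
  linarith

/-- The bound `k_{2,l} ≥ 2 l X - 1` also covers the last window, half of which is cut off at `n`.
Thus only half of the full length `2X` is guaranteed, less the preliminary sample and rounding. -/
theorem window_ge (hab : a < b) (hn : 1 ≤ n) {l : ℕ} (hl : 1 ≤ l) (hl' : l ≤ gridSize n) :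
    (n : ℝ) / (2 * gridSize n) - 3 - (n / (2 * gridSize n) : ℝ) ^ μ₀ ≤
      (kTwo a b n l : ℝ) - iotaIdx a b μ₀ n l - 1 := by
  have hd := gridSize_pos hn
  have hl1 : (1 : ℝ) ≤ l := by exact_mod_cast hl
  have hl2 : (l : ℝ) ≤ gridSize n := by exact_mod_cast hl'
  set X : ℝ := n / (2 * gridSize n) with hX
  have hX0 : 0 ≤ X := by positivity
  have hn' : (n : ℝ) = X * (2 * gridSize n) := by rw [hX]; field_simp
  have h1 : X * (2 * l) - 1 ≤ (kTwo a b n l : ℝ) := by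
    rw [kTwo, gridPoint_ratio hab, bandwidth_ratio hab, (window_ratio l).1, Nat.cast_min]
    refine le_min ?_ ?_
    · have := Nat.lt_floor_add_one (X * (2 * (l : ℝ) + 1))
      linarith
    · have := mul_le_mul_of_nonneg_left hl2 hX0
      linarith
  have h2 : (iotaIdx a b μ₀ n l : ℝ) ≤ X * (2 * l - 1) + 1 + X ^ μ₀ := by
    rw [iotaIdx, kOne, gridPoint_ratio hab, bandwidth_ratio hab, (window_ratio l).2, mul_one_div]
    push_cast
    have e1 := Nat.floor_le (a := X * (2 * (l : ℝ) - 1)) (mul_nonneg hX0 (by linarith))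
    have e2 := Nat.floor_le (a := X ^ μ₀) (Real.rpow_nonneg hX0 _)
    linarith
  linarith

theorem exists_window_lower_bound (hab : a < b) (hμ₁ : μ₀ < 1) :
    ∃ c : ℝ, 0 < c ∧ ∀ n : ℕ, 1 ≤ n → ∀ l : ℕ, 1 ≤ l → l ≤ gridSize n →
      0 < (kTwo a b n l : ℝ) - iotaIdx a b μ₀ n l - 1 →
      c * gridSize n ≤ (kTwo a b n l : ℝ) - iotaIdx a b μ₀ n l - 1 := by
  have h1 := (tendsto_rpow_neg_atTop (sub_pos.mpr hμ₁)).eventually_le_const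
    (show (0 : ℝ) < 1 / 4 by norm_num)
  -- For `X ≥ X₀` both `X^μ₀` and the rounding loss `3` are at most `X / 4`, leaving `X / 2 ≥ d /
  -- 4`.
  obtain ⟨X₀, hX₀⟩ := (h1.and (eventually_ge_atTop (12 : ℝ))).exists_forall_of_atTop
  have hX12 := (hX₀ X₀ le_rfl).2
  refine ⟨min (1 / 4) (1 / (2 * X₀)), by positivity, fun n hn l hl hl' hN => ?_⟩
  have hd := gridSize_pos hn
  set X : ℝ := n / (2 * gridSize n) with hX
  have hdX : (gridSize n : ℝ) ≤ 2 * X := by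
    rw [hX, mul_div_assoc', le_div_iff₀ (by positivity)]
    have := sq_gridSize_le n
    nlinarith
  rcases le_or_gt X₀ X with h | h
  · obtain ⟨h2, h3⟩ := hX₀ X h
    have hw := window_ge (μ₀ := μ₀) hab hn hl hl'
    rw [← hX] at hw
    have e : X ^ μ₀ = X * X ^ (-(1 - μ₀)) := by
      nth_rw 2 [← Real.rpow_one X]
      rw [← Real.rpow_add (by linarith)]
      congr 1
      ring
    have h4 : X ^ μ₀ ≤ X * (1 / 4) := by
      rw [e]
      exact mul_le_mul_of_nonneg_left h2 (by linarith)
    have h5 := mul_le_mul_of_nonneg_right (min_le_left (1 / 4) (1 / (2 * X₀))) hd.le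
    linarith
  -- For small `X` integrality alone suffices: a positive length is at least `1`, and `d ≤ 2X <
  -- 2X₀`.
  · have h2 : (1 : ℝ) ≤ (kTwo a b n l : ℝ) - iotaIdx a b μ₀ n l - 1 := by
      have h3 : iotaIdx a b μ₀ n l + 1 < kTwo a b n l := by
        have : ((iotaIdx a b μ₀ n l + 1 : ℕ) : ℝ) < (kTwo a b n l : ℝ) := by
          push_cast
          linarith
        exact_mod_cast this
      have h4 : ((iotaIdx a b μ₀ n l + 2 : ℕ) : ℝ) ≤ (kTwo a b n l : ℝ) := by exact_mod_cast h3
      push_cast at h4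
      linarith
    refine le_trans ?_ h2
    refine (mul_le_mul_of_nonneg_right (min_le_right _ _) hd.le).trans ?_
    rw [one_div_mul_eq_div, div_le_one (by positivity)]
    linarith

theorem epsTilde_bounds (n : ℕ) : 0 < epsTilde n ∧ epsTilde n ≤ 1 / 2 := by
  have h : 0 ≤ Real.log n := Real.log_natCast_nonneg n
  unfold epsTilde
  refine ⟨by positivity, ?_⟩
  exact one_div_le_one_div_of_le (by norm_num) (by linarith)

/-- The projection of the preliminary estimate keeps `1 - p²` between `ε̃` and `1`, however bad that
estimate is. Its accuracy is never used; the price is a logarithmic factor. -/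
theorem threshold_coef_bounds (n l : ℕ) (y : ℕ → ℝ) :
    1 / 2 ≤ (1 - epsTilde n) / (1 - prelimProj a b μ₀ n l y ^ 2) ∧
      (1 - epsTilde n) / (1 - prelimProj a b μ₀ n l y ^ 2) ≤ 2 + Real.log n := by
  obtain ⟨h0, h1⟩ := epsTilde_bounds n
  have hlog : (epsTilde n) * (2 + Real.log n) = 1 := by
    have h : 0 ≤ Real.log n := Real.log_natCast_nonneg n
    unfold epsTilde
    field_simp
  have hlog0 : 0 ≤ 2 + Real.log n := by linarith [Real.log_natCast_nonneg n]
  have p1 : prelimProj a b μ₀ n l y ≤ 1 - epsTilde n := min_le_right _ _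
  have p2 : -1 + epsTilde n ≤ prelimProj a b μ₀ n l y :=
    le_min (le_max_right _ _) (by linarith)
  set p := prelimProj a b μ₀ n l y
  have hp : epsTilde n ≤ 1 - p ^ 2 := by nlinarith
  have hp0 : 0 < 1 - p ^ 2 := h0.trans_le hp
  constructor
  · rw [div_le_div_iff₀ two_pos hp0]
    nlinarith [sq_nonneg p]
  · rw [div_le_iff₀ hp0]
    nlinarith

theorem threshold_bounds {l : ℕ} (y : ℕ → ℝ)
    (hN : 0 < (kTwo a b n l : ℝ) - iotaIdx a b μ₀ n l - 1) :
    ((kTwo a b n l : ℝ) - iotaIdx a b μ₀ n l - 1) / 2 ≤ threshold a b μ₀ n l y ∧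
    threshold a b μ₀ n l y ≤
      (2 + Real.log n) * ((kTwo a b n l : ℝ) - iotaIdx a b μ₀ n l - 1) := by
  obtain ⟨h1, h2⟩ := threshold_coef_bounds (a := a) (b := b) (μ₀ := μ₀) n l y
  have e1 := mul_le_mul_of_nonneg_right h1 hN.le
  have e2 := mul_le_mul_of_nonneg_right h2 hN.le
  unfold threshold
  exact ⟨by linarith, e2⟩

theorem window_pos_of_threshold_pos {l : ℕ} {y : ℕ → ℝ}
    (h : 0 < threshold a b μ₀ n l y) :
    0 < (kTwo a b n l : ℝ) - iotaIdx a b μ₀ n l - 1 := by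
  have h1 := (threshold_coef_bounds (a := a) (b := b) (μ₀ := μ₀) n l y).1
  exact pos_of_mul_pos_right h (by linarith)

theorem iotaIdx_lt_of_window_pos {l : ℕ} (h : 0 < (kTwo a b n l : ℝ) - iotaIdx a b μ₀ n l - 1) :
    iotaIdx a b μ₀ n l + 1 < kTwo a b n l := by
  have : ((iotaIdx a b μ₀ n l + 1 : ℕ) : ℝ) < (kTwo a b n l : ℝ) := by
    push_cast
    linarith
  exact_mod_cast this

end Windows

/-! Locality and measurability of the procedure. -/

section Locality

variable {a b μ₀ : ℝ} {n l : ℕ} {y y' : ℕ → ℝ}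

theorem energy_congr {k m : ℕ} (h : ∀ j < m, y j = y' j) :
    energy a b n l y k m = energy a b n l y' k m := by
  refine Finset.sum_congr rfl fun j hj => ?_
  rw [Finset.mem_Icc] at hj
  rw [h (j - 1) (by omega)]

theorem threshold_congr (h : ∀ j ≤ iotaIdx a b μ₀ n l, y j = y' j) :
    threshold a b μ₀ n l y = threshold a b μ₀ n l y' := by
  have h1 : prelimEst a b μ₀ n l y = prelimEst a b μ₀ n l y' := by
    unfold prelimEst
    rw [energy_congr fun j hj => h j hj.le]
    congr 1
    refine Finset.sum_congr rfl fun j hj => ?_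
    rw [Finset.mem_Icc] at hj
    rw [h j hj.2, h (j - 1) (by omega)]
  unfold threshold prelimProj
  rw [h1]

/-- Predictability: index `i` refers to time `i + 1`, whose clock value involves `y` only up to time
`i`. The threshold is known by then, because a nonzero weight requires `ι_l ≤ i`. -/
theorem noiseWeight_congr {i : ℕ} (h : ∀ j ≤ i, y j = y' j) :
    noiseWeight a b μ₀ n l y i = noiseWeight a b μ₀ n l y' i := by
  unfold noiseWeight
  split_ifs with hi
  · have h1 : threshold a b μ₀ n l y = threshold a b μ₀ n l y' :=
      threshold_congr fun j hj => h j (by omega)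
    have h2 : ∀ k ≤ i + 1, cappedEnergy a b μ₀ n l y k = cappedEnergy a b μ₀ n l y' k := by
      intro k hk
      unfold cappedEnergy
      rw [h1, energy_congr fun j hj => h j (by omega)]
    unfold transformWeight
    rw [h1, h2 _ le_rfl, h2 _ (Nat.sub_le _ _), Nat.add_sub_cancel, h i le_rfl]
  · rfl

theorem noiseWeight_disjoint (hab : a < b) {l l' : ℕ} (hl : l ≠ l') (y : ℕ → ℝ) (i : ℕ) :
    noiseWeight a b μ₀ n l y i * noiseWeight a b μ₀ n l' y i = 0 := by
  unfold noiseWeight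
  split_ifs with h1 h2
  · exfalso
    rcases lt_or_gt_of_ne hl with h | h
    · have := kTwo_le_iotaIdx (n := n) (μ₀ := μ₀) hab h
      omega
    · have := kTwo_le_iotaIdx (n := n) (μ₀ := μ₀) hab h
      omega
  all_goals simp

theorem measurable_energy (k m : ℕ) : Measurable fun y : ℕ → ℝ => energy a b n l y k m := by
  unfold energy
  fun_prop

theorem measurable_threshold : Measurable fun y : ℕ → ℝ => threshold a b μ₀ n l y := by
  have h1 : Measurable fun y : ℕ → ℝ => prelimEst a b μ₀ n l y := by
    unfold prelimEst
    exact Measurable.div (by fun_prop) (measurable_energy _ _)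
  unfold threshold prelimProj
  fun_prop

theorem measurable_noiseWeight (i : ℕ) :
    Measurable fun y : ℕ → ℝ => noiseWeight a b μ₀ n l y i := by
  have h1 : ∀ k, Measurable fun y : ℕ → ℝ => cappedEnergy a b μ₀ n l y k := by
    intro k
    unfold cappedEnergy
    split_ifs
    · exact (measurable_energy _ _).min measurable_threshold
    · exact measurable_threshold
  unfold noiseWeight
  split_ifs
  · unfold transformWeight
    refine Measurable.div (Measurable.mul (Measurable.ite ?_ measurable_const measurable_const)
      ((h1 _).sub (h1 _)).sqrt) measurable_threshold
    exact measurableSet_le measurable_const (measurable_pi_apply _)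
  · exact measurable_const

end Locality

end SeqAR

namespace SeqAR

/-! The noise law. -/

section Noise

variable {s : ℝ} {p : ℝ → ℝ}

theorem integral_noiseLaw (hp : p ∈ densityClass s) (g : ℝ → ℝ) :
    ∫ x, g x ∂(noiseLaw p) = ∫ x, g x * p x := by
  rw [noiseLaw, integral_withDensity_eq_integral_toReal_smul
    hp.1.ennreal_ofReal (ae_of_all _ fun _ => ENNReal.ofReal_lt_top)]
  refine integral_congr_ae (ae_of_all _ fun x => ?_)
  simp only [ENNReal.toReal_ofReal (hp.2.1 x), smul_eq_mul, mul_comm]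

theorem integrable_noiseLaw_iff (hp : p ∈ densityClass s) {g : ℝ → ℝ} :
    Integrable g (noiseLaw p) ↔ Integrable fun x => g x * p x := by
  rw [noiseLaw, integrable_withDensity_iff_integrable_smul'
    hp.1.ennreal_ofReal (ae_of_all _ fun _ => ENNReal.ofReal_lt_top)]
  refine integrable_congr (ae_of_all _ fun x => ?_)
  simp only [ENNReal.toReal_ofReal (hp.2.1 x), smul_eq_mul, mul_comm]

theorem isNoise_noiseLaw (hp : p ∈ densityClass s) : IsNoise (noiseLaw p) := by
  have hprob : IsProbabilityMeasure (noiseLaw p) := by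
    refine ⟨?_⟩
    have hint : Integrable p := by
      by_contra h
      have := integral_undef h
      rw [hp.2.2.1] at this
      exact one_ne_zero this
    rw [noiseLaw, withDensity_apply _ MeasurableSet.univ, Measure.restrict_univ,
      ← ofReal_integral_eq_lintegral_ofReal hint (ae_of_all _ hp.2.1), hp.2.2.1, ENNReal.ofReal_one]
  refine ⟨hprob, fun q => ?_, ?_, ?_⟩
  · have h1 : MemLp (id : ℝ → ℝ) ((2 * (q + 1) : ℕ) : ℝ≥0∞) (noiseLaw p) := by
      rw [← integrable_norm_rpow_iff measurable_id.aestronglyMeasurable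
        (by norm_cast) (ENNReal.natCast_ne_top _)]
      have := (integrable_noiseLaw_iff hp).mpr (hp.2.2.2.2.2 (q + 1) (by omega)).1
      simpa only [ENNReal.toReal_natCast, Real.rpow_natCast, id, Real.norm_eq_abs] using this
    exact h1.mono_exponent (by norm_cast; omega)
  · rw [integral_noiseLaw hp]
    exact hp.2.2.2.1
  · rw [integral_noiseLaw hp]
    exact hp.2.2.2.2.1

theorem integral_even_moment_le (hp : p ∈ densityClass s) {k : ℕ} (hk : 1 ≤ k) :
    ∫ x, x ^ (2 * k) ∂(noiseLaw p) ≤ s ^ k * (Nat.doubleFactorial (2 * k - 1) : ℝ) := by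
  rw [integral_noiseLaw hp]
  have := (hp.2.2.2.2.2 k hk).2
  simpa only [pow_mul, sq_abs] using this

theorem doubleFactorial_two_mul_sub_one_le (k : ℕ) :
    Nat.doubleFactorial (2 * k - 1) ≤ (2 * k) ^ k := by
  have key : ∀ m k, m ≤ k → Nat.doubleFactorial (2 * m - 1) ≤ (2 * k) ^ m := by
    intro m
    induction m with
    | zero => intro k _; simp [Nat.doubleFactorial]
    | succ m ih =>
      intro k hk
      have h := ih k (by omega)
      rcases m with _ | m
      · simp [Nat.doubleFactorial]
        omega
      · have e : 2 * (m + 1 + 1) - 1 = (2 * (m + 1) - 1) + 2 := by omega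
        rw [e, Nat.doubleFactorial_add_two, pow_succ, mul_comm]
        exact Nat.mul_le_mul h (by omega)
  exact key k k le_rfl

theorem integral_pow_four_le (hp : p ∈ densityClass s) :
    ∫ x, x ^ 4 ∂(noiseLaw p) ≤ 3 * s ^ 2 := by
  have := integral_even_moment_le hp (k := 2) (by norm_num)
  norm_num [Nat.doubleFactorial] at this
  linarith

theorem integral_pow_four_mul_le (hs : 0 ≤ s) (hp : p ∈ densityClass s) {m : ℕ} (hm : 1 ≤ m) :
    ∫ x, x ^ (4 * m) ∂(noiseLaw p) ≤ (16 * m ^ 2 * s ^ 2) ^ m := by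
  have h := integral_even_moment_le hp (k := 2 * m) (by omega)
  have e : 2 * (2 * m) = 4 * m := by ring
  rw [e] at h
  refine h.trans ?_
  have h2 : ((Nat.doubleFactorial (4 * m - 1) : ℕ) : ℝ) ≤ (4 * m) ^ (2 * m) := by
    have := doubleFactorial_two_mul_sub_one_le (2 * m)
    rw [e] at this
    exact_mod_cast this
  refine (mul_le_mul_of_nonneg_left h2 (by positivity)).trans (le_of_eq ?_)
  rw [pow_mul, pow_mul, ← mul_pow]
  congr 1
  ring

end Noise

/-! The path of the autoregression. -/

section Path

variable {a b y₀ : ℝ} {n : ℕ} {S : ℝ → ℝ}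

/-- The whole sequence `y_0, …, y_n` as a function of the noise. -/
noncomputable def pathSeq (a b y₀ : ℝ) {n : ℕ} (S : ℝ → ℝ) (ξ : Fin n → ℝ) : ℕ → ℝ :=
  obsSeq y₀ fun k : Fin n => arPath a b y₀ S ξ ((k : ℕ) + 1)

theorem pathSeq_eq (ξ : Fin n → ℝ) {k : ℕ} (hk : k ≤ n) :
    pathSeq a b y₀ S ξ k = arPath a b y₀ S ξ k := by
  cases k with
  | zero => rfl
  | succ k => simp [pathSeq, obsSeq, Nat.lt_of_succ_le hk]

theorem pathSeq_succ (ξ : Fin n → ℝ) (i : Fin n) :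
    pathSeq a b y₀ S ξ (i.val + 1) =
      S (designPoint a b n (i.val + 1)) * pathSeq a b y₀ S ξ i.val + ξ i := by
  rw [pathSeq_eq ξ i.isLt, pathSeq_eq ξ i.isLt.le]
  simp [arPath]

theorem arPath_congr {ξ ξ' : Fin n → ℝ} {k : ℕ} (h : ∀ i : Fin n, i.val < k → ξ i = ξ' i) :
    arPath a b y₀ S ξ k = arPath a b y₀ S ξ' k := by
  induction k with
  | zero => rfl
  | succ k ih =>
    simp only [arPath]
    rw [ih fun i hi => h i (by omega)]
    by_cases hk : k < n
    · simp only [hk, dite_true]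
      rw [h ⟨k, hk⟩ (Nat.lt_succ_self k)]
    · simp only [hk, dite_false]

theorem pathSeq_congr {ξ ξ' : Fin n → ℝ} {k : ℕ} (h : ∀ i : Fin n, i.val < k → ξ i = ξ' i) :
    pathSeq a b y₀ S ξ k = pathSeq a b y₀ S ξ' k := by
  cases k with
  | zero => rfl
  | succ k =>
    simp only [pathSeq, obsSeq]
    split_ifs
    · exact arPath_congr h
    · rfl

theorem measurable_pathSeq : Measurable fun ξ : Fin n → ℝ => pathSeq a b y₀ S ξ := by
  refine measurable_pi_lambda _ fun k => ?_
  cases k with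
  | zero => exact measurable_const
  | succ k =>
    simp only [pathSeq, obsSeq]
    split_ifs
    · exact measurable_arPath a b y₀ S _
    · exact measurable_const

theorem designPoint_mem (hab : a < b) {k : ℕ} (hk : k ≤ n) :
    designPoint a b n k ∈ Icc a b := by
  have h := sub_pos.mpr hab
  have h1 : 0 ≤ (k : ℝ) * (b - a) / n := by positivity
  have h2 : (k : ℝ) * (b - a) / n ≤ b - a := by
    rcases Nat.eq_zero_or_pos n with h0 | h0
    · subst h0
      simp [h.le]
    · rw [div_le_iff₀ (by exact_mod_cast h0), mul_comm]
      have : (k : ℝ) ≤ n := by exact_mod_cast hk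
      exact mul_le_mul_of_nonneg_left this h.le
  unfold designPoint
  constructor <;> linarith

theorem abs_arPath_le (hab : a < b) {ε X : ℝ} (hε : 0 < ε) (hε₁ : ε < 1)
    (hS : ∀ x ∈ Icc a b, |S x| ≤ 1 - ε) {ξ : Fin n → ℝ} (hX0 : 0 ≤ X) (hX : ∀ i, |ξ i| ≤ X)
    {k : ℕ} (hk : k ≤ n) : |arPath a b y₀ S ξ k| ≤ |y₀| + X / ε := by
  induction k with
  | zero =>
    simp only [arPath]
    have : 0 ≤ X / ε := by positivity
    linarith
  | succ k ih =>
    have hkn : k < n := hk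
    simp only [arPath, hkn, dite_true]
    refine (abs_add_le _ _).trans ?_
    rw [abs_mul]
    have h1 := mul_le_mul (hS _ (designPoint_mem hab hk)) (ih hkn.le) (abs_nonneg _)
      (by linarith : (0 : ℝ) ≤ 1 - ε)
    have h2 := hX ⟨k, hkn⟩
    have h3 : (1 - ε) * (|y₀| + X / ε) = |y₀| + X / ε - ε * |y₀| - X := by
      field_simp
      ring
    have h4 : 0 ≤ ε * |y₀| := by positivity
    linarith

/-- Truncation at level `t`: above it, `(x⁴ / t)^(m - 1) ≥ 1`. Summing the second term over the
noise variables bounds the maximum of their fourth powers. -/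
theorem pow_four_le_of_threshold {x t : ℝ} (ht : 0 < t) {m : ℕ} (hm : 1 ≤ m) :
    x ^ 4 ≤ t + x ^ (4 * m) / t ^ (m - 1) := by
  have h0 : 0 ≤ x ^ 4 := by positivity
  rcases le_or_gt (x ^ 4) t with h | h
  · have : 0 ≤ x ^ (4 * m) / t ^ (m - 1) := by
      rw [pow_mul]
      positivity
    linarith
  · have h1 : x ^ 4 ≤ x ^ (4 * m) / t ^ (m - 1) := by
      rw [le_div_iff₀ (by positivity), pow_mul]
      obtain ⟨k, rfl⟩ : ∃ k, m = k + 1 := ⟨m - 1, by omega⟩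
      rw [Nat.add_sub_cancel, pow_succ (x ^ 4) k, mul_comm]
      exact mul_le_mul_of_nonneg_right (pow_le_pow_left₀ ht.le h.le k) h0
    linarith

/-- A bound for the fourth power of the noise maximum. -/
noncomputable def noiseMax (m : ℕ) (t : ℝ) {n : ℕ} (ξ : Fin n → ℝ) : ℝ :=
  t + ∑ i, ξ i ^ (4 * m) / t ^ (m - 1)

theorem noiseMax_nonneg {m : ℕ} {t : ℝ} (ht : 0 < t) (ξ : Fin n → ℝ) : 0 ≤ noiseMax m t ξ := by
  unfold noiseMax
  have : 0 ≤ ∑ i, ξ i ^ (4 * m) / t ^ (m - 1) := Finset.sum_nonneg fun i _ => by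
    rw [pow_mul]
    positivity
  linarith

theorem exists_path_bound (hab : a < b) {ε t : ℝ} (hε : 0 < ε) (hε₁ : ε < 1)
    (hS : ∀ x ∈ Icc a b, |S x| ≤ 1 - ε) (hn : 1 ≤ n) (ht : 0 < t) {m : ℕ} (hm : 1 ≤ m)
    (ξ : Fin n → ℝ) :
    ∃ Y : ℝ, (∀ k ≤ n, |pathSeq a b y₀ S ξ k| ≤ Y) ∧
      Y ^ 4 ≤ 8 * (y₀ ^ 4 + noiseMax m t ξ / ε ^ 4) := by
  obtain ⟨i, -, hi⟩ := Finset.exists_max_image (Finset.univ : Finset (Fin n)) (fun i => |ξ i|)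
    ⟨⟨0, hn⟩, Finset.mem_univ _⟩
  refine ⟨|y₀| + |ξ i| / ε, fun k hk => ?_, ?_⟩
  · rw [pathSeq_eq ξ hk]
    exact abs_arPath_le hab hε hε₁ hS (abs_nonneg _) (fun j => hi j (Finset.mem_univ j)) hk
  · have h1 : |ξ i| ^ 4 ≤ noiseMax m t ξ := by
      rw [show |ξ i| ^ 4 = ξ i ^ 4 from Even.pow_abs (by decide) _]
      refine (pow_four_le_of_threshold ht hm).trans ?_
      unfold noiseMax
      gcongr
      refine Finset.single_le_sum (f := fun i => ξ i ^ (4 * m) / t ^ (m - 1)) (fun j _ => ?_)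
        (Finset.mem_univ i)
      rw [pow_mul]
      positivity
    have h2 : (|y₀| + |ξ i| / ε) ^ 4 ≤ 2 ^ 3 * (|y₀| ^ 4 + (|ξ i| / ε) ^ 4) :=
      add_pow_le (abs_nonneg _) (by positivity) 4
    have h3 : |y₀| ^ 4 = y₀ ^ 4 := Even.pow_abs (by decide) _
    rw [h3, div_pow] at h2
    have h4 : |ξ i| ^ 4 / ε ^ 4 ≤ noiseMax m t ξ / ε ^ 4 := by gcongr
    linarith

theorem allMoments_noiseMax {μ : Measure ℝ} (hμ : IsNoise μ) (m : ℕ) (t : ℝ) :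
    AllMoments (Measure.pi fun _ : Fin n => μ) (noiseMax m t) := by
  have := hμ.prob
  refine (AllMoments.const t).add (AllMoments.sum _ fun i _ => ?_)
  exact ((Adapted.eval hμ.mom i (Nat.lt_succ_self _)).pow (4 * m)).mom.mul
    (AllMoments.const (t ^ (m - 1))⁻¹)

/-- With a logarithmic exponent the noise maximum is of the order of a squared logarithm. -/
theorem integral_noiseMax_le {s : ℝ} {p : ℝ → ℝ} (hs : 1 ≤ s) (hp : p ∈ densityClass s)
    {m : ℕ} (hm : 1 ≤ m) (hmn : (n : ℝ) ≤ 3 ^ (m - 1)) :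
    ∫ ξ, noiseMax m (3 * (16 * m ^ 2 * s ^ 2)) ξ ∂(Measure.pi fun _ : Fin n => noiseLaw p) ≤
      64 * m ^ 2 * s ^ 2 := by
  have hμ := isNoise_noiseLaw hp
  have := hμ.prob
  have hm0 : (0 : ℝ) < m := by exact_mod_cast hm
  set T : ℝ := 16 * m ^ 2 * s ^ 2 with hT
  have hT0 : 0 < T := by positivity
  have hi : ∀ i : Fin n, Integrable (fun ξ : Fin n → ℝ => ξ i ^ (4 * m) / (3 * T) ^ (m - 1))
      (Measure.pi fun _ : Fin n => noiseLaw p) := fun i =>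
    (((Adapted.eval hμ.mom i (Nat.lt_succ_self _)).pow (4 * m)).mom.integrable).div_const _
  have h1 : ∀ i : Fin n, ∫ ξ, ξ i ^ (4 * m) / (3 * T) ^ (m - 1)
      ∂(Measure.pi fun _ : Fin n => noiseLaw p) ≤ T / 3 ^ (m - 1) := by
    intro i
    rw [integral_div, integral_comp_eval (μ := fun _ : Fin n => noiseLaw p)
      (f := fun x => x ^ (4 * m)) (measurable_id.pow_const _).aestronglyMeasurable]
    rw [div_le_div_iff₀ (by positivity) (by positivity)]
    have h2 := integral_pow_four_mul_le (by linarith) hp hm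
    -- The level `3T` beats the moment bound `T^m` by the geometric factor `3^(m-1)`, which pays for
    -- the union over `n` variables.
    have e : T * (3 * T) ^ (m - 1) = T ^ m * 3 ^ (m - 1) := by
      obtain ⟨k, rfl⟩ : ∃ k, m = k + 1 := ⟨m - 1, by omega⟩
      rw [Nat.add_sub_cancel, mul_pow, pow_succ]
      ring
    rw [e]
    exact mul_le_mul_of_nonneg_right h2 (by positivity)
  unfold noiseMax
  rw [integral_add (integrable_const _) (integrable_finsetSum _ fun i _ => hi i),
    integral_finsetSum _ fun i _ => hi i]
  have h3 : ∑ i : Fin n, ∫ ξ, ξ i ^ (4 * m) / (3 * T) ^ (m - 1)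
      ∂(Measure.pi fun _ : Fin n => noiseLaw p) ≤ T := by
    refine (Finset.sum_le_sum fun i _ => h1 i).trans ?_
    rw [Finset.sum_const, Finset.card_univ, Fintype.card_fin, nsmul_eq_mul, mul_div_assoc',
      div_le_iff₀ (by positivity), mul_comm]
    exact mul_le_mul_of_nonneg_left hmn hT0.le
  simp only [integral_const, probReal_univ, smul_eq_mul]
  linarith

end Path

end SeqAR

namespace SeqAR

/-! Step functions: integrated and empirical squared errors. -/

section Step

variable {a b : ℝ} {n : ℕ}

/-- The step function with the values `g l` on the cells of the grid. -/
noncomputable def stepFun (a b : ℝ) (n : ℕ) (g : ℕ → ℝ) (t : ℝ) : ℝ :=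
  indicator (Icc a (gridPoint a b n 1)) (fun _ => g 1) t +
    ∑ l ∈ Finset.Icc 2 (gridSize n),
      indicator (Ioc (gridPoint a b n (l - 1)) (gridPoint a b n l)) (fun _ => g l) t

/-- The integrated squared error on `[a, b]`. -/
noncomputable def intErr (a b : ℝ) (T S : ℝ → ℝ) : ℝ≥0∞ :=
  ∫⁻ t in Icc a b, ENNReal.ofReal ((T t - S t) ^ 2)

theorem gridPoint_zero : gridPoint a b n 0 = a := by simp [gridPoint]

theorem gridPoint_last (hn : 1 ≤ n) : gridPoint a b n (gridSize n) = b := by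
  rw [gridPoint, div_self (gridSize_pos hn).ne']
  ring

theorem gridPoint_succ_sub (l : ℕ) :
    gridPoint a b n (l + 1) - gridPoint a b n l = (b - a) / gridSize n := by
  unfold gridPoint
  push_cast
  ring

theorem gridPoint_mono (hab : a < b) : Monotone (gridPoint a b n) := by
  intro l m h
  unfold gridPoint
  have := (sub_pos.mpr hab).le
  gcongr

theorem gridPoint_mem (hab : a < b) (hn : 1 ≤ n) {l : ℕ} (hl : l ≤ gridSize n) :
    gridPoint a b n l ∈ Icc a b := by
  constructor
  · have := gridPoint_mono (n := n) hab (Nat.zero_le l)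
    rwa [gridPoint_zero] at this
  · have := gridPoint_mono (n := n) hab hl
    rwa [gridPoint_last hn] at this

theorem stepFun_eq (hab : a < b) (g : ℕ → ℝ) {l : ℕ} (hl : l < gridSize n) {t : ℝ}
    (ht : t ∈ Ioc (gridPoint a b n l) (gridPoint a b n (l + 1))) :
    stepFun a b n g t = g (l + 1) := by
  have hm := gridPoint_mono (n := n) hab
  have hne : ∀ k ∈ Finset.Icc 2 (gridSize n), k ≠ l + 1 →
      indicator (Ioc (gridPoint a b n (k - 1)) (gridPoint a b n k)) (fun _ => g k) t = 0 := by
    intro k hk hkl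
    rw [Finset.mem_Icc] at hk
    refine indicator_of_notMem (fun h => ?_) _
    rcases lt_or_gt_of_ne hkl with h1 | h1
    · have := hm (show k ≤ l by omega)
      linarith [h.2, ht.1]
    · have := hm (show l + 1 ≤ k - 1 by omega)
      linarith [h.1, ht.2]
  unfold stepFun
  rcases Nat.eq_zero_or_pos l with h0 | h0
  · subst h0
    rw [Finset.sum_eq_zero fun k hk => hne k hk (by rw [Finset.mem_Icc] at hk; omega), add_zero,
      indicator_of_mem]
    rw [gridPoint_zero] at ht
    exact ⟨ht.1.le, ht.2⟩
  · have h1 : t ∉ Icc a (gridPoint a b n 1) := fun h => by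
      have := hm (show 1 ≤ l from h0)
      linarith [h.2, ht.1]
    rw [indicator_of_notMem h1, zero_add, Finset.sum_eq_single (l + 1) hne]
    · exact indicator_of_mem (by simpa using ht) _
    · intro h
      exact absurd (Finset.mem_Icc.mpr ⟨by omega, by omega⟩) h

theorem lintegral_Icc_eq_sum_cells (hab : a < b) (hn : 1 ≤ n) (F : ℝ → ℝ≥0∞) :
    ∫⁻ t in Icc a b, F t = ∑ l ∈ Finset.range (gridSize n),
      ∫⁻ t in Ioc (gridPoint a b n l) (gridPoint a b n (l + 1)), F t := by
  have key : ∀ m, ∫⁻ t in Ioc (gridPoint a b n 0) (gridPoint a b n m), F t =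
      ∑ l ∈ Finset.range m, ∫⁻ t in Ioc (gridPoint a b n l) (gridPoint a b n (l + 1)), F t := by
    intro m
    induction m with
    | zero => simp
    | succ m ih =>
      rw [Finset.sum_range_succ, ← ih, ← lintegral_union measurableSet_Ioc (Ioc_disjoint_Ioc_of_le le_rfl),
        Ioc_union_Ioc_eq_Ioc (gridPoint_mono hab (Nat.zero_le m))
          (gridPoint_mono hab (Nat.le_succ m))]
  rw [← key, gridPoint_zero, gridPoint_last hn]
  exact setLIntegral_congr Ioc_ae_eq_Icc.symm

theorem abs_sub_le_of_mem_stabilitySet {ε L : ℝ} {S : ℝ → ℝ} (hS : S ∈ stabilitySet a b ε L)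
    {x y : ℝ} (hx : x ∈ Icc a b) (hy : y ∈ Icc a b) : |S x - S y| ≤ L * |x - y| := by
  have := Convex.norm_image_sub_le_of_norm_derivWithin_le (hS.1.differentiableOn one_ne_zero)
    (fun z hz => by simpa using hS.2.2 z hz) (convex_Icc a b) hy hx
  simpa using this

theorem sq_add_le {δ : ℝ} (hδ : 0 < δ) (x y : ℝ) :
    (x + y) ^ 2 ≤ (1 + δ) * x ^ 2 + (1 + 1 / δ) * y ^ 2 := by
  have h : (1 + δ) * x ^ 2 + (1 + 1 / δ) * y ^ 2 - (x + y) ^ 2 = (δ * x - y) ^ 2 / δ := by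
    field_simp
    ring
  have : 0 ≤ (δ * x - y) ^ 2 / δ := by positivity
  linarith

theorem sq_le_of_abs_sub_le {δ x y z r : ℝ} (hδ : 0 < δ) (h : |y - z| ≤ r) :
    (x - y) ^ 2 ≤ (1 + δ) * (x - z) ^ 2 + (1 + 1 / δ) * r ^ 2 := by
  have h1 := sq_add_le hδ (x - z) (z - y)
  have h2 : (z - y) ^ 2 ≤ r ^ 2 := by
    rw [← sq_abs, abs_sub_comm]
    exact pow_le_pow_left₀ (abs_nonneg _) h 2
  have h3 : (1 + 1 / δ) * (z - y) ^ 2 ≤ (1 + 1 / δ) * r ^ 2 := by gcongr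
  have e : x - z + (z - y) = x - y := by ring
  rw [e] at h1
  linarith

variable {ε L : ℝ} {S : ℝ → ℝ}

theorem abs_sub_le_on_cell (hab : a < b) (hn : 1 ≤ n) (hL : 0 ≤ L) (hS : S ∈ stabilitySet a b ε L)
    {l : ℕ} (hl : l < gridSize n) {t : ℝ}
    (ht : t ∈ Ioc (gridPoint a b n l) (gridPoint a b n (l + 1))) :
    |S t - S (gridPoint a b n (l + 1))| ≤ L * ((b - a) / gridSize n) := by
  have h1 := gridPoint_mem hab hn hl.le
  have h2 := gridPoint_mem hab hn (Nat.succ_le_of_lt hl)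
  refine (abs_sub_le_of_mem_stabilitySet hS ⟨h1.1.trans ht.1.le, ht.2.trans h2.2⟩ h2).trans ?_
  refine mul_le_mul_of_nonneg_left ?_ hL
  rw [← gridPoint_succ_sub (n := n) l, abs_sub_comm, abs_of_nonneg (sub_nonneg.mpr ht.2)]
  linarith [ht.1]

theorem volume_cell (l : ℕ) :
    volume (Ioc (gridPoint a b n l) (gridPoint a b n (l + 1))) =
      ENNReal.ofReal ((b - a) / gridSize n) := by
  rw [Real.volume_Ioc, gridPoint_succ_sub]

/-- On a cell `S` moves by at most `L (b - a) / d`, so replacing `S t` by its value at the right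
grid point costs `1 + δ` and a term of order `1 / (δ d²)`. -/
theorem intErr_stepFun_le (hab : a < b) (hn : 1 ≤ n) (hL : 0 ≤ L)
    (hS : S ∈ stabilitySet a b ε L) {δ : ℝ} (hδ : 0 < δ) (g : ℕ → ℝ) :
    intErr a b (stepFun a b n g) S ≤
      ENNReal.ofReal ((1 + δ) * ((b - a) / gridSize n *
        ∑ l : Fin (gridSize n), (g (l + 1) - S (gridPoint a b n (l + 1))) ^ 2) +
        (1 + 1 / δ) * (L ^ 2 * ((b - a) / gridSize n) ^ 2 * (b - a))) := by
  have hd := gridSize_pos hn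
  have hba := sub_pos.mpr hab
  have hc : 0 < (b - a) / gridSize n := by positivity
  set c := (b - a) / gridSize n with hcdef
  rw [intErr, lintegral_Icc_eq_sum_cells hab hn]
  calc _ ≤ ∑ l ∈ Finset.range (gridSize n),
        ENNReal.ofReal (((1 + δ) * (g (l + 1) - S (gridPoint a b n (l + 1))) ^ 2 +
          (1 + 1 / δ) * (L * c) ^ 2) * c) := by
        refine Finset.sum_le_sum fun l hl => ?_
        have hl' := Finset.mem_range.mp hl
        rw [ENNReal.ofReal_mul (by positivity), ← volume_cell (a := a) (b := b) (n := n) l,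
          ← setLIntegral_const]
        refine setLIntegral_mono measurable_const fun t ht => ENNReal.ofReal_le_ofReal ?_
        rw [stepFun_eq hab g hl' ht]
        exact sq_le_of_abs_sub_le hδ (abs_sub_le_on_cell hab hn hL hS hl' ht)
    _ = _ := by
        rw [← ENNReal.ofReal_sum_of_nonneg fun l _ => by positivity, ← Finset.sum_mul,
          Finset.sum_add_distrib, ← Finset.mul_sum, Finset.sum_const, Finset.card_range,
          Fin.sum_univ_eq_sum_range (fun l => (g (l + 1) - S (gridPoint a b n (l + 1))) ^ 2)]
        congr 1
        have e : (gridSize n : ℝ) * c = b - a := by rw [hcdef]; field_simp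
        rw [← e, nsmul_eq_mul]
        ring

theorem ofReal_empErr_le (hab : a < b) (hn : 1 ≤ n) (hL : 0 ≤ L)
    (hS : S ∈ stabilitySet a b ε L) {δ : ℝ} (hδ : 0 < δ) (g : ℕ → ℝ) :
    ENNReal.ofReal ((b - a) / gridSize n *
        ∑ l : Fin (gridSize n), (g (l + 1) - S (gridPoint a b n (l + 1))) ^ 2) ≤
      ENNReal.ofReal (1 + δ) * intErr a b (stepFun a b n g) S +
        ENNReal.ofReal ((1 + 1 / δ) * (L ^ 2 * ((b - a) / gridSize n) ^ 2 * (b - a))) := by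
  have hd := gridSize_pos hn
  have hba := sub_pos.mpr hab
  have hc : 0 < (b - a) / gridSize n := by positivity
  set c := (b - a) / gridSize n with hcdef
  rw [intErr, lintegral_Icc_eq_sum_cells hab hn]
  calc _ = ∑ l ∈ Finset.range (gridSize n),
        ENNReal.ofReal ((g (l + 1) - S (gridPoint a b n (l + 1))) ^ 2 * c) := by
        rw [← ENNReal.ofReal_sum_of_nonneg fun l _ => by positivity, ← Finset.sum_mul, mul_comm,
          Fin.sum_univ_eq_sum_range (fun l => (g (l + 1) - S (gridPoint a b n (l + 1))) ^ 2)]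
    _ ≤ ∑ l ∈ Finset.range (gridSize n), (ENNReal.ofReal (1 + δ) *
        (∫⁻ t in Ioc (gridPoint a b n l) (gridPoint a b n (l + 1)),
          ENNReal.ofReal ((stepFun a b n g t - S t) ^ 2)) +
        ENNReal.ofReal ((1 + 1 / δ) * (L * c) ^ 2 * c)) := by
        refine Finset.sum_le_sum fun l hl => ?_
        have hl' := Finset.mem_range.mp hl
        rw [ENNReal.ofReal_mul (sq_nonneg _), ENNReal.ofReal_mul (by positivity),
          ← volume_cell (a := a) (b := b) (n := n) l, ← setLIntegral_const, ← setLIntegral_const,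
          ← lintegral_const_mul' _ _ ENNReal.ofReal_ne_top,
          ← lintegral_add_right _ measurable_const]
        refine setLIntegral_mono' measurableSet_Ioc fun t ht => ?_
        rw [stepFun_eq hab g hl' ht, ← ENNReal.ofReal_mul (by positivity),
          ← ENNReal.ofReal_add (by positivity) (by positivity)]
        refine ENNReal.ofReal_le_ofReal (sq_le_of_abs_sub_le hδ ?_)
        rw [abs_sub_comm]
        exact abs_sub_le_on_cell hab hn hL hS hl' ht
    _ = _ := by
        rw [Finset.sum_add_distrib, ← ENNReal.ofReal_sum_of_nonneg fun l _ => by positivity,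
          Finset.sum_const, Finset.card_range, Finset.mul_sum]
        congr 2
        have e : (gridSize n : ℝ) * c = b - a := by rw [hcdef]; field_simp
        rw [← e, nsmul_eq_mul]
        ring

end Step

/-! Comparison of risks. -/

section Risk

variable {a b y₀ : ℝ} {n : ℕ} {S p : ℝ → ℝ}

/-- The noise and the observations determine each other, so a remainder written in the noise is also
a measurable function of the observations. Lower integrals are monotone and only the added remainder
has to be measurable, hence no measurability of the estimators is required. -/
theorem risk_le_of_pathwise {T₁ T₂ : (Fin n → ℝ) → ℝ → ℝ} {K : ℝ≥0∞} (hK : K ≠ ⊤)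
    {R : (Fin n → ℝ) → ℝ} (hR : Measurable R)
    (h : ∀ ξ : Fin n → ℝ,
      intErr a b (T₁ fun k => arPath a b y₀ S ξ ((k : ℕ) + 1)) S ≤
        K * intErr a b (T₂ fun k => arPath a b y₀ S ξ ((k : ℕ) + 1)) S + ENNReal.ofReal (R ξ)) :
    risk a b y₀ T₁ S p ≤ K * risk a b y₀ T₂ S p +
      ∫⁻ ξ, ENNReal.ofReal (R ξ) ∂(Measure.pi fun _ : Fin n => noiseLaw p) := by
  set Φ : (Fin n → ℝ) → Fin n → ℝ := fun ξ k => arPath a b y₀ S ξ ((k : ℕ) + 1) with hΦ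
  have hΦm : Measurable Φ := measurable_pi_lambda _ fun k => measurable_arPath a b y₀ S _
  -- The inverse of the autoregression recovers `ξ_{k+1} = y_{k+1} - S(x_{k+1}) y_k`; the coordinate
  -- `k` of `y` is time `k + 1`.
  let Ψ : (Fin n → ℝ) → Fin n → ℝ := fun y k =>
    y k - S (designPoint a b n ((k : ℕ) + 1)) * obsSeq y₀ y k
  have hΨm : Measurable Ψ := by
    refine measurable_pi_lambda _ fun k => (measurable_pi_apply k).sub
      (measurable_const.mul ?_)
    rcases k with ⟨k, hk⟩
    cases k with
    | zero => exact measurable_const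
    | succ k =>
      simp only [obsSeq, show k < n by omega, dite_true]
      exact measurable_pi_apply _
  have hRm : Measurable fun y => ENNReal.ofReal (R (Ψ y)) := (hR.comp hΨm).ennreal_ofReal
  have h1 : ∀ ξ, Ψ (Φ ξ) = ξ := by
    intro ξ
    funext k
    have e := pathSeq_succ (a := a) (b := b) (y₀ := y₀) (S := S) ξ k
    have e1 := pathSeq_eq (a := a) (b := b) (y₀ := y₀) (S := S) ξ k.isLt
    simp only [Ψ, hΦ]
    rw [e] at e1
    rw [← Nat.succ_eq_add_one, ← e1]
    simp [pathSeq]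
  have h2 : ∀ y, Φ (Ψ y) = y := by
    intro y
    have key : ∀ k ≤ n, arPath a b y₀ S (Ψ y) k = obsSeq y₀ y k := by
      intro k
      induction k with
      | zero => intro _; rfl
      | succ k ih =>
        intro hk
        have hk' : k < n := hk
        have e : obsSeq y₀ y (k + 1) = y ⟨k, hk'⟩ := by simp [obsSeq, hk']
        simp only [arPath, hk', dite_true, ih hk'.le, e, Ψ]
        ring
    funext k
    rw [hΦ]
    simp only
    rw [key _ k.isLt]
    simp [obsSeq]
  have h3 : ∫⁻ y, ENNReal.ofReal (R (Ψ y)) ∂(obsLaw a b y₀ n p S) =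
      ∫⁻ ξ, ENNReal.ofReal (R ξ) ∂(Measure.pi fun _ : Fin n => noiseLaw p) := by
    rw [obsLaw, lintegral_map hRm hΦm]
    exact lintegral_congr fun ξ => by rw [h1 ξ]
  rw [← h3]
  unfold risk
  rw [← lintegral_const_mul' _ _ hK, ← lintegral_add_right _ hRm]
  refine lintegral_mono fun y => ?_
  have := h (Ψ y)
  rw [show (fun k : Fin n => arPath a b y₀ S (Ψ y) ((k : ℕ) + 1)) = y from h2 y] at this
  exact this

end Risk

end SeqAR

namespace SeqAR

/-! Model selection in an orthonormal system of coordinates. -/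

section Orthogonal

variable {d : ℕ} {O : Fin d → Fin d → ℝ}

/-- A one-sided inverse of a square matrix is two-sided; there are as many basis functions as grid
points. -/
theorem orthogonal_transpose (hO : ∀ i j, ∑ l, O i l * O j l = if i = j then 1 else 0)
    (l l' : Fin d) : ∑ j, O j l * O j l' = if l = l' then 1 else 0 := by
  let M : Matrix (Fin d) (Fin d) ℝ := Matrix.of O
  have h1 : M * M.transpose = 1 := by
    ext i j
    simp [Matrix.mul_apply, M, hO, Matrix.one_apply]
  have h2 : M.transpose * M = 1 := mul_eq_one_comm.mp h1
  have := congrFun (congrFun h2 l) l'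
  simpa [Matrix.mul_apply, M, Matrix.one_apply] using this

theorem parseval (hO : ∀ i j, ∑ l, O i l * O j l = if i = j then 1 else 0) (x : Fin d → ℝ) :
    ∑ l, (∑ j, x j * O j l) ^ 2 = ∑ j, x j ^ 2 := by
  have e : ∀ l, (∑ j, x j * O j l) ^ 2 = ∑ i, ∑ j, x i * x j * (O i l * O j l) := fun l => by
    rw [sq, Finset.sum_mul_sum]
    exact Finset.sum_congr rfl fun i _ => Finset.sum_congr rfl fun j _ => by ring
  simp_rw [e]
  rw [Finset.sum_comm]
  refine Finset.sum_congr rfl fun i _ => ?_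
  rw [Finset.sum_comm, Finset.sum_eq_single i]
  · rw [← Finset.mul_sum, hO, if_pos rfl]
    ring
  · intro j _ hj
    rw [← Finset.mul_sum, hO, if_neg hj.symm, mul_zero]
  · simp

/-- The coordinates of a vector in the orthonormal system `O`. -/
def coord (O : Fin d → Fin d → ℝ) (f : Fin d → ℝ) (j : Fin d) : ℝ := ∑ l, O j l * f l

theorem parseval_coord (hO : ∀ i j, ∑ l, O i l * O j l = if i = j then 1 else 0)
    (f : Fin d → ℝ) : ∑ j, coord O f j ^ 2 = ∑ l, f l ^ 2 := by
  rw [← parseval (O := fun j l => O l j) (orthogonal_transpose hO) f]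
  exact Finset.sum_congr rfl fun j _ => by
    rw [coord]
    congr 1
    exact Finset.sum_congr rfl fun l _ => mul_comm _ _

theorem sum_coord_mul (hO : ∀ i j, ∑ l, O i l * O j l = if i = j then 1 else 0)
    (f : Fin d → ℝ) (l : Fin d) : ∑ j, coord O f j * O j l = f l := by
  simp_rw [coord, Finset.sum_mul]
  rw [Finset.sum_comm, Finset.sum_eq_single l]
  · have := orthogonal_transpose hO l l
    rw [if_pos rfl] at this
    calc ∑ j, O j l * f l * O j l = (∑ j, O j l * O j l) * f l := by
          rw [Finset.sum_mul]
          exact Finset.sum_congr rfl fun j _ => by ring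
      _ = f l := by rw [this, one_mul]
  · intro l' _ hl
    have := orthogonal_transpose hO l' l
    rw [if_neg hl] at this
    calc ∑ j, O j l' * f l' * O j l = (∑ j, O j l' * O j l) * f l' := by
          rw [Finset.sum_mul]
          exact Finset.sum_congr rfl fun j _ => by ring
      _ = 0 := by rw [this, zero_mul]
  · simp

theorem coord_add (f g : Fin d → ℝ) (j : Fin d) :
    coord O (fun l => f l + g l) j = coord O f j + coord O g j := by
  simp only [coord, mul_add, Finset.sum_add_distrib]

/-- The linear statistic with weights `x`. -/
def linStat (O : Fin d → Fin d → ℝ) (f e x : Fin d → ℝ) : ℝ :=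
  ∑ j, x j * coord O f j * coord O e j

/-- The variance coordinates. -/
def varCoord (O : Fin d → Fin d → ℝ) (r : Fin d → ℝ) (j : Fin d) : ℝ := ∑ l, O j l ^ 2 * r l

/-- The centred quadratic statistic with weights `x`. -/
def quadStat (O : Fin d → Fin d → ℝ) (e r x : Fin d → ℝ) : ℝ :=
  ∑ j, x j * (coord O e j ^ 2 - varCoord O r j)

/-- Normalised linear statistics, summed over a finite set of weights. -/
noncomputable def linSup (X : Finset (Fin d → ℝ)) (O : Fin d → Fin d → ℝ) (f e : Fin d → ℝ) : ℝ :=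
  ∑ x ∈ X, linStat O f e x ^ 2 / ∑ j, x j ^ 2 * coord O f j ^ 2

/-- Normalised quadratic statistics, summed over a finite set of weights. -/
noncomputable def quadSup (X : Finset (Fin d → ℝ)) (O : Fin d → Fin d → ℝ) (e r : Fin d → ℝ)
    (ρ : ℝ) : ℝ :=
  ∑ x ∈ X, quadStat O e r x ^ 2 / (ρ * ∑ j, x j ^ 2)

theorem linSup_nonneg (X : Finset (Fin d → ℝ)) (f e : Fin d → ℝ) : 0 ≤ linSup X O f e :=
  Finset.sum_nonneg fun _ _ => div_nonneg (sq_nonneg _) (Finset.sum_nonneg fun _ _ => by positivity)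

theorem quadSup_nonneg (X : Finset (Fin d → ℝ)) (e r : Fin d → ℝ) {ρ : ℝ} (hρ : 0 ≤ ρ) :
    0 ≤ quadSup X O e r ρ :=
  Finset.sum_nonneg fun _ _ => div_nonneg (sq_nonneg _)
    (mul_nonneg hρ (Finset.sum_nonneg fun _ _ => sq_nonneg _))

/-- When the normalising sum is zero the quotient in `linSup` is zero by convention, but then every
`x j * coord O f j` vanishes and so does the statistic. -/
theorem linStat_sq_le {X : Finset (Fin d → ℝ)} {x : Fin d → ℝ} (hx : x ∈ X) (f e : Fin d → ℝ) :
    linStat O f e x ^ 2 ≤ linSup X O f e * ∑ j, x j ^ 2 * coord O f j ^ 2 := by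
  have h0 : 0 ≤ ∑ j, x j ^ 2 * coord O f j ^ 2 := Finset.sum_nonneg fun _ _ => by positivity
  have hle : linStat O f e x ^ 2 / ∑ j, x j ^ 2 * coord O f j ^ 2 ≤ linSup X O f e :=
    Finset.single_le_sum (f := fun x : Fin d → ℝ =>
      linStat O f e x ^ 2 / ∑ j, x j ^ 2 * coord O f j ^ 2)
      (fun _ _ => div_nonneg (sq_nonneg _) (Finset.sum_nonneg fun _ _ => by positivity)) hx
  rcases h0.eq_or_lt with h | h
  · have h1 : linStat O f e x = 0 := Finset.sum_eq_zero fun j hj => by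
      have := (Finset.sum_eq_zero_iff_of_nonneg fun j _ => by positivity).mp h.symm j hj
      rw [← mul_pow, pow_eq_zero_iff two_ne_zero] at this
      rw [this, zero_mul]
    rw [h1, ← h]
    simp
  · rwa [div_le_iff₀ h] at hle

theorem le_varCoord (hO : ∀ i j, ∑ l, O i l * O j l = if i = j then 1 else 0) {r : Fin d → ℝ}
    {ρ : ℝ} (hr : ∀ l, ρ ≤ r l) (j : Fin d) : ρ ≤ varCoord O r j := by
  have h := hO j j
  rw [if_pos rfl] at h
  calc ρ = ∑ l, O j l ^ 2 * ρ := by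
        rw [← Finset.sum_mul]
        simp_rw [sq]
        rw [h, one_mul]
    _ ≤ _ := Finset.sum_le_sum fun l _ => mul_le_mul_of_nonneg_left (hr l) (sq_nonneg _)

/-- The variances `varCoord O r` are random, so `quadSup` normalises by their deterministic lower
bound `ρ`; its denominator can then leave the expectation. -/
theorem quadStat_sq_le (hO : ∀ i j, ∑ l, O i l * O j l = if i = j then 1 else 0)
    {X : Finset (Fin d → ℝ)} {x : Fin d → ℝ} (hx : x ∈ X) (e : Fin d → ℝ) {r : Fin d → ℝ}
    {ρ : ℝ} (hρ : 0 < ρ) (hr : ∀ l, ρ ≤ r l) :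
    quadStat O e r x ^ 2 ≤ quadSup X O e r ρ * ∑ j, x j ^ 2 * varCoord O r j := by
  have h0 : 0 ≤ ∑ j, x j ^ 2 := Finset.sum_nonneg fun _ _ => sq_nonneg _
  have hle : quadStat O e r x ^ 2 / (ρ * ∑ j, x j ^ 2) ≤ quadSup X O e r ρ :=
    Finset.single_le_sum (f := fun x : Fin d → ℝ => quadStat O e r x ^ 2 / (ρ * ∑ j, x j ^ 2))
      (fun _ _ => div_nonneg (sq_nonneg _)
        (mul_nonneg hρ.le (Finset.sum_nonneg fun _ _ => sq_nonneg _))) hx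
  have h2 : ρ * ∑ j, x j ^ 2 ≤ ∑ j, x j ^ 2 * varCoord O r j := by
    rw [Finset.mul_sum]
    refine Finset.sum_le_sum fun j _ => ?_
    rw [mul_comm]
    exact mul_le_mul_of_nonneg_left (le_varCoord hO hr j) (sq_nonneg _)
  refine le_trans ?_ (mul_le_mul_of_nonneg_left h2 (quadSup_nonneg X e r hρ.le))
  rcases h0.eq_or_lt with h | h
  · have h1 : quadStat O e r x = 0 := Finset.sum_eq_zero fun j hj => by
      have := (Finset.sum_eq_zero_iff_of_nonneg fun j _ => sq_nonneg _).mp h.symm j hj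
      rw [pow_eq_zero_iff two_ne_zero] at this
      rw [this, zero_mul]
    rw [h1, ← h]
    simp
  · rwa [div_le_iff₀ (mul_pos hρ h)] at hle

open Classical in
/-- The weights which enter the comparison with `w₀`. -/
noncomputable def comparisonSet (Λ : Finset (Fin d → ℝ)) (w₀ : Fin d → ℝ) : Finset (Fin d → ℝ) :=
  (Λ.image fun w j => w j - w₀ j) ∪ (Λ.image fun w j => (w j - w₀ j) ^ 2) ∪
    {fun j => w₀ j - w₀ j ^ 2, fun j => w₀ j ^ 2}

theorem card_comparisonSet_le (Λ : Finset (Fin d → ℝ)) (w₀ : Fin d → ℝ) :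
    (comparisonSet Λ w₀).card ≤ 2 * Λ.card + 2 := by
  classical
  refine (Finset.card_union_le _ _).trans (add_le_add ?_ Finset.card_le_two)
  refine (Finset.card_union_le _ _).trans ?_
  rw [two_mul]
  exact add_le_add Finset.card_image_le Finset.card_image_le

/-- The oracle inequality in terms of the normalised statistics. -/
theorem oracle_inequality_coord (hO : ∀ i j, ∑ l, O i l * O j l = if i = j then 1 else 0)
    {Λ : Finset (Fin d → ℝ)} (hΛ : ∀ w ∈ Λ, ∀ j, w j ∈ Icc (0 : ℝ) 1) {w w₀ : Fin d → ℝ}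
    (hw : w ∈ Λ) (hw₀ : w₀ ∈ Λ) {f e g r Y : Fin d → ℝ} (hY : ∀ l, Y l = f l + e l + g l)
    {ρ δ : ℝ} (hρ : 0 < ρ) (hr : ∀ l, ρ ≤ r l) (hδ : 0 < δ) (hδ' : δ ≤ 1 / 12)
    (hJ : ∑ j, w j ^ 2 * coord O Y j ^ 2 - 2 * ∑ j, w j * (coord O Y j ^ 2 - varCoord O r j) +
        δ * ∑ j, w j ^ 2 * varCoord O r j ≤
      ∑ j, w₀ j ^ 2 * coord O Y j ^ 2 - 2 * ∑ j, w₀ j * (coord O Y j ^ 2 - varCoord O r j) +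
        δ * ∑ j, w₀ j ^ 2 * varCoord O r j) :
    ∑ l, ((∑ j, w j * coord O Y j * O j l) - f l) ^ 2 ≤
      (1 + 4 * δ) / (1 - 6 * δ) * ∑ l, ((∑ j, w₀ j * coord O Y j * O j l) - f l) ^ 2 +
        60 / δ * (linSup (comparisonSet Λ w₀) O f e + quadSup (comparisonSet Λ w₀) O e r ρ +
          ∑ l, g l ^ 2) := by
  classical
  have hT : ∀ j, coord O Y j = coord O f j + coord O e j + coord O g j := fun j => by
    rw [← coord_add, ← coord_add]
    simp only [coord, hY]
  have hE : ∀ u : Fin d → ℝ, ∑ l, ((∑ j, u j * coord O Y j * O j l) - f l) ^ 2 =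
      ∑ j, (u j * (coord O f j + coord O e j + coord O g j) - coord O f j) ^ 2 := fun u => by
    rw [← parseval hO fun j =>
      u j * (coord O f j + coord O e j + coord O g j) - coord O f j]
    refine Finset.sum_congr rfl fun l _ => ?_
    conv_lhs => rw [← sum_coord_mul hO f l]
    rw [← Finset.sum_sub_distrib]
    congr 1
    exact Finset.sum_congr rfl fun j _ => by rw [hT, sub_mul]
  simp_rw [hE]
  rw [← parseval_coord hO g]
  simp_rw [hT] at hJ
  have mem1 : (fun j => w j - w₀ j) ∈ comparisonSet Λ w₀ :=
    Finset.mem_union_left _ (Finset.mem_union_left _ (Finset.mem_image_of_mem _ hw))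
  have mem2 : (fun j => (w j - w₀ j) ^ 2) ∈ comparisonSet Λ w₀ :=
    Finset.mem_union_left _ (Finset.mem_union_right _ (Finset.mem_image_of_mem _ hw))
  have mem3 : (fun j => w₀ j - w₀ j ^ 2) ∈ comparisonSet Λ w₀ :=
    Finset.mem_union_right _ (by simp)
  have mem4 : (fun j => w₀ j ^ 2) ∈ comparisonSet Λ w₀ :=
    Finset.mem_union_right _ (by simp)
  refine oracle_inequality hδ hδ' (hΛ w hw) (hΛ w₀ hw₀)
    (fun j => hρ.le.trans (le_varCoord hO hr j)) (linSup_nonneg _ _ _)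
    (quadSup_nonneg _ _ _ hρ.le) ?_ ?_ hJ
  · rintro x (rfl | rfl | rfl)
    · exact linStat_sq_le mem1 f e
    · exact linStat_sq_le mem2 f e
    · exact linStat_sq_le mem3 f e
  · rintro x (rfl | rfl | rfl)
    · exact quadStat_sq_le hO mem1 e hρ hr
    · exact quadStat_sq_le hO mem2 e hρ hr
    · exact quadStat_sq_le hO mem4 e hρ hr

theorem linStat_eq (f e x : Fin d → ℝ) :
    linStat O f e x = ∑ l, (∑ j, x j * coord O f j * O j l) * e l := by
  have h : ∀ j, coord O e j = ∑ l, O j l * e l := fun _ => rfl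
  unfold linStat
  simp_rw [h, Finset.mul_sum, Finset.sum_mul]
  rw [Finset.sum_comm]
  exact Finset.sum_congr rfl fun l _ => Finset.sum_congr rfl fun j _ => by ring

theorem quadStat_eq (e r x : Fin d → ℝ) :
    quadStat O e r x = ∑ l, ∑ l', (∑ j, x j * O j l * O j l') * e l * e l' -
      ∑ l, (∑ j, x j * O j l * O j l) * r l := by
  have h1 : ∀ j, coord O e j ^ 2 = ∑ l, ∑ l', O j l * O j l' * e l * e l' := fun j => by
    rw [coord, sq, Finset.sum_mul_sum]
    exact Finset.sum_congr rfl fun l _ => Finset.sum_congr rfl fun l' _ => by ring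
  unfold quadStat varCoord
  simp_rw [mul_sub, h1, Finset.sum_sub_distrib, Finset.mul_sum, Finset.sum_mul]
  congr 1
  · rw [Finset.sum_comm]
    refine Finset.sum_congr rfl fun l _ => ?_
    rw [Finset.sum_comm]
    exact Finset.sum_congr rfl fun l' _ => Finset.sum_congr rfl fun j _ => by ring
  · rw [Finset.sum_comm]
    exact Finset.sum_congr rfl fun l _ => Finset.sum_congr rfl fun j _ => by ring

/-! ### Expectations of the normalised statistics. -/

variable {n : ℕ} {μ : Measure ℝ} (hμ : IsNoise μ)
  {v : Fin d → Fin n → (Fin n → ℝ) → ℝ} {s : ℝ}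
  (hv : ∀ l (i : Fin n), Adapted μ i.val (v l i))
include hμ hv

theorem allMoments_block (l : Fin d) :
    AllMoments (Measure.pi fun _ : Fin n => μ) fun ξ => ∑ i, v l i ξ * ξ i := by
  have := hμ.prob
  exact AllMoments.sum _ fun i _ => (hv l i).mom.mul
    (Adapted.eval hμ.mom i (Nat.lt_succ_self _)).mom

theorem allMoments_linStat (f x : Fin d → ℝ) :
    AllMoments (Measure.pi fun _ : Fin n => μ)
      fun ξ => linStat O f (fun l => ∑ i, v l i ξ * ξ i) x := by
  have := hμ.prob
  simp_rw [linStat_eq]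
  exact AllMoments.sum _ fun l _ => (AllMoments.const _).mul (allMoments_block hμ hv l)

theorem allMoments_quadStat (x : Fin d → ℝ) :
    AllMoments (Measure.pi fun _ : Fin n => μ)
      fun ξ => quadStat O (fun l => ∑ i, v l i ξ * ξ i) (fun l => ∑ i, v l i ξ ^ 2) x := by
  have := hμ.prob
  simp_rw [quadStat_eq]
  exact (AllMoments.sum _ fun l _ => AllMoments.sum _ fun l' _ =>
    ((AllMoments.const _).mul (allMoments_block hμ hv l)).mul (allMoments_block hμ hv l')).sub
    (AllMoments.sum _ fun l _ => (AllMoments.const _).mul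
      (AllMoments.sum _ fun i _ => ((hv l i).mom.pow 2)))

theorem integrable_linSup (X : Finset (Fin d → ℝ)) (f : Fin d → ℝ) :
    Integrable (fun ξ => linSup X O f fun l => ∑ i, v l i ξ * ξ i)
      (Measure.pi fun _ : Fin n => μ) := by
  have := hμ.prob
  exact integrable_finsetSum _ fun x _ =>
    (((allMoments_linStat hμ hv f x).pow 2).integrable).div_const _

theorem integrable_quadSup (X : Finset (Fin d → ℝ)) (ρ : ℝ) :
    Integrable (fun ξ => quadSup X O (fun l => ∑ i, v l i ξ * ξ i) (fun l => ∑ i, v l i ξ ^ 2) ρ)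
      (Measure.pi fun _ : Fin n => μ) := by
  have := hμ.prob
  exact integrable_finsetSum _ fun x _ =>
    (((allMoments_quadStat hμ hv x).pow 2).integrable).div_const _

variable (hO : ∀ i j, ∑ l, O i l * O j l = if i = j then 1 else 0)
  (hdis : ∀ l l' i ξ, l ≠ l' → v l i ξ * v l' i ξ = 0)
  (hs : ∀ l ξ, ∑ i, v l i ξ ^ 2 ≤ s) (hs0 : 0 ≤ s)
include hO hdis hs hs0

theorem integral_linSup_le (X : Finset (Fin d → ℝ)) (f : Fin d → ℝ) :
    ∫ ξ, linSup X O f (fun l => ∑ i, v l i ξ * ξ i) ∂(Measure.pi fun _ : Fin n => μ) ≤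
      X.card * s := by
  have := hμ.prob
  unfold linSup
  rw [integral_finsetSum _ fun x _ =>
    (((allMoments_linStat hμ hv f x).pow 2).integrable).div_const _, ← nsmul_eq_mul]
  refine Finset.sum_le_card_nsmul _ _ _ fun x _ => ?_
  rw [integral_div]
  have h0 : 0 ≤ ∑ j, x j ^ 2 * coord O f j ^ 2 := Finset.sum_nonneg fun _ _ => by positivity
  refine div_le_of_le_mul₀ h0 hs0 ?_
  simp_rw [linStat_eq]
  refine (integral_sq_linear_form_le hμ hv hdis hs _).trans (le_of_eq ?_)
  rw [parseval hO]
  simp_rw [mul_pow]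

/-- The statistic is the form with matrix `Oᵀ diag(x) O`, whose squared Frobenius norm is `∑ x_j²`;
this cancels the normalisation. -/
theorem integral_quadSup_le (X : Finset (Fin d → ℝ)) {ρ m4 : ℝ} (hρ : 0 < ρ)
    (h4 : ∫ x, x ^ 4 ∂μ ≤ m4) (hm4 : 0 ≤ m4) :
    ∫ ξ, quadSup X O (fun l => ∑ i, v l i ξ * ξ i) (fun l => ∑ i, v l i ξ ^ 2) ρ
        ∂(Measure.pi fun _ : Fin n => μ) ≤
      X.card * ((8 + 2 * m4) * s ^ 2 / ρ) := by
  have := hμ.prob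
  unfold quadSup
  rw [integral_finsetSum _ fun x _ =>
    (((allMoments_quadStat hμ hv x).pow 2).integrable).div_const _, ← nsmul_eq_mul]
  refine Finset.sum_le_card_nsmul _ _ _ fun x _ => ?_
  rw [integral_div]
  have h0 : 0 ≤ ∑ j, x j ^ 2 := Finset.sum_nonneg fun _ _ => sq_nonneg _
  refine div_le_of_le_mul₀ (by positivity) (by positivity) ?_
  simp_rw [quadStat_eq]
  refine (integral_sq_quadratic_form_le hμ hv hdis hs h4 hm4 hs0
    (fun l l' => ∑ j, x j * O j l * O j l')
    (fun l l' => Finset.sum_congr rfl fun j _ => by ring)).trans (le_of_eq ?_)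
  have e : ∑ l, ∑ l', (∑ j, x j * O j l * O j l') ^ 2 = ∑ j, x j ^ 2 := by
    simp_rw [fun l => parseval hO fun j => x j * O j l, mul_pow]
    rw [Finset.sum_comm]
    refine Finset.sum_congr rfl fun j _ => ?_
    have := hO j j
    rw [if_pos rfl] at this
    rw [← Finset.mul_sum]
    simp_rw [sq (O j _)]
    rw [this, mul_one]
  rw [e]
  field_simp

end Orthogonal

end SeqAR

namespace SeqAR

/-! The model selection procedure in orthonormal coordinates. -/

section Selection

variable {a b y₀ μ₀ : ℝ} {n : ℕ}

/-- The orthonormal matrix of the normalised values of the basis functions. -/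
noncomputable def basisMatrix (a b : ℝ) (n : ℕ) (φ : Fin (gridSize n) → ℝ → ℝ)
    (j l : Fin (gridSize n)) : ℝ :=
  Real.sqrt ((b - a) / gridSize n) * φ j (gridPoint a b n (l + 1))

theorem basisMatrix_orthonormal (hab : a < b) {φ : Fin (gridSize n) → ℝ → ℝ}
    (hφ : EmpOrthonormal a b n φ) (i j : Fin (gridSize n)) :
    ∑ l, basisMatrix a b n φ i l * basisMatrix a b n φ j l = if i = j then 1 else 0 := by
  have hc : 0 ≤ (b - a) / (gridSize n : ℝ) := div_nonneg (sub_pos.mpr hab).le (Nat.cast_nonneg _)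
  rw [← hφ i j, Finset.mul_sum]
  refine Finset.sum_congr rfl fun l _ => ?_
  unfold basisMatrix
  rw [mul_mul_mul_comm, Real.mul_self_sqrt hc]

theorem thetaHat_eq (hab : a < b) (φ : Fin (gridSize n) → ℝ → ℝ) (y : ℕ → ℝ)
    (j : Fin (gridSize n)) :
    thetaHat a b μ₀ n φ y j = Real.sqrt ((b - a) / gridSize n) *
      coord (basisMatrix a b n φ) (fun l => regObs a b μ₀ n (l + 1) y) j := by
  have hc : 0 ≤ (b - a) / (gridSize n : ℝ) := div_nonneg (sub_pos.mpr hab).le (Nat.cast_nonneg _)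
  unfold thetaHat coord basisMatrix
  nth_rw 1 [← Real.mul_self_sqrt hc]
  rw [mul_assoc, Finset.mul_sum]
  congr 1
  exact Finset.sum_congr rfl fun l _ => by ring

theorem sCoef_eq (hab : a < b) (φ : Fin (gridSize n) → ℝ → ℝ) (y : ℕ → ℝ)
    (j : Fin (gridSize n)) :
    sCoef a b μ₀ n φ y j =
      varCoord (basisMatrix a b n φ) (fun l => sigmaSq a b μ₀ n (l + 1) y) j := by
  have hc : 0 ≤ (b - a) / (gridSize n : ℝ) := div_nonneg (sub_pos.mpr hab).le (Nat.cast_nonneg _)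
  unfold sCoef varCoord basisMatrix
  rw [Finset.mul_sum]
  refine Finset.sum_congr rfl fun l _ => ?_
  rw [mul_pow, Real.sq_sqrt hc]
  ring

theorem cost_eq (hab : a < b) (φ : Fin (gridSize n) → ℝ → ℝ) (δ : ℝ) (y : ℕ → ℝ)
    (w : Fin (gridSize n) → ℝ) :
    cost a b μ₀ n φ δ y w = (b - a) / gridSize n *
      (∑ j, w j ^ 2 * coord (basisMatrix a b n φ) (fun l => regObs a b μ₀ n (l + 1) y) j ^ 2 -
        2 * ∑ j, w j *
          (coord (basisMatrix a b n φ) (fun l => regObs a b μ₀ n (l + 1) y) j ^ 2 -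
            varCoord (basisMatrix a b n φ) (fun l => sigmaSq a b μ₀ n (l + 1) y) j) +
        δ * ∑ j, w j ^ 2 *
          varCoord (basisMatrix a b n φ) (fun l => sigmaSq a b μ₀ n (l + 1) y) j) := by
  have hc : 0 ≤ (b - a) / (gridSize n : ℝ) := div_nonneg (sub_pos.mpr hab).le (Nat.cast_nonneg _)
  unfold cost penalty thetaTilde
  simp_rw [thetaHat_eq hab, sCoef_eq hab, mul_pow, Real.sq_sqrt hc]
  generalize coord (basisMatrix a b n φ) (fun l => regObs a b μ₀ n (l + 1) y) = T
  generalize varCoord (basisMatrix a b n φ) (fun l => sigmaSq a b μ₀ n (l + 1) y) = s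
  generalize (b - a) / (gridSize n : ℝ) = c
  have e1 : ∑ j, w j ^ 2 * (c * T j ^ 2) = c * ∑ j, w j ^ 2 * T j ^ 2 := by
    rw [Finset.mul_sum]
    exact Finset.sum_congr rfl fun j _ => by ring
  have e2 : ∑ j, w j * (c * T j ^ 2 - c * s j) = c * ∑ j, w j * (T j ^ 2 - s j) := by
    rw [Finset.mul_sum]
    exact Finset.sum_congr rfl fun j _ => by ring
  rw [e1, e2]
  ring

theorem gridEst_of_good (hab : a < b) (φ : Fin (gridSize n) → ℝ → ℝ) {y : ℕ → ℝ}
    (hg : good a b μ₀ n y) (w : Fin (gridSize n) → ℝ) (l : Fin (gridSize n)) :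
    gridEst a b μ₀ n φ y w (l + 1) =
      ∑ j, w j * coord (basisMatrix a b n φ) (fun l => regObs a b μ₀ n (l + 1) y) j *
        basisMatrix a b n φ j l := by
  rw [gridEst, if_pos hg]
  refine Finset.sum_congr rfl fun j _ => ?_
  rw [thetaHat_eq hab, basisMatrix]
  ring

/-- The noise weights along the path. -/
noncomputable def pathWeight (a b y₀ μ₀ : ℝ) {n : ℕ} (S : ℝ → ℝ) (l : Fin (gridSize n)) (i : Fin n)
    (ξ : Fin n → ℝ) : ℝ :=
  noiseWeight a b μ₀ n (l + 1) (pathSeq a b y₀ S ξ) i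

/-- The noise in the regression for `Y_l`. -/
noncomputable def blockNoise (a b y₀ μ₀ : ℝ) {n : ℕ} (S : ℝ → ℝ) (ξ : Fin n → ℝ)
    (l : Fin (gridSize n)) : ℝ :=
  ∑ i, pathWeight a b y₀ μ₀ S l i ξ * ξ i

/-- The squared weights, summed over the window. -/
noncomputable def blockVar (a b y₀ μ₀ : ℝ) {n : ℕ} (S : ℝ → ℝ) (ξ : Fin n → ℝ)
    (l : Fin (gridSize n)) : ℝ :=
  ∑ i, pathWeight a b y₀ μ₀ S l i ξ ^ 2

/-- All windows of the procedure are long enough, with the lower bound `c₀ d`. -/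
def WindowsLong (a b μ₀ : ℝ) (n : ℕ) (c₀ : ℝ) : Prop :=
  ∀ l : Fin (gridSize n), 0 < (kTwo a b n (l + 1) : ℝ) - iotaIdx a b μ₀ n (l + 1) - 1 ∧
    c₀ * gridSize n ≤ (kTwo a b n (l + 1) : ℝ) - iotaIdx a b μ₀ n (l + 1) - 1

variable {S : ℝ → ℝ} {c₀ : ℝ}

theorem threshold_ge (hw : WindowsLong a b μ₀ n c₀) (y : ℕ → ℝ) (l : Fin (gridSize n)) :
    c₀ * gridSize n / 2 ≤ threshold a b μ₀ n (l + 1) y := by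
  have := (threshold_bounds y (hw l).1).1
  linarith [(hw l).2]

theorem blockVar_eq (hw : WindowsLong a b μ₀ n c₀) (ξ : Fin n → ℝ) (l : Fin (gridSize n)) :
    blockVar a b y₀ μ₀ S ξ l = sigmaSq a b μ₀ n (l + 1) (pathSeq a b y₀ S ξ) := by
  have h := iotaIdx_lt_of_window_pos (hw l).1
  have h2 := (threshold_bounds (pathSeq a b y₀ S ξ) (hw l).1).1
  exact sum_noiseWeight_sq (by omega) (by linarith [(hw l).1])

theorem blockVar_le (hn : 1 ≤ n) (hc₀ : 0 < c₀) (hw : WindowsLong a b μ₀ n c₀)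
    (ξ : Fin n → ℝ) (l : Fin (gridSize n)) :
    blockVar a b y₀ μ₀ S ξ l ≤ 2 / (c₀ * gridSize n) := by
  have hd := gridSize_pos hn
  rw [blockVar_eq hw, sigmaSq, ← inv_div]
  exact inv_anti₀ (by positivity) (threshold_ge hw _ l)

theorem le_blockVar (hab : a < b) (hn : 1 ≤ n) (hw : WindowsLong a b μ₀ n c₀)
    (ξ : Fin n → ℝ) (l : Fin (gridSize n)) :
    ((2 + Real.log n) * (4 * gridSize n))⁻¹ ≤ blockVar a b y₀ μ₀ S ξ l := by
  have hlog : 0 ≤ Real.log n := Real.log_natCast_nonneg n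
  obtain ⟨h1, h2⟩ := threshold_bounds (pathSeq a b y₀ S ξ) (hw l).1
  rw [blockVar_eq hw, sigmaSq]
  refine inv_anti₀ (by linarith [(hw l).1]) (h2.trans ?_)
  exact mul_le_mul_of_nonneg_left (window_le hab hn _) (by linarith)

/-- The weights are bounded, because their squares sum to `1 / H_l` on every path; this supplies all
the moments. -/
theorem adapted_pathWeight {μ : Measure ℝ} [IsProbabilityMeasure μ] (hn : 1 ≤ n) (hc₀ : 0 < c₀)
    (hw : WindowsLong a b μ₀ n c₀) (l : Fin (gridSize n)) (i : Fin n) :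
    Adapted μ i.val (pathWeight a b y₀ μ₀ S l i) := by
  have hm : Measurable (pathWeight a b y₀ μ₀ S l i) :=
    (measurable_noiseWeight i.val).comp measurable_pathSeq
  refine ⟨hm, fun ξ ξ' h => ?_, AllMoments.of_bound hm (1 + 2 / (c₀ * gridSize n)) fun ξ => ?_⟩
  · exact noiseWeight_congr fun j hj => pathSeq_congr fun k hk => h k (lt_of_lt_of_le hk hj)
  · have h1 : pathWeight a b y₀ μ₀ S l i ξ ^ 2 ≤ blockVar a b y₀ μ₀ S ξ l :=
      Finset.single_le_sum (f := fun i => pathWeight a b y₀ μ₀ S l i ξ ^ 2)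
        (fun _ _ => sq_nonneg _) (Finset.mem_univ i)
    have h2 := h1.trans (blockVar_le hn hc₀ hw ξ l)
    rw [← sq_abs] at h2
    nlinarith [sq_nonneg (|pathWeight a b y₀ μ₀ S l i ξ| - 1),
      abs_nonneg (pathWeight a b y₀ μ₀ S l i ξ)]

/-- The bias in the regression for `Y_l`. -/
noncomputable def blockBias (a b y₀ μ₀ : ℝ) {n : ℕ} (S : ℝ → ℝ) (ξ : Fin n → ℝ)
    (l : Fin (gridSize n)) : ℝ :=
  ∑ i, pathWeight a b y₀ μ₀ S l i ξ *
    (S (designPoint a b n (i.val + 1)) * pathSeq a b y₀ S ξ i.val) - S (gridPoint a b n (l + 1))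

theorem goodAt_of_good {y : ℕ → ℝ} (hg : good a b μ₀ n y) (l : Fin (gridSize n)) :
    goodAt a b μ₀ n (l + 1) y :=
  hg _ (Finset.mem_Icc.mpr ⟨by omega, l.isLt⟩)

theorem regObs_eq (hw : WindowsLong a b μ₀ n c₀) {ξ : Fin n → ℝ}
    (hg : good a b μ₀ n (pathSeq a b y₀ S ξ)) (l : Fin (gridSize n)) :
    regObs a b μ₀ n (l + 1) (pathSeq a b y₀ S ξ) =
      S (gridPoint a b n (l + 1)) + blockNoise a b y₀ μ₀ S ξ l + blockBias a b y₀ μ₀ S ξ l := by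
  rw [regObs, if_pos hg, seqEst_eq (goodAt_of_good hg l) (iotaIdx_lt_of_window_pos (hw l).1)]
  simp_rw [pathSeq_succ, mul_add, Finset.sum_add_distrib]
  unfold blockNoise blockBias pathWeight
  ring

/-- The bound for the sum of squared biases. -/
noncomputable def biasBound (a b y₀ ε L c₀ : ℝ) (m : ℕ) (t : ℝ) {n : ℕ} (ξ : Fin n → ℝ) : ℝ :=
  gridSize n * (2 * (L * bandwidth a b n) ^ 2 + 64 * (1 + L * bandwidth a b n) ^ 2 /
    (c₀ * gridSize n) ^ 2 * (y₀ ^ 4 + noiseMax m t ξ / ε ^ 4))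

theorem sum_blockBias_sq_le (hab : a < b) {ε L : ℝ} (hε : 0 < ε) (hε₁ : ε < 1) (hL : 0 ≤ L)
    (hn : 1 ≤ n) (hS : S ∈ stabilitySet a b ε L) (hc₀ : 0 < c₀) (hw : WindowsLong a b μ₀ n c₀)
    {m : ℕ} {t : ℝ} (hm : 1 ≤ m) (ht : 0 < t) {ξ : Fin n → ℝ}
    (hg : good a b μ₀ n (pathSeq a b y₀ S ξ)) :
    ∑ l, blockBias a b y₀ μ₀ S ξ l ^ 2 ≤ biasBound a b y₀ ε L c₀ m t ξ := by
  have hd := gridSize_pos hn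
  have hh : 0 ≤ bandwidth a b n := by
    have := (sub_pos.mpr hab).le
    unfold bandwidth
    positivity
  obtain ⟨Y, hY1, hY2⟩ := exists_path_bound (y₀ := y₀) hab hε hε₁ hS.2.1 hn ht hm ξ
  set r := L * bandwidth a b n with hr
  have hr0 : 0 ≤ r := mul_nonneg hL hh
  have key : ∀ l, blockBias a b y₀ μ₀ S ξ l ^ 2 ≤ 2 * r ^ 2 + 64 * (1 + r) ^ 2 /
      (c₀ * gridSize n) ^ 2 * (y₀ ^ 4 + noiseMax m t ξ / ε ^ 4) := by
    intro l
    have hz := gridPoint_mem hab hn (Nat.succ_le_of_lt l.isLt)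
    have h1 := abs_bias_le (goodAt_of_good hg l) (iotaIdx_lt_of_window_pos (hw l).1)
      (f := fun k => S (designPoint a b n k)) (z := S (gridPoint a b n (l + 1))) (r := r) (Y := Y)
      ((hS.2.1 _ hz).trans (by linarith)) hr0
      (fun k hk hQ => by
        refine (abs_sub_le_of_mem_stabilitySet hS
          (designPoint_mem hab (Finset.mem_Icc.mp hk).2) hz).trans ?_
        exact mul_le_mul_of_nonneg_left (abs_sub_le_of_kernelWeight hab hn hQ) hL) hY1
    have hH := threshold_ge hw (pathSeq a b y₀ S ξ) l
    have hH0 : 0 < c₀ * gridSize n / 2 := by positivity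
    have h2 : Y ^ 2 / threshold a b μ₀ n (l + 1) (pathSeq a b y₀ S ξ) ≤
        Y ^ 2 / (c₀ * gridSize n / 2) := by gcongr
    have h3 : |blockBias a b y₀ μ₀ S ξ l| ≤ r + (1 + r) * (Y ^ 2 / (c₀ * gridSize n / 2)) :=
      h1.trans (by gcongr)
    have h4 : blockBias a b y₀ μ₀ S ξ l ^ 2 ≤
        (r + (1 + r) * (Y ^ 2 / (c₀ * gridSize n / 2))) ^ 2 := by
      rw [← sq_abs]
      exact pow_le_pow_left₀ (abs_nonneg _) h3 2
    refine h4.trans ((add_sq_le).trans ?_)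
    have e : 2 * (r ^ 2 + ((1 + r) * (Y ^ 2 / (c₀ * gridSize n / 2))) ^ 2) =
        2 * r ^ 2 + 8 * (1 + r) ^ 2 / (c₀ * gridSize n) ^ 2 * Y ^ 4 := by
      field_simp
      ring
    rw [e]
    have h5 : 8 * (1 + r) ^ 2 / (c₀ * gridSize n) ^ 2 * Y ^ 4 ≤
        8 * (1 + r) ^ 2 / (c₀ * gridSize n) ^ 2 * (8 * (y₀ ^ 4 + noiseMax m t ξ / ε ^ 4)) :=
      mul_le_mul_of_nonneg_left hY2 (by positivity)
    refine (add_le_add_right h5 _).trans (le_of_eq ?_)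
    ring
  refine (Finset.sum_le_card_nsmul _ _ _ fun l _ => key l).trans (le_of_eq ?_)
  rw [Finset.card_univ, Fintype.card_fin, nsmul_eq_mul, biasBound]

/-- The remainder in the oracle inequality, before multiplication by `1 / δ`. -/
noncomputable def remainder (a b y₀ μ₀ ε L c₀ : ℝ) (m : ℕ) (t : ℝ) {n : ℕ}
    (φ : Fin (gridSize n) → ℝ → ℝ) (X : Finset (Fin (gridSize n) → ℝ)) (S : ℝ → ℝ)
    (ξ : Fin n → ℝ) : ℝ :=
  65 * ((b - a) / gridSize n * (linSup X (basisMatrix a b n φ)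
      (fun l => S (gridPoint a b n (l + 1))) (blockNoise a b y₀ μ₀ S ξ) +
    quadSup X (basisMatrix a b n φ) (blockNoise a b y₀ μ₀ S ξ) (blockVar a b y₀ μ₀ S ξ)
      ((2 + Real.log n) * (4 * gridSize n))⁻¹ +
    biasBound a b y₀ ε L c₀ m t ξ)) +
  5 * (L ^ 2 * ((b - a) / gridSize n) ^ 2 * (b - a))

theorem oracle_const_bounds {δ : ℝ} (hδ : 0 < δ) (hδ' : δ ≤ 1 / 12) :
    1 ≤ (1 + 4 * δ) / (1 - 6 * δ) ∧ (1 + 4 * δ) / (1 - 6 * δ) ≤ 8 / 3 := by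
  have h : 0 < 1 - 6 * δ := by linarith
  rw [le_div_iff₀ h, div_le_iff₀ h]
  constructor <;> linarith

/-- Combination of the empirical oracle inequality with the comparison of the norms. -/
theorem combine_bounds {δ κ Q K E E₀ : ℝ} {I I₀ : ℝ≥0∞} (hδ : 0 < δ) (hδ' : δ ≤ 1 / 12)
    (hκ : 1 ≤ κ) (hκ' : κ ≤ 8 / 3) (hQ : 0 ≤ Q) (hK : 0 ≤ K) (hE₀ : 0 ≤ E₀)
    (h1 : I ≤ ENNReal.ofReal ((1 + δ) * E + (1 + 1 / δ) * K))
    (h2 : E ≤ κ * E₀ + 60 / δ * Q)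
    (h3 : ENNReal.ofReal E₀ ≤ ENNReal.ofReal (1 + δ) * I₀ + ENNReal.ofReal ((1 + 1 / δ) * K)) :
    I ≤ ENNReal.ofReal (κ * (1 + δ) ^ 2) * I₀ + ENNReal.ofReal ((65 * Q + 5 * K) / δ) := by
  have hu : 1 / δ = δ⁻¹ := one_div δ
  have hu1 : δ * δ⁻¹ = 1 := mul_inv_cancel₀ hδ.ne'
  have hu0 : 0 < δ⁻¹ := inv_pos.mpr hδ
  have hu2 : 1 ≤ δ⁻¹ / 12 := by nlinarith
  have hδ1 : (1 + 1 / δ) * K ≤ 13 / 12 * (K * δ⁻¹) := by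
    rw [hu]
    nlinarith
  have hKu : 0 ≤ K * δ⁻¹ := by positivity
  have hQu : 0 ≤ Q * δ⁻¹ := by positivity
  -- Here `65 = 60 · 13/12`. In total `K / δ` carries `13/12 · (1 + 26/9)`, which is below `5`.
  have b1 : (1 + δ) * E + (1 + 1 / δ) * K ≤
      (κ * (1 + δ)) * E₀ + (65 * (Q * δ⁻¹) + 13 / 12 * (K * δ⁻¹)) := by
    have h4 : (1 + δ) * E ≤ (1 + δ) * (κ * E₀ + 60 / δ * Q) :=
      mul_le_mul_of_nonneg_left h2 (by linarith)
    have h5 : (1 + δ) * (60 / δ * Q) ≤ 65 * (Q * δ⁻¹) := by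
      rw [div_eq_mul_inv]
      nlinarith
    linarith
  have b2 : κ * (1 + δ) * ((1 + 1 / δ) * K) ≤ 26 / 9 * (13 / 12 * (K * δ⁻¹)) := by
    have h6 : κ * (1 + δ) ≤ 26 / 9 := by nlinarith
    exact mul_le_mul h6 hδ1 (by positivity) (by norm_num)
  have hκδ : 0 ≤ κ * (1 + δ) := by positivity
  calc I ≤ ENNReal.ofReal ((κ * (1 + δ)) * E₀ + (65 * (Q * δ⁻¹) + 13 / 12 * (K * δ⁻¹))) :=
        h1.trans (ENNReal.ofReal_le_ofReal b1)
    _ = ENNReal.ofReal (κ * (1 + δ)) * ENNReal.ofReal E₀ +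
          ENNReal.ofReal (65 * (Q * δ⁻¹) + 13 / 12 * (K * δ⁻¹)) := by
        rw [ENNReal.ofReal_add (by positivity) (by positivity), ENNReal.ofReal_mul hκδ]
    _ ≤ ENNReal.ofReal (κ * (1 + δ)) * (ENNReal.ofReal (1 + δ) * I₀ +
          ENNReal.ofReal ((1 + 1 / δ) * K)) +
          ENNReal.ofReal (65 * (Q * δ⁻¹) + 13 / 12 * (K * δ⁻¹)) := by gcongr
    _ = ENNReal.ofReal (κ * (1 + δ) ^ 2) * I₀ +
          ENNReal.ofReal (κ * (1 + δ) * ((1 + 1 / δ) * K) +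
            (65 * (Q * δ⁻¹) + 13 / 12 * (K * δ⁻¹))) := by
        rw [mul_add, ← mul_assoc, ← ENNReal.ofReal_mul hκδ, ← ENNReal.ofReal_mul hκδ, add_assoc,
          ← ENNReal.ofReal_add (by positivity) (by positivity)]
        congr 3
        ring
    _ ≤ _ := by
        have e : (65 * Q + 5 * K) / δ = 65 * (Q * δ⁻¹) + 5 * (K * δ⁻¹) := by ring
        rw [e]
        refine add_le_add le_rfl (ENNReal.ofReal_le_ofReal ?_)
        linarith

theorem stepEst_eq (φ : Fin (gridSize n) → ℝ → ℝ) (y : ℕ → ℝ) (w : Fin (gridSize n) → ℝ) :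
    stepEst a b μ₀ n φ y w = stepFun a b n fun l => gridEst a b μ₀ n φ y w l := rfl

theorem remainder_nonneg (hab : a < b) {ε L : ℝ} {m : ℕ} {t : ℝ} (ht : 0 < t)
    (φ : Fin (gridSize n) → ℝ → ℝ) (X : Finset (Fin (gridSize n) → ℝ)) (ξ : Fin n → ℝ) :
    0 ≤ remainder a b y₀ μ₀ ε L c₀ m t φ X S ξ := by
  have h := sub_pos.mpr hab
  have hlog : 0 ≤ Real.log n := Real.log_natCast_nonneg n
  have h1 := linSup_nonneg (O := basisMatrix a b n φ) X (fun l => S (gridPoint a b n (l + 1)))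
    (blockNoise a b y₀ μ₀ S ξ)
  have h2 := quadSup_nonneg (O := basisMatrix a b n φ) X (blockNoise a b y₀ μ₀ S ξ)
    (blockVar a b y₀ μ₀ S ξ)
    (ρ := ((2 + Real.log n) * (4 * gridSize n))⁻¹) (by positivity)
  have h3 : 0 ≤ biasBound a b y₀ ε L c₀ m t ξ := by
    have := noiseMax_nonneg (m := m) ht ξ
    have h4 : 0 ≤ ε ^ 4 := by positivity
    have h5 : 0 ≤ noiseMax m t ξ / ε ^ 4 := div_nonneg this h4
    unfold biasBound
    positivity
  unfold remainder
  positivity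

/-- The oracle inequality for the integrated errors on every path. -/
theorem pathwise_oracle (hab : a < b) {ε L : ℝ} (hε : 0 < ε) (hε₁ : ε < 1) (hL : 0 ≤ L)
    (hn : 1 ≤ n) (hS : S ∈ stabilitySet a b ε L) (hc₀ : 0 < c₀) (hw : WindowsLong a b μ₀ n c₀)
    {φ : Fin (gridSize n) → ℝ → ℝ} (hφ : EmpOrthonormal a b n φ)
    {Λ : Finset (Fin (gridSize n) → ℝ)} (hΛ : ∀ w ∈ Λ, ∀ j, w j ∈ Icc (0 : ℝ) 1)
    {w w₀ : Fin (gridSize n) → ℝ} (hwΛ : w ∈ Λ) (hw₀ : w₀ ∈ Λ) {δ : ℝ} (hδ : 0 < δ)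
    (hδ' : δ ≤ 1 / 12) {m : ℕ} {t : ℝ} (hm : 1 ≤ m) (ht : 0 < t) (ξ : Fin n → ℝ)
    (hJ : cost a b μ₀ n φ δ (pathSeq a b y₀ S ξ) w ≤ cost a b μ₀ n φ δ (pathSeq a b y₀ S ξ) w₀) :
    intErr a b (stepEst a b μ₀ n φ (pathSeq a b y₀ S ξ) w) S ≤
      ENNReal.ofReal ((1 + 4 * δ) / (1 - 6 * δ) * (1 + δ) ^ 2) *
        intErr a b (stepEst a b μ₀ n φ (pathSeq a b y₀ S ξ) w₀) S +
      ENNReal.ofReal (remainder a b y₀ μ₀ ε L c₀ m t φ (comparisonSet Λ w₀) S ξ / δ) := by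
  obtain ⟨hκ, hκ'⟩ := oracle_const_bounds hδ hδ'
  have hba := sub_pos.mpr hab
  have hd := gridSize_pos hn
  have hc : 0 < (b - a) / (gridSize n : ℝ) := div_pos hba hd
  set y := pathSeq a b y₀ S ξ with hy
  by_cases hg : good a b μ₀ n y
  · have hO := basisMatrix_orthonormal hab hφ
    rw [cost_eq hab, cost_eq hab] at hJ
    have hJ' := le_of_mul_le_mul_left hJ hc
    have hlog : 0 ≤ Real.log n := Real.log_natCast_nonneg n
    have hv : (fun l : Fin (gridSize n) => sigmaSq a b μ₀ n (l + 1) y) =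
        blockVar a b y₀ μ₀ S ξ := funext fun l => (blockVar_eq hw ξ l).symm
    rw [hv] at hJ'
    have h2 := oracle_inequality_coord hO hΛ hwΛ hw₀ (f := fun l => S (gridPoint a b n (l + 1)))
      (e := blockNoise a b y₀ μ₀ S ξ) (g := blockBias a b y₀ μ₀ S ξ)
      (fun l => regObs_eq hw hg l) (ρ := ((2 + Real.log n) * (4 * gridSize n))⁻¹) (by positivity)
      (le_blockVar hab hn hw ξ) hδ hδ' hJ'
    have hG := fun u => gridEst_of_good hab φ hg u
    simp_rw [← hy, ← hG] at h2
    have hB := sum_blockBias_sq_le hab hε hε₁ hL hn hS hc₀ hw hm ht hg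
    have u1 := intErr_stepFun_le hab hn hL hS hδ fun l => gridEst a b μ₀ n φ y w l
    have u2 := ofReal_empErr_le hab hn hL hS hδ fun l => gridEst a b μ₀ n φ y w₀ l
    set Z1 := linSup (comparisonSet Λ w₀) (basisMatrix a b n φ)
      (fun l => S (gridPoint a b n (l + 1))) (blockNoise a b y₀ μ₀ S ξ) with hZ1
    set Z2 := quadSup (comparisonSet Λ w₀) (basisMatrix a b n φ) (blockNoise a b y₀ μ₀ S ξ)
      (blockVar a b y₀ μ₀ S ξ) ((2 + Real.log n) * (4 * gridSize n))⁻¹ with hZ2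
    have hZ10 : 0 ≤ Z1 := linSup_nonneg _ _ _
    have hZ20 : 0 ≤ Z2 := quadSup_nonneg _ _ _ (by positivity)
    have hB0 : 0 ≤ ∑ l, blockBias a b y₀ μ₀ S ξ l ^ 2 := Finset.sum_nonneg fun _ _ => sq_nonneg _
    have hB1 : 0 ≤ biasBound a b y₀ ε L c₀ m t ξ := hB0.trans hB
    refine combine_bounds (Q := (b - a) / gridSize n *
      (Z1 + Z2 + biasBound a b y₀ ε L c₀ m t ξ)) hδ hδ' hκ hκ' (by positivity) (by positivity)
      (by positivity) u1 ?_ u2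
    calc (b - a) / gridSize n * ∑ l : Fin (gridSize n),
          (gridEst a b μ₀ n φ y w (l + 1) - S (gridPoint a b n (l + 1))) ^ 2
        ≤ (b - a) / gridSize n * ((1 + 4 * δ) / (1 - 6 * δ) * ∑ l : Fin (gridSize n),
          (gridEst a b μ₀ n φ y w₀ (l + 1) - S (gridPoint a b n (l + 1))) ^ 2 +
          60 / δ * (Z1 + Z2 + biasBound a b y₀ ε L c₀ m t ξ)) := by
          refine mul_le_mul_of_nonneg_left (h2.trans ?_) hc.le
          gcongr
      _ = _ := by ring
  -- Off `good` both estimators are zero, and the leading constant is at least one.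
  · have e : stepEst a b μ₀ n φ y w = stepEst a b μ₀ n φ y w₀ := by
      rw [stepEst_eq, stepEst_eq]
      simp only [gridEst, if_neg hg]
    rw [e]
    refine le_add_right (le_mul_of_one_le_left zero_le ?_)
    rw [ENNReal.one_le_ofReal]
    nlinarith [sq_nonneg δ]

theorem measurable_pathWeight (l : Fin (gridSize n)) (i : Fin n) :
    Measurable (pathWeight a b y₀ μ₀ S l i) :=
  (measurable_noiseWeight i.val).comp measurable_pathSeq

theorem measurable_remainder {ε L : ℝ} {m : ℕ} {t : ℝ}
    (φ : Fin (gridSize n) → ℝ → ℝ) (X : Finset (Fin (gridSize n) → ℝ)) :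
    Measurable fun ξ : Fin n → ℝ => remainder a b y₀ μ₀ ε L c₀ m t φ X S ξ := by
  have h1 : ∀ l, Measurable fun ξ : Fin n → ℝ => blockNoise a b y₀ μ₀ S ξ l := fun l =>
    Finset.measurable_fun_sum _ fun i _ => (measurable_pathWeight l i).mul (measurable_pi_apply i)
  have h2 : ∀ l, Measurable fun ξ : Fin n → ℝ => blockVar a b y₀ μ₀ S ξ l := fun l =>
    Finset.measurable_fun_sum _ fun i _ => (measurable_pathWeight l i).pow_const 2
  unfold remainder linSup quadSup linStat quadStat varCoord coord biasBound noiseMax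
  fun_prop

theorem integrable_noiseMax {μ : Measure ℝ} (hμ : IsNoise μ) (m : ℕ) (t : ℝ) :
    Integrable (noiseMax m t) (Measure.pi fun _ : Fin n => μ) :=
  (allMoments_noiseMax hμ m t).integrable

/-- The rate of the remainder. -/
noncomputable def rate (a b y₀ ε L c₀ ς ν : ℝ) (n m : ℕ) : ℝ :=
  260 * (b - a) * ((2 * ν + 2) * (2 / c₀) +
    (2 * ν + 2) * ((8 + 6 * ς ^ 2) * (16 * (2 + Real.log n) / c₀ ^ 2)) +
    (L ^ 2 * (b - a) ^ 2 / 2 + 64 * (1 + L * (b - a)) ^ 2 / c₀ ^ 2 *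
      (y₀ ^ 4 + 64 * m ^ 2 * ς ^ 2 / ε ^ 4))) + 20 * (L ^ 2 * (b - a) ^ 3)

theorem integral_biasBound_le (hab : a < b) {ε L ς : ℝ} (hε : 0 < ε) (hL : 0 ≤ L)
    (hn : 1 ≤ n) (hc₀ : 0 < c₀) {p : ℝ → ℝ} (hς : 1 ≤ ς) (hp : p ∈ densityClass ς)
    {m : ℕ} (hm : 1 ≤ m) (hmn : (n : ℝ) ≤ 3 ^ (m - 1)) :
    Integrable (fun ξ : Fin n → ℝ => biasBound a b y₀ ε L c₀ m (3 * (16 * m ^ 2 * ς ^ 2)) ξ)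
      (Measure.pi fun _ : Fin n => noiseLaw p) ∧
    ∫ ξ : Fin n → ℝ, biasBound a b y₀ ε L c₀ m (3 * (16 * m ^ 2 * ς ^ 2)) ξ
      ∂(Measure.pi fun _ : Fin n => noiseLaw p) ≤
    (L ^ 2 * (b - a) ^ 2 / 2 + 64 * (1 + L * (b - a)) ^ 2 / c₀ ^ 2 *
      (y₀ ^ 4 + 64 * m ^ 2 * ς ^ 2 / ε ^ 4)) / gridSize n := by
  have hμ := isNoise_noiseLaw hp
  have := hμ.prob
  have hba := sub_pos.mpr hab
  have hd := gridSize_pos hn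
  have hd1 : (1 : ℝ) ≤ gridSize n := by exact_mod_cast Nat.sqrt_pos.mpr hn
  have hI := integrable_noiseMax (n := n) hμ m (3 * (16 * m ^ 2 * ς ^ 2))
  have hM := integral_noiseMax_le hς hp hm hmn
  set t : ℝ := 3 * (16 * m ^ 2 * ς ^ 2) with ht
  set P := Measure.pi fun _ : Fin n => noiseLaw p with hP
  set r := L * bandwidth a b n with hr
  have hr1 : r = L * (b - a) / (2 * gridSize n) := by rw [hr, bandwidth, mul_div_assoc]
  have i1 : Integrable (fun ξ : Fin n → ℝ => y₀ ^ 4 + noiseMax m t ξ / ε ^ 4) P :=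
    (integrable_const _).add (hI.div_const _)
  have i2 : Integrable (fun ξ : Fin n → ℝ => 64 * (1 + r) ^ 2 /
      (c₀ * gridSize n) ^ 2 * (y₀ ^ 4 + noiseMax m t ξ / ε ^ 4)) P := i1.const_mul _
  refine ⟨((integrable_const _).add i2).const_mul _, ?_⟩
  have j1 : ∫ ξ : Fin n → ℝ, (y₀ ^ 4 + noiseMax m t ξ / ε ^ 4) ∂P =
      y₀ ^ 4 + (∫ ξ, noiseMax m t ξ ∂P) / ε ^ 4 := by
    rw [integral_add (integrable_const _) (hI.div_const _), integral_div]
    simp [hP]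
  have j2 : ∫ ξ : Fin n → ℝ, (2 * r ^ 2 + 64 * (1 + r) ^ 2 /
      (c₀ * gridSize n) ^ 2 * (y₀ ^ 4 + noiseMax m t ξ / ε ^ 4)) ∂P =
      2 * r ^ 2 + 64 * (1 + r) ^ 2 / (c₀ * gridSize n) ^ 2 *
        (y₀ ^ 4 + (∫ ξ, noiseMax m t ξ ∂P) / ε ^ 4) := by
    rw [integral_add (integrable_const _) i2, integral_const, integral_const_mul, j1]
    simp [hP]
  have j3 : ∫ ξ : Fin n → ℝ, biasBound a b y₀ ε L c₀ m t ξ ∂P = gridSize n * (2 * r ^ 2 +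
      64 * (1 + r) ^ 2 / (c₀ * gridSize n) ^ 2 *
        (y₀ ^ 4 + (∫ ξ, noiseMax m t ξ ∂P) / ε ^ 4)) := by
    rw [← j2, ← integral_const_mul]
    rfl
  rw [j3]
  have h1 : (∫ ξ, noiseMax m t ξ ∂P) / ε ^ 4 ≤ 64 * m ^ 2 * ς ^ 2 / ε ^ 4 := by gcongr
  have hI0 : 0 ≤ ∫ ξ, noiseMax m t ξ ∂P :=
    integral_nonneg fun ξ => noiseMax_nonneg (by positivity) ξ
  have h2 : r ≤ L * (b - a) := by
    rw [hr1]
    exact div_le_self (by positivity) (by linarith)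
  have hr0 : 0 ≤ r := by rw [hr1]; positivity
  calc (gridSize n : ℝ) * (2 * r ^ 2 + 64 * (1 + r) ^ 2 / (c₀ * gridSize n) ^ 2 *
        (y₀ ^ 4 + (∫ ξ, noiseMax m t ξ ∂P) / ε ^ 4))
      ≤ (gridSize n : ℝ) * (2 * r ^ 2 + 64 * (1 + L * (b - a)) ^ 2 / (c₀ * gridSize n) ^ 2 *
        (y₀ ^ 4 + 64 * m ^ 2 * ς ^ 2 / ε ^ 4)) := by
        gcongr
    _ = _ := by
        rw [hr1]
        field_simp

theorem integral_remainder_le (hab : a < b) {ε L ς : ℝ} (hε : 0 < ε) (hL : 0 ≤ L)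
    (hn : 1 ≤ n) (hc₀ : 0 < c₀) (hw : WindowsLong a b μ₀ n c₀)
    {φ : Fin (gridSize n) → ℝ → ℝ} (hφ : EmpOrthonormal a b n φ)
    {X : Finset (Fin (gridSize n) → ℝ)} {ν : ℝ} (hX : (X.card : ℝ) ≤ 2 * ν + 2)
    {p : ℝ → ℝ} (hς : 1 ≤ ς) (hp : p ∈ densityClass ς)
    {m : ℕ} (hm : 1 ≤ m) (hmn : (n : ℝ) ≤ 3 ^ (m - 1)) :
    Integrable (fun ξ : Fin n → ℝ =>
      remainder a b y₀ μ₀ ε L c₀ m (3 * (16 * m ^ 2 * ς ^ 2)) φ X S ξ)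
      (Measure.pi fun _ : Fin n => noiseLaw p) ∧
    ∫ ξ : Fin n → ℝ, remainder a b y₀ μ₀ ε L c₀ m (3 * (16 * m ^ 2 * ς ^ 2)) φ X S ξ
      ∂(Measure.pi fun _ : Fin n => noiseLaw p) ≤ rate a b y₀ ε L c₀ ς ν n m / n := by
  have hμ := isNoise_noiseLaw hp
  have := hμ.prob
  have hba := sub_pos.mpr hab
  have hd := gridSize_pos hn
  have hn0 : (0 : ℝ) < n := by exact_mod_cast hn
  have hlog : 0 ≤ Real.log n := Real.log_natCast_nonneg n
  obtain ⟨i3, h3⟩ := integral_biasBound_le (y₀ := y₀) hab hε hL hn hc₀ hς hp hm hmn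
  set t : ℝ := 3 * (16 * m ^ 2 * ς ^ 2) with ht
  set P := Measure.pi fun _ : Fin n => noiseLaw p with hP
  have hv : ∀ (l : Fin (gridSize n)) (i : Fin n),
      Adapted (noiseLaw p) i.val (pathWeight a b y₀ μ₀ S l i) :=
    fun l i => adapted_pathWeight hn hc₀ hw l i
  have hO := basisMatrix_orthonormal hab hφ
  have hdis : ∀ (l l' : Fin (gridSize n)) (i : Fin n) ξ, l ≠ l' →
      pathWeight a b y₀ μ₀ S l i ξ * pathWeight a b y₀ μ₀ S l' i ξ = 0 := fun l l' i ξ hl =>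
    noiseWeight_disjoint hab (fun h => hl (Fin.ext (by omega))) _ _
  have hs : ∀ (l : Fin (gridSize n)) ξ, ∑ i, pathWeight a b y₀ μ₀ S l i ξ ^ 2 ≤
      2 / (c₀ * gridSize n) := fun l ξ => blockVar_le hn hc₀ hw ξ l
  set ρ : ℝ := ((2 + Real.log n) * (4 * gridSize n))⁻¹ with hρ
  have hρ0 : 0 < ρ := by positivity
  set f : Fin (gridSize n) → ℝ := fun l => S (gridPoint a b n (l + 1)) with hf
  have i1 : Integrable (fun ξ => linSup X (basisMatrix a b n φ) f (blockNoise a b y₀ μ₀ S ξ)) P :=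
    integrable_linSup hμ hv X f
  have i2 : Integrable (fun ξ => quadSup X (basisMatrix a b n φ) (blockNoise a b y₀ μ₀ S ξ)
      (blockVar a b y₀ μ₀ S ξ) ρ) P := integrable_quadSup hμ hv X ρ
  have h1 : ∫ ξ, linSup X (basisMatrix a b n φ) f (blockNoise a b y₀ μ₀ S ξ) ∂P ≤
      X.card * (2 / (c₀ * gridSize n)) :=
    integral_linSup_le hμ hv hO hdis hs (by positivity) X f
  have h2 : ∫ ξ, quadSup X (basisMatrix a b n φ) (blockNoise a b y₀ μ₀ S ξ)
      (blockVar a b y₀ μ₀ S ξ) ρ ∂P ≤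
      X.card * ((8 + 2 * (3 * ς ^ 2)) * (2 / (c₀ * gridSize n)) ^ 2 / ρ) :=
    integral_quadSup_le hμ hv hO hdis hs (by positivity) X hρ0 (integral_pow_four_le hp)
      (by positivity)
  have i12 : Integrable (fun ξ => linSup X (basisMatrix a b n φ) f (blockNoise a b y₀ μ₀ S ξ) +
      quadSup X (basisMatrix a b n φ) (blockNoise a b y₀ μ₀ S ξ) (blockVar a b y₀ μ₀ S ξ) ρ) P :=
    i1.add i2
  have i4 : Integrable (fun ξ => linSup X (basisMatrix a b n φ) f (blockNoise a b y₀ μ₀ S ξ) +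
      quadSup X (basisMatrix a b n φ) (blockNoise a b y₀ μ₀ S ξ) (blockVar a b y₀ μ₀ S ξ) ρ +
      biasBound a b y₀ ε L c₀ m t ξ) P := i12.add i3
  refine ⟨((i4.const_mul _).const_mul _).add (integrable_const _), ?_⟩
  have e : ∫ ξ : Fin n → ℝ, remainder a b y₀ μ₀ ε L c₀ m t φ X S ξ ∂P =
      65 * ((b - a) / gridSize n *
        (∫ ξ, linSup X (basisMatrix a b n φ) f (blockNoise a b y₀ μ₀ S ξ) ∂P +
        ∫ ξ, quadSup X (basisMatrix a b n φ) (blockNoise a b y₀ μ₀ S ξ)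
          (blockVar a b y₀ μ₀ S ξ) ρ ∂P +
        ∫ ξ, biasBound a b y₀ ε L c₀ m t ξ ∂P)) +
      5 * (L ^ 2 * ((b - a) / gridSize n) ^ 2 * (b - a)) := by
    rw [← integral_add i1 i2, ← integral_add i12 i3, ← integral_const_mul,
      ← integral_const_mul]
    unfold remainder
    rw [integral_add ((i4.const_mul _).const_mul _) (integrable_const _)]
    simp only [integral_const, probReal_univ, smul_eq_mul, one_mul]
  rw [e]
  set Br : ℝ := (2 * ν + 2) * (2 / c₀) +
    (2 * ν + 2) * ((8 + 6 * ς ^ 2) * (16 * (2 + Real.log n) / c₀ ^ 2)) +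
    (L ^ 2 * (b - a) ^ 2 / 2 + 64 * (1 + L * (b - a)) ^ 2 / c₀ ^ 2 *
      (y₀ ^ 4 + 64 * m ^ 2 * ς ^ 2 / ε ^ 4)) with hBr
  have hν : 0 ≤ 2 * ν + 2 := (Nat.cast_nonneg _).trans hX
  have hBr0 : 0 ≤ Br := by positivity
  have h1' := h1.trans (mul_le_mul_of_nonneg_right hX (by positivity))
  have h2' := h2.trans (mul_le_mul_of_nonneg_right hX (by positivity))
  have hsum : (∫ ξ, linSup X (basisMatrix a b n φ) f (blockNoise a b y₀ μ₀ S ξ) ∂P +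
        ∫ ξ, quadSup X (basisMatrix a b n φ) (blockNoise a b y₀ μ₀ S ξ)
          (blockVar a b y₀ μ₀ S ξ) ρ ∂P +
        ∫ ξ, biasBound a b y₀ ε L c₀ m t ξ ∂P) ≤ Br / gridSize n := by
    refine (add_le_add (add_le_add h1' h2') h3).trans (le_of_eq ?_)
    rw [hBr, hρ]
    field_simp
    ring
  -- This turns the constants `65` and `5` into the `260` and `20` of `rate`.
  have hq : 1 / (gridSize n : ℝ) ^ 2 ≤ 4 / n := by
    rw [div_le_div_iff₀ (by positivity) hn0, one_mul]
    exact le_four_mul_sq_gridSize hn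
  calc _ ≤ 65 * ((b - a) / gridSize n * (Br / gridSize n)) +
        5 * (L ^ 2 * ((b - a) / gridSize n) ^ 2 * (b - a)) := by gcongr
    _ = (65 * (b - a) * Br + 5 * (L ^ 2 * (b - a) ^ 3)) * (1 / (gridSize n : ℝ) ^ 2) := by
        field_simp
    _ ≤ (65 * (b - a) * Br + 5 * (L ^ 2 * (b - a) ^ 3)) * (4 / n) := by gcongr
    _ = _ := by
        rw [rate, ← hBr]
        ring

end Selection

end SeqAR

namespace SeqAR

/-! Sequences of slower than polynomial growth. -/

namespace SubPoly

variable {f g : ℕ → ℝ}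

theorem const (c : ℝ) : SubPoly fun _ => c := fun _ hr =>
  tendsto_const_nhds.div_atTop ((tendsto_rpow_atTop hr).comp tendsto_natCast_atTop_atTop)

theorem add (hf : SubPoly f) (hg : SubPoly g) : SubPoly fun n => f n + g n := fun r hr => by
  simpa only [add_div, add_zero] using (hf r hr).add (hg r hr)

theorem mul (hf : SubPoly f) (hg : SubPoly g) : SubPoly fun n => f n * g n := fun r hr => by
  have h := (hf (r / 2) (half_pos hr)).mul (hg (r / 2) (half_pos hr))
  rw [mul_zero] at h
  refine h.congr fun n => ?_
  rw [div_mul_div_comm, ← Real.rpow_add_of_nonneg (Nat.cast_nonneg _) (half_pos hr).le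
    (half_pos hr).le, add_halves]

theorem sq (hf : SubPoly f) : SubPoly fun n => f n ^ 2 := by
  simpa only [pow_two] using hf.mul hf

theorem div_const (hf : SubPoly f) (c : ℝ) : SubPoly fun n => f n / c := by
  simpa only [div_eq_mul_inv] using hf.mul (const c⁻¹)

theorem mono (hg : SubPoly g) (h0 : ∀ n, 0 ≤ f n) (h : ∀ n, f n ≤ g n) : SubPoly f := fun r hr =>
  squeeze_zero (fun n => div_nonneg (h0 n) (Real.rpow_nonneg (Nat.cast_nonneg _) _))
    (fun n => div_le_div_of_nonneg_right (h n) (Real.rpow_nonneg (Nat.cast_nonneg _) _)) (hg r hr)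

theorem log : SubPoly fun n => Real.log n := fun _ hr =>
  (isLittleO_log_rpow_atTop hr).tendsto_div_nhds_zero.comp tendsto_natCast_atTop_atTop

end SubPoly

/-- The logarithmic exponent of the moments. -/
noncomputable def momentExponent (n : ℕ) : ℕ := ⌈Real.log n⌉₊ + 1

theorem subPoly_momentExponent : SubPoly fun n => (momentExponent n : ℝ) := by
  refine SubPoly.mono (SubPoly.log.add (SubPoly.const 2)) (fun n => Nat.cast_nonneg _) fun n => ?_
  have := (Nat.ceil_lt_add_one (Real.log_natCast_nonneg n)).le
  unfold momentExponent
  push_cast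
  linarith

/-- Because `e ≤ 3`, a moment order of about `log n` already satisfies the condition of
`integral_noiseMax_le`. -/
theorem le_three_pow_momentExponent {n : ℕ} (hn : 1 ≤ n) :
    (n : ℝ) ≤ 3 ^ (momentExponent n - 1) := by
  have hn0 : (0 : ℝ) < n := by exact_mod_cast hn
  rw [momentExponent, Nat.add_sub_cancel]
  calc (n : ℝ) = Real.exp (Real.log n) := (Real.exp_log hn0).symm
    _ ≤ Real.exp (⌈Real.log n⌉₊ : ℝ) := Real.exp_le_exp.mpr (Nat.le_ceil _)
    _ = Real.exp 1 ^ ⌈Real.log n⌉₊ := by rw [← Real.exp_nat_mul, mul_one]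
    _ ≤ 3 ^ ⌈Real.log n⌉₊ := by
        gcongr
        linarith [Real.exp_one_lt_d9]

theorem subPoly_rate (a b y₀ ε L c₀ : ℝ) {ς ν : ℕ → ℝ} {m : ℕ → ℕ} (hς : SubPoly ς)
    (hν : SubPoly ν) (hm : SubPoly fun n => (m n : ℝ)) :
    SubPoly fun n => rate a b y₀ ε L c₀ (ς n) (ν n) n (m n) := by
  have h1 : SubPoly fun n => 2 * ν n + 2 := ((SubPoly.const 2).mul hν).add (SubPoly.const 2)
  have h2 : SubPoly fun n => 8 + 6 * ς n ^ 2 :=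
    (SubPoly.const 8).add ((SubPoly.const 6).mul hς.sq)
  have h3 : SubPoly fun n => 16 * (2 + Real.log n) / c₀ ^ 2 :=
    ((SubPoly.const 16).mul ((SubPoly.const 2).add SubPoly.log)).div_const _
  have h4 : SubPoly fun n => y₀ ^ 4 + 64 * (m n : ℝ) ^ 2 * ς n ^ 2 / ε ^ 4 :=
    (SubPoly.const _).add ((((SubPoly.const 64).mul hm.sq).mul hς.sq).div_const _)
  exact ((SubPoly.const _).mul (((h1.mul (SubPoly.const _)).add (h1.mul (h2.mul h3))).add
    ((SubPoly.const _).add ((SubPoly.const _).mul h4)))).add (SubPoly.const _)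

theorem rate_nonneg {a b y₀ ε L c₀ ς ν : ℝ} (hab : a < b) (hc₀ : 0 < c₀) (hL : 0 ≤ L)
    (hν : 0 ≤ ν) (n m : ℕ) : 0 ≤ rate a b y₀ ε L c₀ ς ν n m := by
  have h := sub_pos.mpr hab
  have hlog : 0 ≤ Real.log n := Real.log_natCast_nonneg n
  unfold rate
  positivity

/-! ### From paths to risks and robust risks. -/

theorem not_good_of_short_window {a b μ₀ : ℝ} {n : ℕ} {l : Fin (gridSize n)}
    (h : ¬ 0 < (kTwo a b n (l + 1) : ℝ) - iotaIdx a b μ₀ n (l + 1) - 1) (y : ℕ → ℝ) :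
    ¬ good a b μ₀ n y := fun hg =>
  h (window_pos_of_threshold_pos (goodAt_of_good hg l).1)

/-- The oracle inequality for a fixed noise density and a fixed competitor. -/
theorem risk_selectedEst_le {a b : ℝ} (hab : a < b) {y₀ ε L μ₀ c₀ : ℝ} (hε : 0 < ε) (hε₁ : ε < 1)
    (hL : 0 < L) (hc₀ : 0 < c₀)
    {n : ℕ} (hn : 1 ≤ n)
    (hwin : ∀ l : ℕ, 1 ≤ l → l ≤ gridSize n →
      0 < (kTwo a b n l : ℝ) - iotaIdx a b μ₀ n l - 1 →
      c₀ * gridSize n ≤ (kTwo a b n l : ℝ) - iotaIdx a b μ₀ n l - 1)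
    {φ : Fin (gridSize n) → ℝ → ℝ} (hφ : EmpOrthonormal a b n φ)
    {Λ : Finset (Fin (gridSize n) → ℝ)} (hΛ : ∀ w ∈ Λ, ∀ j, w j ∈ Icc (0 : ℝ) 1)
    {S : ℝ → ℝ} (hS : S ∈ stabilitySet a b ε L) {δ : ℝ} (hδ : 0 < δ) (hδ' : δ ≤ 1 / 12)
    {W : (Fin n → ℝ) → Fin (gridSize n) → ℝ} (hW : IsSelector a b y₀ μ₀ φ δ Λ W)
    {ς : ℝ} (hς : 1 ≤ ς) {p : ℝ → ℝ} (hp : p ∈ densityClass ς)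
    {w₀ : Fin (gridSize n) → ℝ} (hw₀ : w₀ ∈ Λ) :
    risk a b y₀ (selectedEst a b y₀ μ₀ φ W) S p ≤
      ENNReal.ofReal ((1 + 4 * δ) * (1 + δ) ^ 2 / (1 - 6 * δ)) *
        risk a b y₀ (weightedEst a b y₀ μ₀ φ w₀) S p +
      ENNReal.ofReal (rate a b y₀ ε L c₀ ς Λ.card n (momentExponent n) / (δ * n)) := by
  have hK : (1 + 4 * δ) * (1 + δ) ^ 2 / (1 - 6 * δ) =
      (1 + 4 * δ) / (1 - 6 * δ) * (1 + δ) ^ 2 := by ring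
  rw [hK]
  by_cases hlong : ∀ l : Fin (gridSize n),
      0 < (kTwo a b n (l + 1) : ℝ) - iotaIdx a b μ₀ n (l + 1) - 1
  · have hw : WindowsLong a b μ₀ n c₀ := fun l =>
      ⟨hlong l, hwin _ (by omega) (Nat.succ_le_of_lt l.isLt) (hlong l)⟩
    have hm : 1 ≤ momentExponent n := Nat.le_add_left _ _
    have hm0 : (0 : ℝ) < momentExponent n := by exact_mod_cast hm
    set m := momentExponent n with hmdef
    have ht : (0 : ℝ) < 3 * (16 * m ^ 2 * ς ^ 2) := by positivity
    have hX : ((comparisonSet Λ w₀).card : ℝ) ≤ 2 * (Λ.card : ℝ) + 2 := by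
      exact_mod_cast card_comparisonSet_le Λ w₀
    obtain ⟨hI, hB⟩ := integral_remainder_le (y₀ := y₀) (S := S) hab hε hL.le hn hc₀ hw hφ hX hς hp
      hm (le_three_pow_momentExponent hn)
    have h := risk_le_of_pathwise (a := a) (b := b) (y₀ := y₀) (S := S) (p := p)
      (T₁ := selectedEst a b y₀ μ₀ φ W) (T₂ := weightedEst a b y₀ μ₀ φ w₀)
      (K := ENNReal.ofReal ((1 + 4 * δ) / (1 - 6 * δ) * (1 + δ) ^ 2)) ENNReal.ofReal_ne_top
      (R := fun ξ => remainder a b y₀ μ₀ ε L c₀ m (3 * (16 * m ^ 2 * ς ^ 2)) φ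
        (comparisonSet Λ w₀) S ξ / δ) ((measurable_remainder φ _).div_const δ)
      (fun ξ => pathwise_oracle hab hε hε₁ hL.le hn hS hc₀ hw hφ hΛ (hW.2 _).1 hw₀ hδ hδ' hm ht ξ
        ((hW.2 _).2 w₀ hw₀))
    refine h.trans (add_le_add le_rfl ?_)
    rw [← ofReal_integral_eq_lintegral_ofReal (hI.div_const δ)
      (ae_of_all _ fun ξ => div_nonneg (remainder_nonneg hab ht φ _ ξ) hδ.le), integral_div]
    refine ENNReal.ofReal_le_ofReal ?_
    rw [mul_comm δ, ← div_div]
    exact div_le_div_of_nonneg_right hB hδ.le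
  -- One window without positive length makes `good` impossible, so all estimators vanish
  -- identically and the inequality is trivial for such `n`.
  · push Not at hlong
    obtain ⟨l, hl⟩ := hlong
    have hbad := not_good_of_short_window (not_lt.mpr hl)
    have e : selectedEst a b y₀ μ₀ φ W = weightedEst a b y₀ μ₀ φ w₀ := by
      funext y t
      simp only [selectedEst, weightedEst, stepEst, gridEst, if_neg (hbad _)]
    rw [e]
    refine le_add_right (le_mul_of_one_le_left zero_le ?_)
    rw [ENNReal.one_le_ofReal]
    obtain ⟨hκ, -⟩ := oracle_const_bounds hδ hδ'
    nlinarith [sq_nonneg δ]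

end SeqAR

theorem mainTheorem4
    (a b : ℝ) (hab : a < b) (y₀ : ℝ)
    (ε : ℝ) (hε₀ : 0 < ε) (hε₁ : ε < 1) (L : ℝ) (hL : 0 < L)
    (μ₀ : ℝ) (hμ₀ : 0 < μ₀) (hμ₁ : μ₀ < 1)
    (vs : ℕ → ℝ) (hvs : ∀ n, 1 ≤ vs n) (hvs_lim : SubPoly vs)
    (ν : ℕ → ℕ) (hν_lim : SubPoly fun n => (ν n : ℝ)) :
    ∃ B : ℕ → ℝ, (∀ n, 0 ≤ B n) ∧ SubPoly B ∧
      ∀ n : ℕ, 3 ≤ n →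
      ∀ φ : Fin (gridSize n) → ℝ → ℝ, EmpOrthonormal a b n φ →
      ∀ Λ : Finset (Fin (gridSize n) → ℝ),
        (∀ w ∈ Λ, ∀ j, w j ∈ Set.Icc (0 : ℝ) 1) → Λ.card = ν n →
      ∀ S ∈ stabilitySet a b ε L,
      ∀ δ : ℝ, 0 < δ → δ ≤ 1 / 12 →
      ∀ W : (Fin n → ℝ) → Fin (gridSize n) → ℝ, IsSelector a b y₀ μ₀ φ δ Λ W →
        robustRisk a b y₀ (vs n) (selectedEst a b y₀ μ₀ φ W) S ≤
          ENNReal.ofReal ((1 + 4 * δ) * (1 + δ) ^ 2 / (1 - 6 * δ)) *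
              (⨅ w ∈ Λ, robustRisk a b y₀ (vs n) (weightedEst a b y₀ μ₀ φ w) S) +
            ENNReal.ofReal (B n / (δ * n)) := by
  obtain ⟨c₀, hc₀, hwin⟩ := exists_window_lower_bound (a := a) (b := b) hab hμ₁
  refine ⟨fun n => rate a b y₀ ε L c₀ (vs n) (ν n) n (momentExponent n),
    fun n => rate_nonneg hab hc₀ hL.le (Nat.cast_nonneg _) n _,
    subPoly_rate a b y₀ ε L c₀ hvs_lim hν_lim subPoly_momentExponent, ?_⟩
  intro n hn φ hφ Λ hΛ hcard S hS δ hδ hδ' W hW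
  have hn1 : 1 ≤ n := by omega
  -- The competitor minimises the robust risk and is fixed before the density. The remainder does
  -- not depend on the density, so the supremum may be taken on the left; `Λ` is nonempty because
  -- the selector takes values in it.
  obtain ⟨w₀, hw₀, hmin⟩ := Finset.exists_min_image Λ
    (fun w => robustRisk a b y₀ (vs n) (weightedEst a b y₀ μ₀ φ w) S) ⟨_, (hW.2 0).1⟩
  refine iSup₂_le fun p hp => ?_
  refine (risk_selectedEst_le hab hε₀ hε₁ hL hc₀ hn1 (hwin n hn1) hφ hΛ hS hδ hδ' hW (hvs n) hp
    hw₀).trans ?_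
  rw [hcard]
  refine add_le_add (mul_le_mul_right ?_ _) le_rfl
  exact (le_iSup₂ (f := fun p (_ : p ∈ densityClass (vs n)) =>
    risk a b y₀ (weightedEst a b y₀ μ₀ φ w₀) S p) p hp).trans (le_iInf₂ hmin)
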